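/- Let $\Omega\subset\mathbb R^3$ be the open unit ball centred at the origin, let $T>0$ and $\kappa>0$, and let $\overline\Delta$ be the Laplace--Beltrami operator on $\partial\Omega$, $\partial_\nu$ the outer normal derivative, and $\dot f$ the derivative in time. Put $$X^{3}_T(\partial\Omega)=C^0([0,T],H^3(\partial\Omega))\cap C^1([0,T],H^{3/2}(\partial\Omega))\cap C^2([0,T],L^2(\partial\Omega)),$$ $$X^{3/2}_T(\partial\Omega)=C^0([0,T],H^{3/2}(\partial\Omega))\cap C^1([0,T],L^{2}(\partial\Omega)),\qquad X^{2}_T(\Omega)=C^0([0,T],H^{2}(\Omega))\cap C^1([0,T],H^{1/2}(\Omega)),$$ where $X^{3/2}_T(\partial\Omega)$ has the norm $\sup_t\|f\|_{H^{3/2}(\partial\Omega)}+\sup_t\|\dot f\|_{L^2(\partial\Omega)}$. Let $\mathcal H=L^2([0,T]\times\partial\Omega)\times H^{3/2}(\partial\Omega)\times L^2(\partial\Omega)$ and $$\mathcal L:X^3_T(\partial\Omega)\to\mathcal H,\qquad \mathcal L(f)=(\ddot f-\kappa\overline\Delta\,\partial_\nu f,\ f(0),\ \dot f(0)),$$ where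 $\partial_\nu f$ is computed using the harmonic extension of $f$ to $\Omega$. Then there is exactly one continuous linear map $\overline{\mathcal L^{-1}}:\mathcal H\to X^{3/2}_T(\partial\Omega)$ such that $\overline{\mathcal L^{-1}}(\mathcal L f)=f$ for all $f\in X^3_T(\partial\Omega)$. For $G\in L^2([0,T]\times\partial\Omega)$, $f_0\in H^{3/2}(\partial\Omega)$ and $f_1\in L^2(\partial\Omega)$, call $f\in X^2_T(\Omega)$ a weak solution of $$\Delta f=0\ \text{in }\Omega,\qquad \ddot f-\kappa\overline\Delta\,\partial_\nu f=G\ \text{on }\partial\Omega,\qquad f(0)=f_0,\ \dot f(0)=f_1\ \text{on }\partial\Omega,$$ if $\Delta f=0$ in $\Omega$ at all times and the restriction $f|_{\partial\Omega}$ belongs to the closure of $X^3_T(\partial\Omega)$ in $X^{3/2}_T(\partial\Omega)$ and equals $\overline{\mathcal L^{-1}}(G,f_0,f_1)$. Then for all such $G$, $f_0$, $f_1$ there exists a unique weak solution. -/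

import Mathlib

open MeasureTheory Set Filter Topology
open scoped ContDiff ENNReal

namespace DynamicBoundary

noncomputable section

/-! ## Geometry: the unit ball of `ℝ³` and its boundary -/

/-- Euclidean space `ℝ³`. -/
abbrev E3 : Type := EuclideanSpace ℝ (Fin 3)

/-- The unit ball `Ω`. -/
abbrev Om : Set E3 := Metric.ball (0 : E3) 1

/-- The boundary `∂Ω`, the unit sphere, as a type (with the chordal distance). -/
abbrev Sph : Type := Metric.sphere (0 : E3) 1

/-- Lebesgue measure on `Ω`. -/
abbrev volOm : Measure E3 := (volume : Measure E3).restrict Om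

/-- Surface measure on `∂Ω` (total mass `4π`). -/
abbrev sigma : Measure Sph := (volume : Measure E3).toSphere

/-- The real Hilbert space `L²(μ)`. -/
abbrev L2 {X : Type*} [MeasurableSpace X] (μ : Measure X) : Type _ := Lp ℝ 2 μ

/-- The partial derivative `∂ᵢ φ` of a smooth function on `ℝ³`. -/
def pderiv (i : Fin 3) (φ : E3 → ℝ) (x : E3) : ℝ :=
  fderiv ℝ φ x (EuclideanSpace.single i 1)

/-- The rotational derivative `Rᵢ φ = xᵢ₊₁ ∂ᵢ₊₂ φ - xᵢ₊₂ ∂ᵢ₊₁ φ` (indices modulo 3). The fields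
`R₀, R₁, R₂` are the infinitesimal rotations `eᵢ × x`: they are tangent to the sphere, divergence
free and span every tangent plane; on the unit sphere `∑ᵢ (Rᵢ φ)² = |∇_∂ φ|²`, and
`∑ᵢ Rᵢ Rᵢ φ` is the Laplace-Beltrami operator applied to `φ`. -/
def rderiv (i : Fin 3) (φ : E3 → ℝ) (x : E3) : ℝ :=
  x (i + 1) * pderiv (i + 2) φ x - x (i + 2) * pderiv (i + 1) φ x

/-! ## Weak derivatives -/

/-- The graph of a weak derivative in `L²(μ)`: given the set `P` of all pairs `(φ, Dφ)` of a test
function and its derivative, `v = D u` weakly when `∫ v φ = - ∫ u Dφ` for all test functions. -/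
def weakGraph {X : Type*} [MeasurableSpace X] (μ : Measure X) (P : Set ((X → ℝ) × (X → ℝ)))
    (hP : ∀ p ∈ P, MemLp p.1 2 μ ∧ MemLp p.2 2 μ) : Submodule ℝ (L2 μ × L2 μ) where
  carrier := {w | ∀ p ∈ P, ∫ x, w.2 x * p.1 x ∂μ = - ∫ x, w.1 x * p.2 x ∂μ}
  zero_mem' := by
    intro p hp
    have h : ∀ q : X → ℝ, ∫ x, (0 : L2 μ) x * q x ∂μ = 0 := fun q => by
      rw [integral_congr_ae (g := fun _ => (0 : ℝ)), integral_zero]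
      filter_upwards [Lp.coeFn_zero ℝ 2 μ] with x hx
      rw [hx, Pi.zero_apply, zero_mul]
    simp only [Prod.snd_zero, Prod.fst_zero, h, neg_zero]
  add_mem' := by
    intro a b ha hb p hp
    have h : ∀ (u v : L2 μ) (q : X → ℝ), MemLp q 2 μ →
        ∫ x, (u + v : L2 μ) x * q x ∂μ = ∫ x, u x * q x ∂μ + ∫ x, v x * q x ∂μ := by
      intro u v q hq
      have hu : Integrable (fun x => u x * q x) μ := (Lp.memLp u).integrable_mul hq
      have hv : Integrable (fun x => v x * q x) μ := (Lp.memLp v).integrable_mul hq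
      rw [← integral_add hu hv]
      refine integral_congr_ae ?_
      filter_upwards [Lp.coeFn_add u v] with x hx
      rw [hx, Pi.add_apply, add_mul]
    simp only [Prod.snd_add, Prod.fst_add]
    rw [h _ _ _ (hP p hp).1, h _ _ _ (hP p hp).2, ha p hp, hb p hp]
    ring
  smul_mem' := by
    intro c a ha p hp
    have h : ∀ (u : L2 μ) (q : X → ℝ),
        ∫ x, (c • u : L2 μ) x * q x ∂μ = c * ∫ x, u x * q x ∂μ := by
      intro u q
      rw [← integral_const_mul]
      refine integral_congr_ae ?_
      filter_upwards [Lp.coeFn_smul c u] with x hx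
      rw [hx, Pi.smul_apply, smul_eq_mul, mul_assoc]
    simp only [Prod.smul_snd, Prod.smul_fst]
    rw [h, h, ha p hp]
    ring

/-- Test pairs on `Ω`: `φ ∈ C_c^∞(Ω)` with `∂ᵢ φ`. -/
def ballTest (i : Fin 3) : Set ((E3 → ℝ) × (E3 → ℝ)) :=
  {p | ContDiff ℝ ∞ p.1 ∧ HasCompactSupport p.1 ∧ tsupport p.1 ⊆ Om ∧ p.2 = pderiv i p.1}

/-- Test pairs on `∂Ω`: the restriction of a smooth `φ` on `ℝ³` with that of `Rᵢ φ`. -/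
def sphereTest (i : Fin 3) : Set ((Sph → ℝ) × (Sph → ℝ)) :=
  {p | ∃ φ : E3 → ℝ, ContDiff ℝ ∞ φ ∧ p.1 = (fun x : Sph => φ x) ∧
    p.2 = fun x : Sph => rderiv i φ x}

theorem continuous_pderiv (i : Fin 3) {φ : E3 → ℝ} (h : ContDiff ℝ ∞ φ) :
    Continuous (pderiv i φ) :=
  (h.continuous_fderiv (by simp)).clm_apply continuous_const

theorem memLp_ballTest (i : Fin 3) (p : (E3 → ℝ) × (E3 → ℝ)) (hp : p ∈ ballTest i) :
    MemLp p.1 2 volOm ∧ MemLp p.2 2 volOm := by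
  obtain ⟨h1, h2, -, h4⟩ := hp
  refine ⟨(h1.continuous.memLp_of_hasCompactSupport h2), ?_⟩
  rw [h4]
  exact (continuous_pderiv i h1).memLp_of_hasCompactSupport
    ((h2.fderiv ℝ).mono' fun x hx => subset_closure (by
      simp only [Function.mem_support, pderiv] at hx ⊢
      intro h0
      simp [h0] at hx))

theorem memLp_sphereTest (i : Fin 3) (p : (Sph → ℝ) × (Sph → ℝ)) (hp : p ∈ sphereTest i) :
    MemLp p.1 2 sigma ∧ MemLp p.2 2 sigma := by
  obtain ⟨φ, h1, h2, h3⟩ := hp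
  have hc : ∀ f : Sph → ℝ, Continuous f → MemLp f 2 sigma := fun f hf =>
    hf.memLp_of_hasCompactSupport (HasCompactSupport.of_compactSpace f)
  rw [h2, h3]
  refine ⟨hc _ (h1.continuous.comp continuous_subtype_val), hc _ ?_⟩
  have h5 := fun j => continuous_pderiv j h1
  have h6 : Continuous (rderiv i φ) := by
    unfold rderiv
    fun_prop
  exact h6.comp continuous_subtype_val

/-- The weak partial derivative `∂ᵢ` in `L²(Ω)`, as a graph. -/
def ballD (i : Fin 3) : Submodule ℝ (L2 volOm × L2 volOm) :=
  weakGraph volOm (ballTest i) (memLp_ballTest i)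

/-- The weak tangential derivative `Rᵢ` in `L²(∂Ω)`, as a graph. -/
def sphereD (i : Fin 3) : Submodule ℝ (L2 sigma × L2 sigma) :=
  weakGraph sigma (sphereTest i) (memLp_sphereTest i)

/-! ## Sobolev spaces

The elements of a Sobolev space are the families made of a function and of its weak derivatives
(and, for fractional order, of the difference function of the derivatives of highest order). Such
a family is determined by the function, its component `base`. The norms are the usual ones:
`‖u‖²` is the sum of the squares of the `L²` norms of the members of the family. -/

/-- Words of length at most `m` in the indices `0, 1, 2`. -/
abbrev Words (m : ℕ) : Type := Σ k : Fin (m + 1), (Fin (k : ℕ) → Fin 3)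

/-- The word `α` of length `k ≤ m`. -/
abbrev word {m : ℕ} (k : ℕ) (hk : k ≤ m) (α : Fin k → Fin 3) : Words m :=
  ⟨⟨k, Nat.lt_succ_of_le hk⟩, α⟩

/-- The space `H^m` for integer `m`: families `U` with `Dᵢ U_α = U_{iα}` weakly. Its norm is
`‖u‖²_m = ∑_{k ≤ m} ‖D^k u‖²_{L²}`. -/
def sobolev {X : Type*} [MeasurableSpace X] {μ : Measure X}
    (D : Fin 3 → Submodule ℝ (L2 μ × L2 μ)) (m : ℕ) :
    Submodule ℝ (PiLp 2 (fun _ : Words m => L2 μ)) where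
  carrier := {U | ∀ (k : ℕ) (hk : k + 1 ≤ m) (α : Fin k → Fin 3) (i : Fin 3),
    (U (word k (Nat.le_of_succ_le hk) α), U (word (k + 1) hk (Fin.cons i α))) ∈ D i}
  zero_mem' := fun _ _ _ i => (D i).zero_mem
  add_mem' := fun ha hb k hk α i => (D i).add_mem (ha k hk α i) (hb k hk α i)
  smul_mem' := fun c _ ha k hk α i => (D i).smul_mem c (ha k hk α i)

/-- The measure `|x - y|^{-(n + 2σ)} dμ(x) dμ(y)` for `σ = 1/2`, where `n` is the dimension. -/
def gagliardo {X : Type*} [MeasurableSpace X] [Dist X] (n : ℕ) (μ : Measure X) :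
    Measure (X × X) :=
  (μ.prod μ).withDensity fun p => ENNReal.ofReal ((dist p.1 p.2 ^ (n + 1))⁻¹)

/-- The space `H^{m + 1/2}` in dimension `n`: families `(U, V)` with `U ∈ H^m` and
`V_α(x, y) = U_α(x) - U_α(y)` for all words `α` of length `m`, where `V_α` is square integrable
with respect to `|x - y|^{-(n + 1)} dμ(x) dμ(y)`. Its norm is
`‖u‖²_{m+1/2} = ‖u‖²_m + [D^m u]²_{1/2}`. -/
def sobolevHalf {X : Type*} [MeasurableSpace X] [Dist X] {μ : Measure X} [SFinite μ] (n : ℕ)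
    (D : Fin 3 → Submodule ℝ (L2 μ × L2 μ)) (m : ℕ) :
    Submodule ℝ (WithLp 2 (PiLp 2 (fun _ : Words m => L2 μ) ×
      PiLp 2 (fun _ : Fin m → Fin 3 => L2 (gagliardo n μ)))) where
  carrier := {W | W.fst ∈ sobolev D m ∧ ∀ α : Fin m → Fin 3,
    W.snd α =ᵐ[gagliardo n μ] fun p => W.fst (word m le_rfl α) p.1 - W.fst (word m le_rfl α) p.2}
  zero_mem' := by
    refine ⟨(sobolev D m).zero_mem, fun α => ?_⟩
    have hac : gagliardo n μ ≪ μ.prod μ := withDensity_absolutelyContinuous _ _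
    have h := Lp.coeFn_zero ℝ 2 μ
    filter_upwards [Lp.coeFn_zero ℝ 2 (gagliardo n μ),
      hac.ae_le (Measure.quasiMeasurePreserving_fst.ae h),
      hac.ae_le (Measure.quasiMeasurePreserving_snd.ae h)] with p h1 h2 h3
    simp only [WithLp.zero_fst, WithLp.zero_snd, PiLp.zero_apply]
    rw [h1, h2, h3]
    simp
  add_mem' := by
    intro a b ha hb
    refine ⟨(sobolev D m).add_mem ha.1 hb.1, fun α => ?_⟩
    have hac : gagliardo n μ ≪ μ.prod μ := withDensity_absolutelyContinuous _ _
    have h := Lp.coeFn_add (a.fst (word m le_rfl α)) (b.fst (word m le_rfl α))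
    filter_upwards [Lp.coeFn_add (a.snd α) (b.snd α), ha.2 α, hb.2 α,
      hac.ae_le (Measure.quasiMeasurePreserving_fst.ae h),
      hac.ae_le (Measure.quasiMeasurePreserving_snd.ae h)] with p h1 h4 h5 h2 h3
    simp only [WithLp.add_fst, WithLp.add_snd, PiLp.add_apply]
    rw [h1, h2, h3]
    simp only [Pi.add_apply, h4, h5]
    ring
  smul_mem' := by
    intro c a ha
    refine ⟨(sobolev D m).smul_mem c ha.1, fun α => ?_⟩
    have hac : gagliardo n μ ≪ μ.prod μ := withDensity_absolutelyContinuous _ _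
    have h := Lp.coeFn_smul c (a.fst (word m le_rfl α))
    filter_upwards [Lp.coeFn_smul c (a.snd α), ha.2 α,
      hac.ae_le (Measure.quasiMeasurePreserving_fst.ae h),
      hac.ae_le (Measure.quasiMeasurePreserving_snd.ae h)] with p h1 h4 h2 h3
    simp only [WithLp.smul_fst, WithLp.smul_snd, PiLp.smul_apply]
    rw [h1, h2, h3]
    simp only [Pi.smul_apply, h4, smul_eq_mul]
    ring

/-- The function underlying an element of `H^m`. -/
def base {X : Type*} [MeasurableSpace X] {μ : Measure X}
    {D : Fin 3 → Submodule ℝ (L2 μ × L2 μ)} {m : ℕ} (U : sobolev D m) : L2 μ :=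
  U.1 (word 0 (Nat.zero_le m) ![])

/-- The function underlying an element of `H^{m + 1/2}`. -/
def baseHalf {X : Type*} [MeasurableSpace X] [Dist X] {μ : Measure X} [SFinite μ] {n : ℕ}
    {D : Fin 3 → Submodule ℝ (L2 μ × L2 μ)} {m : ℕ} (U : sobolevHalf n D m) : L2 μ :=
  U.1.fst (word 0 (Nat.zero_le m) ![])

/-- `∑ᵢ Dᵢ Dᵢ u` for `u ∈ H²`: the Laplacian `Δ` on `Ω` for `D = ballD`, and the
Laplace-Beltrami operator `Δ̄` on `∂Ω` for `D = sphereD`. -/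
def lap {X : Type*} [MeasurableSpace X] {μ : Measure X}
    {D : Fin 3 → Submodule ℝ (L2 μ × L2 μ)} (U : sobolev D 2) : L2 μ :=
  ∑ i : Fin 3, U.1 (word 2 le_rfl ![i, i])

/-- `H⁰(∂Ω) = L²(∂Ω)`. -/
abbrev H0S : Type := L2 sigma

/-- `H^{3/2}(∂Ω)`. -/
abbrev H32S : Type := sobolevHalf 2 sphereD 1

/-- `H²(∂Ω)`. -/
abbrev H2S : Type := sobolev sphereD 2

/-- `H³(∂Ω)`. -/
abbrev H3S : Type := sobolev sphereD 3

/-- `H^{1/2}(Ω)`. -/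
abbrev H12Om : Type := sobolevHalf 3 ballD 0

/-- `H²(Ω)`. -/
abbrev H2Om : Type := sobolev ballD 2

/-! ## Traces, harmonic extension, normal derivative -/

/-- `g` is the boundary trace of the function `u ∈ H¹(Ω)` with gradient `du`: some sequence of
functions that are smooth up to the boundary converges to `u` in `H¹(Ω)` while its restrictions
to `∂Ω` converge to `g` in `L²(∂Ω)`. -/
def IsTrace (u : L2 volOm) (du : Fin 3 → L2 volOm) (g : H0S) : Prop :=
  ∃ φ : ℕ → E3 → ℝ, (∀ n, ContDiff ℝ ∞ (φ n)) ∧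
    Tendsto (fun n => eLpNorm (fun x => φ n x - u x) 2 volOm) atTop (𝓝 0) ∧
    (∀ j, Tendsto (fun n => eLpNorm (fun x => pderiv j (φ n) x - du j x) 2 volOm)
      atTop (𝓝 0)) ∧
    Tendsto (fun n => eLpNorm (fun x : Sph => φ n x - g x) 2 sigma) atTop (𝓝 0)

/-- `g` is the restriction to `∂Ω` of `F ∈ H²(Ω)`. -/
def IsBdry (F : H2Om) (g : H0S) : Prop :=
  IsTrace (base F) (fun j => F.1 (word 1 one_le_two ![j])) g

/-- `h` is the outer normal derivative `∂_ν F = ∑ᵢ xᵢ ∂ᵢ F` on `∂Ω` of `F ∈ H²(Ω)`. -/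
def IsNormalDeriv (F : H2Om) (h : H0S) : Prop :=
  ∃ τ : Fin 3 → H0S,
    (∀ i, IsTrace (F.1 (word 1 one_le_two ![i])) (fun j => F.1 (word 2 le_rfl ![j, i])) (τ i)) ∧
    h =ᵐ[sigma] fun x => ∑ i : Fin 3, (x : E3) i * τ i x

/-- `q = Δ̄ ∂_ν g`, where `∂_ν g` is computed using the harmonic extension `F` of `g` to `Ω`. -/
def IsLapNormal (g q : H0S) : Prop :=
  ∃ (F : H2Om) (V : H2S), lap F = 0 ∧ IsBdry F g ∧ IsNormalDeriv F (base V) ∧ q = lap V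

/-! ## Spaces of curves -/

/-- `g` is the derivative of the curve `f : [0, T] → H` (one-sided at the end points), with
respect to the norm of `H`. -/
def HasTimeDeriv {T : ℝ} {H : Type*} [NormedAddCommGroup H] [NormedSpace ℝ H]
    (f g : Icc (0 : ℝ) T → H) : Prop :=
  ∀ t : Icc (0 : ℝ) T, Tendsto (fun s : Icc (0 : ℝ) T => ((s : ℝ) - (t : ℝ))⁻¹ • (f s - f t))
    (𝓝[≠] t) (𝓝 (g t))

theorem baseHalf_add {n : ℕ} {X : Type*} [MeasurableSpace X] [Dist X] {μ : Measure X} [SFinite μ]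
    {D : Fin 3 → Submodule ℝ (L2 μ × L2 μ)} {m : ℕ} (U V : sobolevHalf n D m) :
    baseHalf (U + V) = baseHalf U + baseHalf V := rfl

theorem baseHalf_smul {n : ℕ} {X : Type*} [MeasurableSpace X] [Dist X] {μ : Measure X} [SFinite μ]
    {D : Fin 3 → Submodule ℝ (L2 μ × L2 μ)} {m : ℕ} (c : ℝ) (U : sobolevHalf n D m) :
    baseHalf (c • U) = c • baseHalf U := rfl

theorem baseHalf_zero {n : ℕ} {X : Type*} [MeasurableSpace X] [Dist X] {μ : Measure X} [SFinite μ]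
    {D : Fin 3 → Submodule ℝ (L2 μ × L2 μ)} {m : ℕ} :
    baseHalf (0 : sobolevHalf n D m) = 0 := rfl

instance : NormedAddCommGroup H32S := Submodule.normedAddCommGroup _

instance : NormedSpace ℝ H32S := Submodule.normedSpace _

instance : Module ℝ H32S := NormedSpace.toModule

instance (T : ℝ) : NormedSpace ℝ C(Icc (0 : ℝ) T, H32S) := ContinuousMap.normedSpace

instance (T : ℝ) : Module ℝ C(Icc (0 : ℝ) T, H32S) := NormedSpace.toModule

/-- The space `X^{3/2}_T(∂Ω) = C⁰([0,T], H^{3/2}(∂Ω)) ∩ C¹([0,T], H⁰(∂Ω))`, whose elements are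
the pairs `(f, ḟ)`, with the norm `sup ‖f‖_{3/2} + sup ‖ḟ‖_0`. -/
def X32 (T : ℝ) : Submodule ℝ (WithLp 1 (C(Icc (0 : ℝ) T, H32S) × C(Icc (0 : ℝ) T, H0S))) where
  carrier := {w | HasTimeDeriv (fun t => baseHalf (w.fst t)) w.snd}
  zero_mem' := by
    intro t
    simp only [WithLp.zero_fst, WithLp.zero_snd, ContinuousMap.zero_apply, sub_self, smul_zero]
    exact tendsto_const_nhds
  add_mem' := by
    intro a b ha hb t
    refine ((ha t).add (hb t)).congr fun s => ?_
    simp only [WithLp.add_fst, ContinuousMap.add_apply, baseHalf_add, ← smul_add]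
    congr 1
    abel
  smul_mem' := by
    intro c a ha t
    refine ((ha t).const_smul c).congr fun s => ?_
    simp only [WithLp.smul_fst, ContinuousMap.smul_apply, baseHalf_smul]
    rw [smul_comm, smul_sub]

/-- `X^3_T(∂Ω) = C⁰([0,T], H³(∂Ω)) ∩ C¹([0,T], H^{3/2}(∂Ω)) ∩ C²([0,T], H⁰(∂Ω))` as a subset of
`X^{3/2}_T(∂Ω)`. -/
def X3 (T : ℝ) : Set (X32 T) :=
  {w | (∃ f : C(Icc (0 : ℝ) T, H3S), ∀ t, base (f t) = baseHalf (w.1.fst t)) ∧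
    (∃ f' : C(Icc (0 : ℝ) T, H32S), (∀ t, baseHalf (f' t) = w.1.snd t) ∧
      HasTimeDeriv w.1.fst f') ∧
    ∃ f'' : C(Icc (0 : ℝ) T, H0S), HasTimeDeriv w.1.snd f''}

/-- A curve `f : [0,T] → L²(Ω)` belongs to
`X²_T(Ω) = C⁰([0,T], H²(Ω)) ∩ C¹([0,T], H^{1/2}(Ω))`. -/
def InX2 {T : ℝ} (f : Icc (0 : ℝ) T → L2 volOm) : Prop :=
  (∃ F : C(Icc (0 : ℝ) T, H2Om), ∀ t, base (F t) = f t) ∧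
  ∃ F F' : C(Icc (0 : ℝ) T, H12Om), (∀ t, baseHalf (F t) = f t) ∧ HasTimeDeriv F F'

/-! ## The map `ℒ`, the extension of its inverse, and weak solutions -/

/-- Lebesgue measure on `[0,T]`. -/
abbrev volT (T : ℝ) : Measure (Icc (0 : ℝ) T) := (volume : Measure ℝ).comap Subtype.val

instance (T : ℝ) : IsFiniteMeasure (volT T) where
  measure_univ_lt_top := by
    rw [(MeasurableEmbedding.subtype_coe measurableSet_Icc).comap_apply]
    refine lt_of_le_of_lt (measure_mono (Subtype.coe_image_subset _ _)) ?_
    simp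

/-- `L²([0,T] × ∂Ω)`. -/
abbrev L2T (T : ℝ) : Type := L2 ((volT T).prod sigma)

/-- The data space `ℋ = L²([0,T] × ∂Ω) × H^{3/2}(∂Ω) × H⁰(∂Ω)`. -/
abbrev Data (T : ℝ) : Type := L2T T × H32S × H0S

/-- `ℒ w = d` for a curve `w ∈ X^3_T(∂Ω)`, that is,
`d = (ẅ - κ Δ̄ ∂_ν w, w(0), ẇ(0))`. -/
def IsL (κ : ℝ) {T : ℝ} (w : X32 T) (d : Data T) : Prop :=
  w ∈ X3 T ∧
  (∃ (w'' : C(Icc (0 : ℝ) T, H0S)) (q : Icc (0 : ℝ) T → H0S),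
    HasTimeDeriv w.1.snd w'' ∧ (∀ t, IsLapNormal (baseHalf (w.1.fst t)) (q t)) ∧
    ∀ᵐ t ∂(volT T), (fun x => d.1 (t, x)) =ᵐ[sigma] (w'' t - κ • q t : H0S)) ∧
  ∀ t : Icc (0 : ℝ) T, (t : ℝ) = 0 → d.2.1 = w.1.fst t ∧ d.2.2 = w.1.snd t

/-- `S : ℋ → X^{3/2}_T(∂Ω)` is a continuous linear map that extends the inverse of `ℒ`, that is,
`S (ℒ w) = w` for all `w ∈ X^3_T(∂Ω)`. -/
def ExtendsInverse (κ : ℝ) {T : ℝ} (S : Data T →L[ℝ] X32 T) : Prop :=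
  ∀ w d, IsL κ w d → S d = w

/-- `f` is a weak solution with data `(G, f₀, f₁)`: it belongs to `X²_T(Ω)`, its restriction to
`∂Ω` belongs to the closure of `X^3_T(∂Ω)` in `X^{3/2}_T(∂Ω)` and is the image of the data under
the continuous linear extension of `ℒ⁻¹`, and `Δ f = 0` in `Ω` at all times. -/
def IsWeakSolution (κ : ℝ) {T : ℝ} (G : L2T T) (f₀ : H32S) (f₁ : H0S)
    (f : Icc (0 : ℝ) T → L2 volOm) : Prop :=
  InX2 f ∧
  ∃ w ∈ closure (X3 T),
    (∀ t, ∃ F : H2Om, base F = f t ∧ lap F = 0 ∧ IsBdry F (baseHalf (w.1.fst t))) ∧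
    ∃ S : Data T →L[ℝ] X32 T, ExtendsInverse κ S ∧ w = S (G, f₀, f₁)

end

end DynamicBoundary

/-!
Spherical harmonics diagonalise the problem. A solid harmonic `h` of degree `l` (a harmonic
polynomial, homogeneous of degree `l`) satisfies `∂_ν h = l h` and `Δ̄ h = -l (l + 1) h` on the unit
sphere, so the coefficient `φ` of `ḧ - κ Δ̄ ∂_ν` along `h` obeys the oscillator equation
`φ'' + κ l² (l + 1) φ = g`. Duhamel's formula expresses `φ` and `φ'` by bounded linear functionals
of the data (`duhPos`, `duhVel`), and every solution in `X^3_T(∂Ω)` has these coefficients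
(`IsL.isDuhamel`), because `Δ̄ ∂_ν` acts on coefficients as multiplication by `-l² (l + 1)`
(`IsLapNormal.inner_eq`, from Green's formula). Since `l² (l + 1)` is comparable with
`(1 + l)³` for `l ≥ 1`, Bessel's inequality turns Duhamel's formula into the energy estimate
`‖w‖ ≤ C ‖d‖` in the norm of `X^{3/2}_T(∂Ω)` (`exists_norm_le`). The single modes `φ(t) h` provide
solutions in `X^3_T(∂Ω)` whose data are total in `ℋ` (`eq_top_of_isL`). As `X^{3/2}_T(∂Ω)` is
complete, the relation between data and solution is therefore a bounded operator, it is the only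
continuous extension of `ℒ⁻¹`, and its values are limits of elements of `X^3_T(∂Ω)`.

The estimate needs the spectral description of `H^{3/2}(∂Ω)`, whose norm is the one of Gagliardo:
`u ∈ H^{3/2}(∂Ω)` has coefficients that are square summable with the weight `(1 + l)³`, and
conversely (`Jw`, `Bw`). The link is the Poisson kernel of the ball: integrated against
`(v(x) - v(y))²` it gives `2 ∑ (1 - r^l) v_l²`. Up to constants this is at most `1 - r` times the
square of the Gagliardo seminorm of `v`, and by Fatou's lemma that square is at most the limit
of the sum divided by `1 - r` as `r → 1`; both are applied to tangential derivatives.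
The kernel is evaluated on
solid harmonics through Green's formula on the sphere, and totality of spherical harmonics follows
from the Stone-Weierstrass theorem, as products of coordinates with solid harmonics decompose into
solid harmonics.

Finally, the harmonic extension is bounded from `H^{3/2}(∂Ω)` to `H²(Ω)` (`E2`) and from `L²(∂Ω)` to
`H^{1/2}(Ω)` (`E0`), so it maps `X^{3/2}_T(∂Ω)` to `X²_T(Ω)`. It is the only harmonic function in
`H²(Ω)` with the given trace (`base_eq_of_harmonic`): a harmonic function with trace zero is
orthogonal to `Δ((|x|^{2k+2} - 1) h)` and hence to all `|x|^{2k} h`, which are total in `L²(Ω)`.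
-/

namespace DynamicBoundary

noncomputable section

open scoped InnerProductSpace

/-! ### Calculus on `ℝ³` -/

theorem contDiff_pderiv (i : Fin 3) {φ : E3 → ℝ} (h : ContDiff ℝ ∞ φ) :
    ContDiff ℝ ∞ (pderiv i φ) :=
  (h.fderiv_right (m := ∞) (by simp)).clm_apply contDiff_const

theorem contDiff_coord (i : Fin 3) : ContDiff ℝ ∞ (fun x : E3 => x i) :=
  (EuclideanSpace.proj (𝕜 := ℝ) i).contDiff

theorem contDiff_rderiv (i : Fin 3) {φ : E3 → ℝ} (h : ContDiff ℝ ∞ φ) :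
    ContDiff ℝ ∞ (rderiv i φ) :=
  ((contDiff_coord _).mul (contDiff_pderiv _ h)).sub
    ((contDiff_coord _).mul (contDiff_pderiv _ h))

theorem ContDiff.diffAt {φ : E3 → ℝ} (h : ContDiff ℝ ∞ φ) (x : E3) : DifferentiableAt ℝ φ x :=
  h.differentiable (by simp) x

theorem pderiv_add (i : Fin 3) {φ ψ : E3 → ℝ} (h : ContDiff ℝ ∞ φ) (k : ContDiff ℝ ∞ ψ) (x : E3) :
    pderiv i (fun y => φ y + ψ y) x = pderiv i φ x + pderiv i ψ x := by
  simp [pderiv, fderiv_fun_add (ContDiff.diffAt h x) (ContDiff.diffAt k x)]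

theorem pderiv_sub (i : Fin 3) {φ ψ : E3 → ℝ} (h : ContDiff ℝ ∞ φ) (k : ContDiff ℝ ∞ ψ) (x : E3) :
    pderiv i (fun y => φ y - ψ y) x = pderiv i φ x - pderiv i ψ x := by
  simp [pderiv, fderiv_fun_sub (ContDiff.diffAt h x) (ContDiff.diffAt k x)]

theorem pderiv_const_mul (i : Fin 3) {φ : E3 → ℝ} (c : ℝ) (h : ContDiff ℝ ∞ φ) (x : E3) :
    pderiv i (fun y => c * φ y) x = c * pderiv i φ x := by
  simp [pderiv, fderiv_const_mul (ContDiff.diffAt h x)]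

theorem pderiv_mul (i : Fin 3) {φ ψ : E3 → ℝ} (h : ContDiff ℝ ∞ φ) (k : ContDiff ℝ ∞ ψ) (x : E3) :
    pderiv i (fun y => φ y * ψ y) x = φ x * pderiv i ψ x + pderiv i φ x * ψ x := by
  simp [pderiv, fderiv_fun_mul (ContDiff.diffAt h x) (ContDiff.diffAt k x), mul_comm]

theorem pderiv_sum (i : Fin 3) {ι : Type*} (s : Finset ι) {φ : ι → E3 → ℝ}
    (h : ∀ j ∈ s, ContDiff ℝ ∞ (φ j)) (x : E3) :
    pderiv i (fun y => ∑ j ∈ s, φ j y) x = ∑ j ∈ s, pderiv i (φ j) x := by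
  simp [pderiv, fderiv_fun_sum fun j hj => ContDiff.diffAt (h j hj) x]

theorem pderiv_const (i : Fin 3) (c : ℝ) (x : E3) : pderiv i (fun _ => c) x = 0 := by
  simp [pderiv]

theorem pderiv_coord (i j : Fin 3) (x : E3) :
    pderiv i (fun y : E3 => y j) x = if i = j then 1 else 0 := by
  have : fderiv ℝ (fun y : E3 => y j) x = EuclideanSpace.proj (𝕜 := ℝ) j :=
    (EuclideanSpace.proj (𝕜 := ℝ) j).fderiv
  simp [pderiv, this, eq_comm]

theorem contDiff_normSq : ContDiff ℝ ∞ (fun x : E3 => ‖x‖ ^ 2) := contDiff_norm_sq ℝ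

theorem normSq_eq (x : E3) : ‖x‖ ^ 2 = x 0 ^ 2 + x 1 ^ 2 + x 2 ^ 2 := by
  rw [EuclideanSpace.norm_sq_eq]; simp [Fin.sum_univ_three]

theorem pderiv_normSq (i : Fin 3) (x : E3) : pderiv i (fun y : E3 => ‖y‖ ^ 2) x = 2 * x i := by
  have : (fun y : E3 => ‖y‖ ^ 2) = fun y => y 0 * y 0 + y 1 * y 1 + y 2 * y 2 := by
    ext y; rw [normSq_eq]; ring
  rw [this, pderiv_add i (by fun_prop) (by fun_prop), pderiv_add i (by fun_prop) (by fun_prop),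
    pderiv_mul i (contDiff_coord _) (contDiff_coord _),
    pderiv_mul i (contDiff_coord _) (contDiff_coord _),
    pderiv_mul i (contDiff_coord _) (contDiff_coord _)]
  simp only [pderiv_coord]
  fin_cases i <;> simp <;> ring

theorem pderiv_comm (i j : Fin 3) {φ : E3 → ℝ} (h : ContDiff ℝ ∞ φ) (x : E3) :
    pderiv i (pderiv j φ) x = pderiv j (pderiv i φ) x := by
  have key : ∀ v w : E3, fderiv ℝ (fun y => fderiv ℝ φ y v) x w = fderiv ℝ (fderiv ℝ φ) x w v := by
    intro v w
    have hd : DifferentiableAt ℝ (fderiv ℝ φ) x :=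
      (h.fderiv_right (m := ∞) (by simp)).differentiable (by simp) x
    rw [fderiv_clm_apply hd (differentiableAt_const v)]
    simp
  have hs : IsSymmSndFDerivAt ℝ φ x := h.contDiffAt.isSymmSndFDerivAt (by simp; exact WithTop.coe_le_coe.2 (le_top : (2 : ℕ∞) ≤ ⊤))
  change fderiv ℝ (fun y => fderiv ℝ φ y _) x _ = fderiv ℝ (fun y => fderiv ℝ φ y _) x _
  rw [key, key]
  exact hs _ _

theorem fderiv_eq_sum {φ : E3 → ℝ} (x v : E3) : fderiv ℝ φ x v = ∑ i, v i * pderiv i φ x := by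
  have hv : v = ∑ i, v i • EuclideanSpace.single i (1 : ℝ) := by
    ext j
    simp [Finset.sum_apply, Pi.single_apply]
  conv_lhs => rw [hv]
  simp [pderiv]

theorem pderiv_comp_smul (i : Fin 3) {φ : E3 → ℝ} (h : ContDiff ℝ ∞ φ) (c : ℝ) (x : E3) :
    pderiv i (fun y => φ (c • y)) x = c * pderiv i φ (c • x) := by
  have h1 : HasFDerivAt (fun y : E3 => c • y) (c • ContinuousLinearMap.id ℝ E3) x :=
    (hasFDerivAt_id x).const_smul c
  have h2 := (ContDiff.diffAt h (c • x)).hasFDerivAt.comp x h1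
  have h3 : fderiv ℝ (fun y => φ (c • y)) x = _ := h2.fderiv
  simp [pderiv, h3]

/-- The derivative along the ray through `x`. -/
theorem hasDerivAt_ray {φ : E3 → ℝ} (h : ContDiff ℝ ∞ φ) (x : E3) (r : ℝ) :
    HasDerivAt (fun c : ℝ => φ (c • x)) (∑ i, x i * pderiv i φ (r • x)) r := by
  have h1 : HasDerivAt (fun c : ℝ => c • x) x r := by
    simpa using (hasDerivAt_id r).smul_const x
  have h2 := (ContDiff.diffAt h (r • x)).hasFDerivAt.comp_hasDerivAt r h1
  rwa [fderiv_eq_sum] at h2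

/-- Product rule for the rotational derivatives. -/
theorem rderiv_mul (i : Fin 3) {φ ψ : E3 → ℝ} (h : ContDiff ℝ ∞ φ) (k : ContDiff ℝ ∞ ψ) (x : E3) :
    rderiv i (fun y => φ y * ψ y) x = φ x * rderiv i ψ x + rderiv i φ x * ψ x := by
  simp only [rderiv, pderiv_mul _ h k]
  ring

theorem rderiv_sum (i : Fin 3) {ι : Type*} (s : Finset ι) {φ : ι → E3 → ℝ}
    (h : ∀ j ∈ s, ContDiff ℝ ∞ (φ j)) (x : E3) :
    rderiv i (fun y => ∑ j ∈ s, φ j y) x = ∑ j ∈ s, rderiv i (φ j) x := by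
  simp only [rderiv, pderiv_sum _ s h, Finset.mul_sum, Finset.sum_sub_distrib]

theorem rderiv_const_mul (i : Fin 3) {φ : E3 → ℝ} (c : ℝ) (h : ContDiff ℝ ∞ φ) (x : E3) :
    rderiv i (fun y => c * φ y) x = c * rderiv i φ x := by
  simp only [rderiv, pderiv_const_mul _ c h]
  ring

/-! ### Solid harmonics -/

/-- `h` is a solid harmonic of degree `l`: a smooth harmonic function on `ℝ³` that is positively
homogeneous of degree `l`. (These are the homogeneous harmonic polynomials.) -/
structure IsSH (l : ℕ) (h : E3 → ℝ) : Prop where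
  smooth : ContDiff ℝ ∞ h
  homog : ∀ {c : ℝ}, 0 < c → ∀ x, h (c • x) = c ^ l * h x
  harmonic : ∀ x, ∑ i, pderiv i (pderiv i h) x = 0

/-- The space of solid harmonics of degree `l`. -/
def SH (l : ℕ) : Submodule ℝ (E3 → ℝ) where
  carrier := {h | IsSH l h}
  zero_mem' := by
    refine ⟨contDiff_const, by simp, fun x => ?_⟩
    have : ∀ i, pderiv i (0 : E3 → ℝ) = fun _ => 0 := fun i => by
      ext x; exact pderiv_const i 0 x
    simp [this, pderiv_const]
  add_mem' := by
    rintro f g ⟨hf, hf1, hf2⟩ ⟨hg, hg1, hg2⟩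
    refine ⟨hf.add hg, fun hc x => ?_, fun x => ?_⟩
    · simp [hf1 hc, hg1 hc, mul_add]
    · have : ∀ i, pderiv i (f + g) = fun x => pderiv i f x + pderiv i g x := fun i => by
        ext x; exact pderiv_add i hf hg x
      simp only [this, pderiv_add _ (contDiff_pderiv _ hf) (contDiff_pderiv _ hg),
        Finset.sum_add_distrib, hf2, hg2, add_zero]
  smul_mem' := by
    rintro c f ⟨hf, hf1, hf2⟩
    refine ⟨contDiff_const.mul hf, fun hd x => ?_, fun x => ?_⟩
    · simp only [Pi.smul_apply, hf1 hd, smul_eq_mul]; ring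
    · have : ∀ i, pderiv i (c • f) = fun x => c * pderiv i f x := fun i => by
        ext x; exact pderiv_const_mul i c hf x
      simp only [this, pderiv_const_mul _ c (contDiff_pderiv _ hf), ← Finset.mul_sum, hf2, mul_zero]

namespace IsSH

variable {l : ℕ} {h : E3 → ℝ}

theorem euler (hh : IsSH l h) (x : E3) : ∑ i, x i * pderiv i h x = l * h x := by
  have h1 := hasDerivAt_ray hh.smooth x 1
  rw [one_smul] at h1
  have h2 : HasDerivAt (fun c : ℝ => c ^ l * h x) (l * h x) 1 := by
    simpa using (hasDerivAt_pow l (1 : ℝ)).mul_const (h x)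
  refine h1.unique (h2.congr_of_eventuallyEq ?_)
  filter_upwards [lt_mem_nhds (zero_lt_one (α := ℝ))] with c hc
  exact hh.homog hc x

theorem pderiv_homog (hh : IsSH l h) (i : Fin 3) {c : ℝ} (hc : 0 < c) (x : E3) :
    c * pderiv i h (c • x) = c ^ l * pderiv i h x := by
  rw [← pderiv_comp_smul i hh.smooth]
  have : (fun y => h (c • y)) = fun y => c ^ l * h y := by ext y; exact hh.homog hc y
  rw [this, pderiv_const_mul i _ hh.smooth]

theorem pderiv_mem (hh : IsSH (l + 1) h) (i : Fin 3) : IsSH l (pderiv i h) := by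
  refine ⟨contDiff_pderiv i hh.smooth, fun {c} hc x => ?_, fun x => ?_⟩
  · have := hh.pderiv_homog i hc x
    rw [pow_succ'] at this
    exact mul_left_cancel₀ hc.ne' (by rw [this]; ring)
  · have h1 : ∀ j, pderiv j (pderiv j (pderiv i h)) x = pderiv i (pderiv j (pderiv j h)) x := by
      intro j
      have : pderiv j (pderiv i h) = pderiv i (pderiv j h) := by
        ext y; exact pderiv_comm j i hh.smooth y
      rw [this, pderiv_comm j i (contDiff_pderiv j hh.smooth)]
    simp only [h1]
    rw [← pderiv_sum i Finset.univ
      (fun j _ => contDiff_pderiv j (contDiff_pderiv j hh.smooth))]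
    simp only [hh.harmonic, pderiv_const]

theorem eq_const (hh : IsSH 0 h) (x : E3) : h x = h 0 := by
  have h1 : Tendsto (fun c : ℝ => h (c • x)) (𝓝[>] 0) (𝓝 (h ((0 : ℝ) • x))) :=
    ((hh.smooth.continuous.comp (continuous_id.smul continuous_const)).tendsto 0).mono_left
      nhdsWithin_le_nhds
  have h2 : Tendsto (fun c : ℝ => h (c • x)) (𝓝[>] 0) (𝓝 (h x)) := by
    refine tendsto_const_nhds.congr' ?_
    filter_upwards [self_mem_nhdsWithin] with c hc
    rw [hh.homog hc, pow_zero, one_mul]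
  rw [zero_smul] at h1
  exact tendsto_nhds_unique h2 h1

theorem pderiv_eq_zero (hh : IsSH 0 h) (i : Fin 3) (x : E3) : pderiv i h x = 0 := by
  have : h = fun _ => h 0 := by ext y; exact hh.eq_const y
  rw [this, pderiv_const]

theorem one_mem : IsSH 0 (fun _ => (1 : ℝ)) :=
  ⟨contDiff_const, by simp, fun x => by
    have : ∀ i, pderiv i (fun _ : E3 => (1 : ℝ)) = fun _ => 0 := fun i => by
      ext x; exact pderiv_const i 1 x
    simp [this, pderiv_const]⟩

/-- Differentiated Euler identity. -/
theorem euler_pderiv (hh : IsSH l h) (k : Fin 3) (x : E3) :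
    ∑ i, x i * pderiv i (pderiv k h) x = (l - 1 : ℝ) * pderiv k h x := by
  cases l with
  | zero =>
    have : pderiv k h = fun _ => 0 := by ext y; exact hh.pderiv_eq_zero k y
    simp [this, pderiv_const]
  | succ l => rw [(hh.pderiv_mem k).euler]; push_cast; ring

/-- Finite dimensionality: by Euler's identity a solid harmonic of positive degree is determined
by its partial derivatives. -/
instance finiteDimensional (l : ℕ) : FiniteDimensional ℝ (SH l) := by
  induction l with
  | zero =>
    let e : SH 0 →ₗ[ℝ] ℝ := { toFun := fun h => h.1 0, map_add' := fun _ _ => rfl,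
                              map_smul' := fun _ _ => rfl }
    refine FiniteDimensional.of_injective e fun f g hfg => ?_
    ext x
    rw [eq_const f.2, eq_const g.2]
    exact hfg
  | succ l ih =>
    let e : SH (l + 1) →ₗ[ℝ] (Fin 3 → SH l) :=
      { toFun := fun h i => ⟨pderiv i h.1, h.2.pderiv_mem i⟩
        map_add' := fun f g => by
          ext i x; exact pderiv_add i f.2.smooth g.2.smooth x
        map_smul' := fun c f => by
          ext i x; exact pderiv_const_mul i c f.2.smooth x }
    refine FiniteDimensional.of_injective e fun f g hfg => ?_
    ext x
    have h1 : ∀ i, pderiv i f.1 x = pderiv i g.1 x := fun i =>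
      congrFun (congrArg Subtype.val (congrFun hfg i)) x
    have h2 := f.2.euler x
    rw [Finset.sum_congr rfl fun i _ => by rw [h1 i], g.2.euler x] at h2
    exact (mul_left_cancel₀ (by positivity) h2).symm

/-- Laplacian of a product. -/
theorem _root_.DynamicBoundary.laplacian_mul {φ ψ : E3 → ℝ} (hφ : ContDiff ℝ ∞ φ)
    (hψ : ContDiff ℝ ∞ ψ) (x : E3) :
    ∑ i, pderiv i (pderiv i (fun y => φ y * ψ y)) x =
      φ x * ∑ i, pderiv i (pderiv i ψ) x + 2 * ∑ i, pderiv i φ x * pderiv i ψ x +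
        ψ x * ∑ i, pderiv i (pderiv i φ) x := by
  have : ∀ i, pderiv i (fun y => φ y * ψ y) = fun y => φ y * pderiv i ψ y + pderiv i φ y * ψ y :=
    fun i => by ext y; exact pderiv_mul i hφ hψ y
  simp only [Finset.mul_sum, ← Finset.sum_add_distrib]
  refine Finset.sum_congr rfl fun i _ => ?_
  rw [this, pderiv_add i (hφ.mul (contDiff_pderiv i hψ)) ((contDiff_pderiv i hφ).mul hψ),
    pderiv_mul i hφ (contDiff_pderiv i hψ), pderiv_mul i (contDiff_pderiv i hφ) hψ]
  ring

/-- The part of degree `l + 1` of the product of a coordinate with a solid harmonic. -/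
def raise (i : Fin 3) (l : ℕ) (h : E3 → ℝ) (x : E3) : ℝ :=
  x i * h x - (2 * l + 1 : ℝ)⁻¹ * (‖x‖ ^ 2 * pderiv i h x)

theorem raise_mem (hh : IsSH l h) (i : Fin 3) : IsSH (l + 1) (raise i l h) := by
  have s1 := contDiff_pderiv i hh.smooth
  have hc : (2 * l + 1 : ℝ) ≠ 0 := by positivity
  refine ⟨((contDiff_coord i).mul hh.smooth).sub
    (contDiff_const.mul (contDiff_normSq.mul s1)), fun {c} hc x => ?_, fun x => ?_⟩
  · simp only [raise, hh.homog hc, PiLp.smul_apply, smul_eq_mul, norm_smul, mul_pow,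
      Real.norm_eq_abs, sq_abs, pow_succ c l]
    have := hh.pderiv_homog i hc x
    linear_combination (-(2 * l + 1 : ℝ)⁻¹ * ‖x‖ ^ 2 * c) * this
  · have e1 : ∀ j, pderiv j (raise i l h) = fun y => pderiv j (fun y => y i * h y) y -
        (2 * l + 1 : ℝ)⁻¹ * pderiv j (fun y => ‖y‖ ^ 2 * pderiv i h y) y := fun j => by
      ext y
      unfold raise
      rw [pderiv_sub j ((contDiff_coord i).mul hh.smooth)
        (contDiff_const.mul (contDiff_normSq.mul s1)),
        pderiv_const_mul j _ (contDiff_normSq.mul s1)]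
    have e2 : ∑ j, pderiv j (pderiv j (raise i l h)) x =
        ∑ j, pderiv j (pderiv j (fun y => y i * h y)) x - (2 * l + 1 : ℝ)⁻¹ *
        ∑ j, pderiv j (pderiv j (fun y => ‖y‖ ^ 2 * pderiv i h y)) x := by
      rw [Finset.mul_sum, ← Finset.sum_sub_distrib]
      refine Finset.sum_congr rfl fun j _ => ?_
      have t1 := contDiff_pderiv j ((contDiff_coord i).mul hh.smooth)
      have t2 := contDiff_pderiv j (contDiff_normSq.mul s1)
      rw [e1, pderiv_sub j t1 (contDiff_const.mul t2), pderiv_const_mul j _ t2]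
    have e3 : ∀ j, pderiv j (fun y : E3 => y i) = fun _ => if j = i then 1 else 0 := fun j => by
      ext y; exact pderiv_coord j i y
    have e4 : ∀ j, pderiv j (fun y : E3 => ‖y‖ ^ 2) = fun y => 2 * y j := fun j => by
      ext y; exact pderiv_normSq j y
    have e5 : ∑ j, pderiv j (pderiv j (pderiv i h)) x = 0 := by
      cases l with
      | zero =>
        have : pderiv i h = fun _ => 0 := by ext y; exact hh.pderiv_eq_zero i y
        have e6 : ∀ j, pderiv j (fun _ : E3 => (0 : ℝ)) = fun _ => 0 := fun j => by
          ext x; exact pderiv_const j 0 x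
        simp [this, e6]
      | succ l => exact (hh.pderiv_mem i).harmonic x
    rw [e2, laplacian_mul (contDiff_coord i) hh.smooth, laplacian_mul contDiff_normSq s1]
    simp only [e3, e4, hh.harmonic, e5, pderiv_const, pderiv_const_mul _ 2 (contDiff_coord _),
      pderiv_coord, if_true]
    have e6 := hh.euler_pderiv i x
    simp only [mul_assoc, ← Finset.mul_sum, e6]
    simp
    field_simp
    ring

theorem rderiv_mem (hh : IsSH l h) (i : Fin 3) : IsSH l (rderiv i h) := by
  have s := fun j => contDiff_pderiv j hh.smooth
  refine ⟨contDiff_rderiv i hh.smooth, fun {c} hc x => ?_, fun x => ?_⟩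
  · simp only [rderiv, PiLp.smul_apply, smul_eq_mul]
    linear_combination x (i + 1) * hh.pderiv_homog (i + 2) hc x -
      x (i + 2) * hh.pderiv_homog (i + 1) hc x
  · have e1 : ∀ j, pderiv j (rderiv i h) = fun y => pderiv j (fun y => y (i + 1) *
        pderiv (i + 2) h y) y - pderiv j (fun y => y (i + 2) * pderiv (i + 1) h y) y := fun j => by
      ext y
      exact pderiv_sub j ((contDiff_coord _).mul (s _)) ((contDiff_coord _).mul (s _)) y
    have e2 : ∑ j, pderiv j (pderiv j (rderiv i h)) x =
        ∑ j, pderiv j (pderiv j (fun y => y (i + 1) * pderiv (i + 2) h y)) x -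
        ∑ j, pderiv j (pderiv j (fun y => y (i + 2) * pderiv (i + 1) h y)) x := by
      rw [← Finset.sum_sub_distrib]
      refine Finset.sum_congr rfl fun j _ => ?_
      rw [e1, pderiv_sub j (contDiff_pderiv j ((contDiff_coord _).mul (s _)))
        (contDiff_pderiv j ((contDiff_coord _).mul (s _)))]
    have e3 : ∀ j k, pderiv j (fun y : E3 => y k) = fun _ => if j = k then 1 else 0 := fun j k => by
      ext y; exact pderiv_coord j k y
    have e5 : ∀ k, ∑ j, pderiv j (pderiv j (pderiv k h)) x = 0 := by
      intro k
      cases l with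
      | zero =>
        have : pderiv k h = fun _ => 0 := by ext y; exact hh.pderiv_eq_zero k y
        have e6 : ∀ j, pderiv j (fun _ : E3 => (0 : ℝ)) = fun _ => 0 := fun j => by
          ext x; exact pderiv_const j 0 x
        simp [this, e6]
      | succ l => exact (hh.pderiv_mem k).harmonic x
    rw [e2, laplacian_mul (contDiff_coord _) (s _), laplacian_mul (contDiff_coord _) (s _)]
    simp only [e3, e5, pderiv_const]
    simp [pderiv_comm (i + 1) (i + 2) hh.smooth x]

/-- The Laplace-Beltrami operator acts on solid harmonics of degree `l` as `-l(l+1)` (here for all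
`x`, since the rotational derivatives make sense off the sphere). -/
theorem sum_rderiv_rderiv (hh : IsSH l h) (x : E3) :
    ∑ i, rderiv i (rderiv i h) x = -(l * (l + 1) : ℝ) * h x := by
  have s := fun j => contDiff_pderiv j hh.smooth
  have e1 : ∀ i j, pderiv j (rderiv i h) x = (x (i + 1) * pderiv j (pderiv (i + 2) h) x +
      (if j = i + 1 then 1 else 0) * pderiv (i + 2) h x) -
      (x (i + 2) * pderiv j (pderiv (i + 1) h) x +
      (if j = i + 2 then 1 else 0) * pderiv (i + 1) h x) := fun i j => by
    have : rderiv i h = fun y => y (i + 1) * pderiv (i + 2) h y - y (i + 2) * pderiv (i + 1) h y :=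
      rfl
    rw [this, pderiv_sub j ((contDiff_coord _).mul (s _)) ((contDiff_coord _).mul (s _)),
      pderiv_mul j (contDiff_coord _) (s _), pderiv_mul j (contDiff_coord _) (s _), pderiv_coord,
      pderiv_coord]
  have e2 : ∀ i, rderiv i (rderiv i h) x = x (i + 1) * pderiv (i + 2) (rderiv i h) x -
    x (i + 2) * pderiv (i + 1) (rderiv i h) x := fun i => rfl
  simp only [e2, e1]
  have eu := hh.euler x
  have eh := hh.harmonic x
  have ep := fun k => hh.euler_pderiv k x
  have ep0 := ep 0
  have ep1 := ep 1
  have ep2 := ep 2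
  have c01 := pderiv_comm 0 1 hh.smooth x
  have c02 := pderiv_comm 0 2 hh.smooth x
  have c12 := pderiv_comm 1 2 hh.smooth x
  simp only [Fin.sum_univ_three] at *
  simp only [show (0 : Fin 3) + 1 = 1 from rfl, show (0 : Fin 3) + 2 = 2 from rfl,
    show (1 : Fin 3) + 1 = 2 from rfl, show (1 : Fin 3) + 2 = 0 from rfl,
    show (2 : Fin 3) + 1 = 0 from rfl, show (2 : Fin 3) + 2 = 1 from rfl]
  simp only [Fin.reduceEq, if_true, if_false, zero_mul, one_mul]
  rw [c01, c02, c12] at *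
  linear_combination (x 0 ^ 2 + x 1 ^ 2 + x 2 ^ 2) * eh - x 0 * ep0 - x 1 * ep1 - x 2 * ep2
    - (l + 1 : ℝ) * eu

end IsSH

/-! ### Polar coordinates and integration by parts -/

theorem lintegral_polar {f : E3 → ℝ≥0∞} (hf : Measurable f) :
    ∫⁻ x, f x = ∫⁻ w : Sph, (∫⁻ r in Ioi (0 : ℝ), ENNReal.ofReal (r ^ 2) * f (r • (w : E3))) ∂sigma := by
  have hmp := (volume : Measure E3).measurePreserving_homeomorphUnitSphereProd
  have h1 : ∫⁻ x, f x = ∫⁻ x : ({(0 : E3)}ᶜ : Set E3), f x.1 ∂(volume.comap Subtype.val) := by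
    rw [lintegral_subtype_comap (measurableSet_singleton _).compl f, restrict_compl_singleton]
  have h2 := hmp.lintegral_comp (f := fun p => f ((homeomorphUnitSphereProd E3).symm p))
    (hf.comp (measurable_subtype_coe.comp (homeomorphUnitSphereProd E3).symm.measurable))
  simp only [Homeomorph.symm_apply_apply, finrank_euclideanSpace, Fintype.card_fin,
    Nat.add_one_sub_one] at h2
  have hm : Measurable fun p : Sph × Ioi (0 : ℝ) => f ((homeomorphUnitSphereProd E3).symm p) :=
    hf.comp (measurable_subtype_coe.comp (homeomorphUnitSphereProd E3).symm.measurable)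
  rw [h1, h2, lintegral_prod _ hm.aemeasurable]
  refine lintegral_congr fun w => ?_
  simp only [homeomorphUnitSphereProd_symm_apply_coe]
  have hm2 : Measurable fun r : ℝ => f (r • (w : E3)) := by fun_prop
  have hm3 : Measurable fun r : Ioi (0 : ℝ) => f (r.1 • (w : E3)) :=
    hm2.comp measurable_subtype_coe
  rw [Measure.volumeIoiPow, lintegral_withDensity_eq_lintegral_mul _ (by fun_prop) hm3,
    ← lintegral_subtype_comap measurableSet_Ioi]
  rfl

theorem lintegral_polar_prod {f : E3 → ℝ≥0∞} (hf : Measurable f) :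
    ∫⁻ x, f x = ∫⁻ p : Sph × ℝ, ENNReal.ofReal (p.2 ^ 2) * f (p.2 • (p.1 : E3))
      ∂(sigma.prod (volume.restrict (Ioi 0))) := by
  rw [lintegral_polar hf, lintegral_prod]
  fun_prop

theorem integral_polar {f : E3 → ℝ} (hm : Measurable f) (hf : Integrable f) :
    Integrable (fun p : Sph × ℝ => p.2 ^ 2 * f (p.2 • (p.1 : E3)))
      (sigma.prod (volume.restrict (Ioi 0))) ∧
    ∫ x, f x = ∫ p : Sph × ℝ, p.2 ^ 2 * f (p.2 • (p.1 : E3))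
      ∂(sigma.prod (volume.restrict (Ioi 0))) := by
  have hi : Integrable (fun p : Sph × ℝ => p.2 ^ 2 * f (p.2 • (p.1 : E3)))
      (sigma.prod (volume.restrict (Ioi 0))) := by
    refine ⟨by fun_prop, ?_⟩
    have h1 := hf.2
    rw [HasFiniteIntegral, lintegral_polar_prod (by fun_prop)] at h1
    refine lt_of_eq_of_lt (lintegral_congr fun p => ?_) h1
    rw [enorm_mul, Real.enorm_of_nonneg (sq_nonneg _)]
  refine ⟨hi, ?_⟩
  rw [integral_eq_lintegral_pos_part_sub_lintegral_neg_part hf,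
    integral_eq_lintegral_pos_part_sub_lintegral_neg_part hi,
    lintegral_polar_prod (by fun_prop), lintegral_polar_prod (by fun_prop)]
  simp only [← mul_neg, ENNReal.ofReal_mul (sq_nonneg _)]

theorem hasCompactSupport_radial {g : ℝ → ℝ} (hc : HasCompactSupport g) :
    HasCompactSupport fun x : E3 => g (‖x‖ ^ 2) := by
  obtain ⟨R, hR⟩ := hc.isCompact.isBounded.subset_closedBall 0
  refine HasCompactSupport.intro (isCompact_closedBall (0 : E3) (R + 1)) fun x hx => ?_
  refine image_eq_zero_of_notMem_tsupport fun hx' => hx ?_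
  have := hR hx'
  simp only [Metric.mem_closedBall, dist_zero_right, norm_pow, norm_norm] at this ⊢
  nlinarith [norm_nonneg x, sq_nonneg (‖x‖ - 1)]

/-- A function whose integrals against all radial test functions vanish has mean zero on the unit
sphere. -/
theorem integral_sphere_eq_zero_of_radial {K : E3 → ℝ} (hK : Continuous K)
    (h : ∀ g : ℝ → ℝ, ContDiff ℝ ∞ g → HasCompactSupport g → ∫ x, g (‖x‖ ^ 2) * K x = 0) :
    ∫ w : Sph, K w ∂sigma = 0 := by
  let M : ℝ → ℝ := fun r => ∫ w : Sph, K (r • (w : E3)) ∂sigma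
  have hM : Continuous M := by
    have := continuous_parametric_integral_of_continuous (μ := sigma)
      (f := fun (r : ℝ) (w : Sph) => K (r • (w : E3)))
      (by unfold Function.uncurry; fun_prop) isCompact_univ
    simpa using this
  have h0 : ∀ g : ℝ → ℝ, ContDiff ℝ ∞ g → HasCompactSupport g →
      ∫ r in Ioi (0 : ℝ), r ^ 2 * g (r ^ 2) * M r = 0 := by
    intro g hg hc
    have hcont : Continuous fun x : E3 => g (‖x‖ ^ 2) * K x := by
      have := hg.continuous; fun_prop
    have hcs : HasCompactSupport fun x : E3 => g (‖x‖ ^ 2) * K x :=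
      (hasCompactSupport_radial hc).mul_right
    obtain ⟨i1, i2⟩ := integral_polar hcont.measurable (hcont.integrable_of_hasCompactSupport hcs)
    rw [h g hg hc, integral_prod_symm _ i1] at i2
    refine Eq.trans ?_ i2.symm
    refine setIntegral_congr_fun measurableSet_Ioi fun r _ => ?_
    simp only [M]
    rw [← integral_const_mul]
    refine integral_congr_ae (Eventually.of_forall fun w => ?_)
    simp only [norm_smul, norm_eq_of_mem_sphere, Real.norm_eq_abs, mul_one, sq_abs]
    ring
  have hM1 : M 1 = ∫ w : Sph, K w ∂sigma := by simp [M]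
  rw [← hM1]
  by_contra hne
  -- A bump function concentrated where `M` keeps its sign at `1` gives a contradiction.
  obtain ⟨δ, hδ, hδ'⟩ := Metric.eventually_nhds_iff.1 
    ((continuousAt_const (y := (0 : ℝ))).eventually_lt ((hM.mul_const (M 1)).continuousAt (x := 1))
      (mul_self_pos.2 hne))
  let g : ContDiffBump (1 : ℝ) := ⟨δ / 2, δ, by positivity, by linarith⟩
  have h1 := h0 g g.contDiff g.hasCompactSupport
  let Φ : ℝ → ℝ := fun r => r ^ 2 * g (r ^ 2) * (M |r| * M 1)
  have hΦc : Continuous Φ := by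
    have := g.continuous
    simp only [Φ]; fun_prop
  have hΦs : HasCompactSupport Φ := by
    refine HasCompactSupport.intro (isCompact_closedBall (0 : ℝ) (1 + δ)) fun r hr => ?_
    have : (g : ℝ → ℝ) (r ^ 2) = 0 := by
      refine g.zero_of_le_dist ?_
      simp only [Metric.mem_closedBall, dist_zero_right, Real.norm_eq_abs, not_le] at hr
      rw [Real.dist_eq]
      refine le_trans ?_ (le_abs_self _)
      rw [← sq_abs]
      change δ ≤ _
      nlinarith [abs_nonneg r]
    simp [Φ, this]
  have hΦ0 : ∀ r, 0 ≤ Φ r := by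
    intro r
    by_cases hr : dist (r ^ 2) 1 < δ
    · have : 0 < M |r| * M 1 := by
        refine hδ' ?_
        rw [Real.dist_eq, ← sq_abs] at hr
        rw [Real.dist_eq]
        refine lt_of_le_of_lt ?_ hr
        have : |r| ^ 2 - 1 = (|r| - 1) * (|r| + 1) := by ring
        rw [this, abs_mul, abs_of_nonneg (by positivity : 0 ≤ |r| + 1)]
        exact le_mul_of_one_le_right (abs_nonneg _) (by linarith [abs_nonneg r])
      have := g.nonneg (x := r ^ 2)
      simp only [Φ]; positivity
    · have : (g : ℝ → ℝ) (r ^ 2) = 0 := g.zero_of_le_dist (not_lt.1 hr)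
      simp [Φ, this]
  have hΦ1 : Φ 1 ≠ 0 := by
    have : (g : ℝ → ℝ) 1 = 1 := g.one_of_mem_closedBall (by simp [g.rIn_pos.le])
    simp [Φ, this, hne]
  have hpos := hΦc.integral_pos_of_hasCompactSupport_nonneg_nonzero (μ := volume) hΦs hΦ0 hΦ1
  have h2 : ∫ r, Φ r = 2 * ∫ r in Ioi (0 : ℝ), r ^ 2 * g (r ^ 2) * (M r * M 1) := by
    rw [← integral_comp_abs]
    simp [Φ]
  have h3 : ∫ r in Ioi (0 : ℝ), r ^ 2 * g (r ^ 2) * (M r * M 1) = 0 := by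
    simp only [← mul_assoc]
    rw [integral_mul_const, h1, zero_mul]
  rw [h2, h3, mul_zero] at hpos
  exact lt_irrefl _ hpos

theorem integral_pderiv_eq_zero (i : Fin 3) {φ : E3 → ℝ} (h : ContDiff ℝ ∞ φ)
    (hc : HasCompactSupport φ) : ∫ x, pderiv i φ x = 0 := by
  have h1 := integral_mul_fderiv_eq_neg_fderiv_mul_of_integrable (𝕜 := ℝ) (μ := (volume : Measure E3))
    (f := fun _ => (1 : ℝ)) (g := φ) (v := EuclideanSpace.single i 1) (by simp)
    (by
      simp only [one_mul]
      exact (continuous_pderiv i h).integrable_of_hasCompactSupport (hc.fderiv_apply ℝ _))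
    (by simpa using h.continuous.integrable_of_hasCompactSupport hc) (by simp)
    fun x _ => ContDiff.diffAt h x
  simpa [pderiv] using h1

theorem continuous_sphere {f : E3 → ℝ} (h : Continuous f) : Continuous fun x : Sph => f x :=
  h.comp continuous_subtype_val

theorem integrable_sphere {f : Sph → ℝ} (h : Continuous f) : Integrable f sigma :=
  h.integrable_of_hasCompactSupport (HasCompactSupport.of_compactSpace f)

theorem integral_rderiv (i : Fin 3) {φ : E3 → ℝ} (h : ContDiff ℝ ∞ φ) :
    ∫ x : Sph, rderiv i φ x ∂sigma = 0 := by
  refine integral_sphere_eq_zero_of_radial (contDiff_rderiv i h).continuous fun g hg hc => ?_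
  have hG : ContDiff ℝ ∞ fun x : E3 => g (‖x‖ ^ 2) := hg.comp contDiff_normSq
  have hGc := hasCompactSupport_radial hc
  have hp : ∀ j x, pderiv j (fun x : E3 => g (‖x‖ ^ 2)) x = 2 * x j * deriv g (‖x‖ ^ 2) := by
    intro j x
    have h1 : HasFDerivAt (fun x : E3 => ‖x‖ ^ 2) _ x :=
      (ContDiff.diffAt contDiff_normSq x).hasFDerivAt
    have h2 := ((hg.differentiable (by simp)) (‖x‖ ^ 2)).hasDerivAt.comp_hasFDerivAt x h1
    have h3 := pderiv_normSq j x
    simp only [pderiv] at h3 ⊢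
    have h4 : fderiv ℝ (fun x : E3 => g (‖x‖ ^ 2)) x = _ := h2.fderiv
    rw [h4]
    simp only [_root_.smul_apply, smul_eq_mul, h3]
    ring
  have hs : ContDiff ℝ ∞ fun x : E3 => g (‖x‖ ^ 2) * φ x := hG.mul h
  have e : ∀ x, g (‖x‖ ^ 2) * rderiv i φ x =
      pderiv (i + 2) (fun x => x (i + 1) * (g (‖x‖ ^ 2) * φ x)) x -
      pderiv (i + 1) (fun x => x (i + 2) * (g (‖x‖ ^ 2) * φ x)) x := by
    intro x
    rw [pderiv_mul _ (contDiff_coord _) hs, pderiv_mul _ (contDiff_coord _) hs,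
      pderiv_mul _ hG h, pderiv_mul _ hG h, hp, hp, pderiv_coord, pderiv_coord]
    simp [rderiv]
    ring
  have hcs : ∀ j, HasCompactSupport fun x : E3 => x j * (g (‖x‖ ^ 2) * φ x) := fun j =>
    (hGc.mul_right (f' := φ)).mul_left
  have hsj : ∀ j, ContDiff ℝ ∞ fun x : E3 => x j * (g (‖x‖ ^ 2) * φ x) := fun j =>
    (contDiff_coord j).mul hs
  have hi : ∀ k j, Integrable (pderiv k fun x : E3 => x j * (g (‖x‖ ^ 2) * φ x)) := fun k j =>
    (continuous_pderiv k (hsj j)).integrable_of_hasCompactSupport ((hcs j).fderiv_apply ℝ _)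
  simp only [e]
  rw [integral_sub (hi _ _) (hi _ _), integral_pderiv_eq_zero _ (hsj _) (hcs _),
    integral_pderiv_eq_zero _ (hsj _) (hcs _), sub_zero]

/-- The rotational derivatives are skew-symmetric on the sphere. -/
theorem integral_mul_rderiv (i : Fin 3) {φ ψ : E3 → ℝ} (h : ContDiff ℝ ∞ φ)
    (k : ContDiff ℝ ∞ ψ) :
    ∫ x : Sph, φ x * rderiv i ψ x ∂sigma = -∫ x : Sph, rderiv i φ x * ψ x ∂sigma := by
  have h1 := integral_rderiv i (h.mul k)
  simp only [rderiv_mul i h k] at h1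
  rw [integral_add] at h1
  · linarith
  · exact integrable_sphere (continuous_sphere (h.mul (contDiff_rderiv i k)).continuous)
  · exact integrable_sphere (continuous_sphere ((contDiff_rderiv i h).mul k).continuous)

/-- Integration of the tangential part of a gradient over the sphere; `2` is the mean curvature. -/
theorem integral_sphere_pderiv (i : Fin 3) {φ : E3 → ℝ} (h : ContDiff ℝ ∞ φ) :
    ∫ x : Sph, pderiv i φ x ∂sigma =
      ∫ x : Sph, ((x : E3) i * ∑ j, (x : E3) j * pderiv j φ x + 2 * ((x : E3) i * φ x)) ∂sigma := by
  have hR : ∀ j k, ∫ x : Sph, (x : E3) j * rderiv k φ x ∂sigma =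
      -∫ x : Sph, rderiv k (fun y : E3 => y j) x * φ x ∂sigma := fun j k =>
    integral_mul_rderiv k (contDiff_coord j) h
  have hI : ∀ {f : E3 → ℝ}, ContDiff ℝ ∞ f → Integrable (fun x : Sph => f x) sigma := fun hf =>
    integrable_sphere (continuous_sphere hf.continuous)
  have hx := fun j => contDiff_coord j
  have hd := fun j => contDiff_pderiv j h
  have hr := fun j => contDiff_rderiv j h
  have i1 : Integrable (fun x : Sph => pderiv i φ x) sigma := hI (hd i)
  have i2 : Integrable (fun x : Sph => (x : E3) i * ∑ j, (x : E3) j * pderiv j φ x +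
      2 * ((x : E3) i * φ x)) sigma :=
    hI (f := fun x => x i * ∑ j, x j * pderiv j φ x + 2 * (x i * φ x)) (by fun_prop)
  rw [← sub_eq_zero, ← integral_sub i1 i2]
  have e1 : ∀ x : Sph, pderiv i φ x - ((x : E3) i * ∑ j, (x : E3) j * pderiv j φ x +
      2 * ((x : E3) i * φ x)) = (x : E3) (i + 2) * rderiv (i + 1) φ x -
        (x : E3) (i + 1) * rderiv (i + 2) φ x - 2 * ((x : E3) i * φ x) := by
    intro x
    have hn : (x : E3) 0 ^ 2 + (x : E3) 1 ^ 2 + (x : E3) 2 ^ 2 = 1 := by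
      rw [← normSq_eq]; simp
    simp only [rderiv, Fin.sum_univ_three]
    fin_cases i
    · simp
      linear_combination (-pderiv 0 φ x) * hn
    · simp
      linear_combination (-pderiv 1 φ x) * hn
    · simp
      linear_combination (-pderiv 2 φ x) * hn
  simp only [e1]
  have i3 : ∀ j k, Integrable (fun x : Sph => (x : E3) j * rderiv k φ x) sigma := fun j k =>
    hI (f := fun x => x j * rderiv k φ x) ((hx j).mul (hr k))
  have i4 : Integrable (fun x : Sph => (x : E3) i * φ x) sigma :=
    hI (f := fun x => x i * φ x) ((hx i).mul h)
  rw [integral_sub (by exact (i3 _ _).sub (i3 _ _)) (i4.const_mul 2), integral_sub (i3 _ _) (i3 _ _),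
    hR, hR, integral_const_mul]
  have e2 : ∀ x : E3, rderiv (i + 1) (fun y : E3 => y (i + 2)) x = - x i := by
    intro x
    simp only [rderiv, pderiv_coord]
    fin_cases i <;> simp
  have e3 : ∀ x : E3, rderiv (i + 2) (fun y : E3 => y (i + 1)) x = x i := by
    intro x
    simp only [rderiv, pderiv_coord]
    fin_cases i <;> simp
  simp only [e2, e3, neg_mul, integral_neg]
  ring

theorem integrableOn_ball {f : E3 → ℝ} (hf : Continuous f) : IntegrableOn f Om :=
  (hf.continuousOn.integrableOn_compact (isCompact_closedBall (0 : E3) 1)).mono_set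
    Metric.ball_subset_closedBall

/-- Polar coordinates in the unit ball. -/
theorem integral_ball_polar {f : E3 → ℝ} (hf : Continuous f) :
    ∫ x in Om, f x = ∫ w : Sph, (∫ r in (0 : ℝ)..1, r ^ 2 * f (r • (w : E3))) ∂sigma := by
  have hm : Measurable (indicator Om f) := hf.measurable.indicator measurableSet_ball
  obtain ⟨i1, i2⟩ := integral_polar hm ((integrable_indicator_iff measurableSet_ball).2
    (integrableOn_ball hf))
  rw [integral_indicator measurableSet_ball] at i2
  rw [i2, integral_prod _ i1]
  refine integral_congr_ae (Eventually.of_forall fun w => ?_)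
  simp only
  rw [intervalIntegral.integral_of_le zero_le_one, integral_Ioc_eq_integral_Ioo,
    ← integral_indicator measurableSet_Ioi, ← integral_indicator measurableSet_Ioo]
  congr 1
  ext r
  by_cases h0 : 0 < r
  · by_cases h1 : r < 1
    · have : r • (w : E3) ∈ Om := by simp [norm_smul, abs_of_pos h0, h1]
      simp [indicator, h0, h1, this]
    · have : r • (w : E3) ∉ Om := by simpa [norm_smul, abs_of_pos h0] using h1
      simp [indicator, h0, h1, this]
  · simp [indicator, h0]

theorem integrable_sphere_prod_Ioc {f : Sph × ℝ → ℝ} (hf : Continuous f) :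
    Integrable f (sigma.prod (volume.restrict (Ioc 0 1))) := by
  have h1 : IntegrableOn f (univ ×ˢ Ioc 0 1) (sigma.prod volume) :=
    (hf.continuousOn.integrableOn_compact (isCompact_univ.prod isCompact_Icc)).mono_set
      (prod_mono_right Ioc_subset_Icc_self)
  rwa [IntegrableOn, ← Measure.prod_restrict, Measure.restrict_univ] at h1

/-- The divergence theorem on the unit ball. -/
theorem integral_ball_pderiv (i : Fin 3) {φ : E3 → ℝ} (h : ContDiff ℝ ∞ φ) :
    ∫ x in Om, pderiv i φ x = ∫ x : Sph, (x : E3) i * φ x ∂sigma := by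
  have hd := fun j => contDiff_pderiv j h
  have c1 : Continuous fun p : Sph × ℝ => p.2 ^ 2 * pderiv i φ (p.2 • (p.1 : E3)) := by
    have := (hd i).continuous
    fun_prop
  have c2 : Continuous fun p : Sph × ℝ => p.2 ^ 2 * ((p.1 : E3) i *
      ∑ j, (p.1 : E3) j * pderiv j φ (p.2 • (p.1 : E3))) +
      2 * p.2 * ((p.1 : E3) i * φ (p.2 • (p.1 : E3))) := by
    have := h.continuous
    have := fun j => (hd j).continuous
    fun_prop
  rw [integral_ball_polar (hd i).continuous]
  simp only [intervalIntegral.integral_of_le (zero_le_one (α := ℝ))]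
  rw [integral_integral_swap (f := fun (w : Sph) (r : ℝ) => r ^ 2 * pderiv i φ (r • (w : E3)))
    (integrable_sphere_prod_Ioc c1)]
  have e1 : ∀ r ∈ Ioc (0 : ℝ) 1, ∫ w : Sph, r ^ 2 * pderiv i φ (r • (w : E3)) ∂sigma =
      ∫ w : Sph, (r ^ 2 * ((w : E3) i * ∑ j, (w : E3) j * pderiv j φ (r • (w : E3))) +
        2 * r * ((w : E3) i * φ (r • (w : E3)))) ∂sigma := by
    intro r _
    have h1 := integral_sphere_pderiv i (φ := fun x => φ (r • x))
      (h.comp (contDiff_const_smul r))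
    simp only [pderiv_comp_smul _ h] at h1
    have h2 := congrArg (r * ·) h1
    simp only [← integral_const_mul] at h2
    refine Eq.trans ?_ (h2.trans ?_)
    · exact integral_congr_ae (Eventually.of_forall fun w => by simp only; ring)
    · refine integral_congr_ae (Eventually.of_forall fun w => ?_)
      simp only [Fin.sum_univ_three]
      ring
  rw [setIntegral_congr_fun measurableSet_Ioc e1,
    ← integral_integral_swap (f := fun (w : Sph) (r : ℝ) => r ^ 2 * ((w : E3) i *
        ∑ j, (w : E3) j * pderiv j φ (r • (w : E3))) + 2 * r * ((w : E3) i * φ (r • (w : E3))))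
      (integrable_sphere_prod_Ioc c2)]
  refine integral_congr_ae (Eventually.of_forall fun w => ?_)
  simp only [← intervalIntegral.integral_of_le (zero_le_one (α := ℝ))]
  rw [intervalIntegral.integral_eq_sub_of_hasDerivAt
    (f := fun r => r ^ 2 * ((w : E3) i * φ (r • (w : E3))))]
  · simp
  · intro r _
    have h1 := (hasDerivAt_pow 2 r).mul ((hasDerivAt_ray h (w : E3) r).const_mul ((w : E3) i))
    refine h1.congr_deriv ?_
    simp
    ring
  · exact (c2.comp (Continuous.prodMk_right w)).intervalIntegrable 0 1

theorem integral_ball_homog {F : E3 → ℝ} (hF : Continuous F) (d : ℕ)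
    (hd : ∀ {c : ℝ}, 0 < c → ∀ x, F (c • x) = c ^ d * F x) :
    ∫ x in Om, F x = (d + 3 : ℝ)⁻¹ * ∫ x : Sph, F x ∂sigma := by
  rw [integral_ball_polar hF, ← integral_const_mul]
  refine integral_congr_ae (Eventually.of_forall fun w => ?_)
  have : ∫ r in (0 : ℝ)..1, r ^ 2 * F (r • (w : E3)) = ∫ r in (0 : ℝ)..1, r ^ (d + 2) * F w := by
    refine intervalIntegral.integral_congr_ae (Eventually.of_forall fun r hr => ?_)
    rw [uIoc_of_le zero_le_one] at hr
    rw [hd hr.1]; ring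
  simp only [this]
  rw [intervalIntegral.integral_mul_const, integral_pow]
  simp
  left
  ring

/-- Integration by parts in the unit ball. -/
theorem integral_ball_mul_pderiv (i : Fin 3) {φ ψ : E3 → ℝ} (h : ContDiff ℝ ∞ φ)
    (k : ContDiff ℝ ∞ ψ) :
    ∫ x in Om, φ x * pderiv i ψ x =
      ∫ x : Sph, (x : E3) i * (φ x * ψ x) ∂sigma - ∫ x in Om, pderiv i φ x * ψ x := by
  have h1 := integral_ball_pderiv i (h.mul k)
  simp only [pderiv_mul i h k] at h1
  rw [integral_add (integrableOn_ball (h.mul (contDiff_pderiv i k)).continuous)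
    (integrableOn_ball ((contDiff_pderiv i h).mul k).continuous)] at h1
  linarith

/-! ### Functions as elements of `L²` -/


/-- The class in `L²(μ)` of a square integrable function (and `0` for other functions). -/
def toL2 {X : Type*} [MeasurableSpace X] (μ : Measure X) (f : X → ℝ) : L2 μ :=
  open scoped Classical in if h : MemLp f 2 μ then h.toLp f else 0

section toL2

variable {X : Type*} [MeasurableSpace X] {μ : Measure X}

theorem coeFn_toL2 {f : X → ℝ} (hf : MemLp f 2 μ) : toL2 μ f =ᵐ[μ] f := by
  rw [toL2, dif_pos hf]
  exact hf.coeFn_toLp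

theorem toL2_add {f g : X → ℝ} (hf : MemLp f 2 μ) (hg : MemLp g 2 μ) :
    toL2 μ (fun x => f x + g x) = toL2 μ f + toL2 μ g := by
  ext1
  filter_upwards [coeFn_toL2 hf, coeFn_toL2 hg, coeFn_toL2 (hf.add hg),
    Lp.coeFn_add (toL2 μ f) (toL2 μ g)] with x h1 h2 h3 h4
  rw [h4, Pi.add_apply, h1, h2]
  exact h3

theorem toL2_const_mul {f : X → ℝ} (c : ℝ) (hf : MemLp f 2 μ) :
    toL2 μ (fun x => c * f x) = c • toL2 μ f := by
  ext1
  filter_upwards [coeFn_toL2 hf, coeFn_toL2 (hf.const_mul c),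
    Lp.coeFn_smul c (toL2 μ f)] with x h1 h3 h4
  rw [h4, Pi.smul_apply, h1, smul_eq_mul]
  exact h3

theorem L2_inner_eq (u v : L2 μ) : ⟪u, v⟫_ℝ = ∫ x, u x * v x ∂μ := by
  rw [L2.inner_def]
  refine integral_congr_ae (Eventually.of_forall fun x => ?_)
  simp [mul_comm]

theorem inner_toL2_right (u : L2 μ) {f : X → ℝ} (hf : MemLp f 2 μ) :
    ⟪u, toL2 μ f⟫_ℝ = ∫ x, u x * f x ∂μ := by
  rw [L2_inner_eq]
  refine integral_congr_ae ?_
  filter_upwards [coeFn_toL2 hf] with x hx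
  rw [hx]

theorem inner_toL2 {f g : X → ℝ} (hf : MemLp f 2 μ) (hg : MemLp g 2 μ) :
    ⟪toL2 μ f, toL2 μ g⟫_ℝ = ∫ x, f x * g x ∂μ := by
  rw [inner_toL2_right _ hg]
  refine integral_congr_ae ?_
  filter_upwards [coeFn_toL2 hf] with x hx
  rw [hx]

end toL2

instance : IsFiniteMeasure volOm := ⟨by simp⟩

theorem memLp_sphere {f : E3 → ℝ} (hf : Continuous f) : MemLp (fun x : Sph => f x) 2 sigma :=
  (continuous_sphere hf).memLp_of_hasCompactSupport (HasCompactSupport.of_compactSpace _)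

theorem memLp_ball {f : E3 → ℝ} (hf : Continuous f) : MemLp f 2 volOm := by
  obtain ⟨C, hC⟩ := (isCompact_closedBall (0 : E3) 1).exists_bound_of_continuousOn hf.continuousOn
  refine MemLp.of_bound hf.aestronglyMeasurable C ?_
  filter_upwards [ae_restrict_mem measurableSet_ball] with x hx
  exact hC x (Metric.ball_subset_closedBall hx)

/-- The restriction of a function on `ℝ³` to the sphere, in `L²(∂Ω)`. -/
def resS (f : E3 → ℝ) : L2 sigma := toL2 sigma fun x : Sph => f x

theorem inner_resS {f g : E3 → ℝ} (hf : Continuous f) (hg : Continuous g) :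
    ⟪resS f, resS g⟫_ℝ = ∫ x : Sph, f x * g x ∂sigma :=
  inner_toL2 (memLp_sphere hf) (memLp_sphere hg)

/-! ### Totality -/

/-- A consequence of the Stone-Weierstrass theorem: on a compact space embedded in `ℝ³`, an `L²`
function that is orthogonal to a space of continuous functions containing `1` and closed under
multiplication by coordinates vanishes. -/
theorem ae_eq_zero_of_orthogonal {X : Type*} [TopologicalSpace X] [CompactSpace X] [T4Space X]
    [MeasurableSpace X] [BorelSpace X] (μ : Measure X) [IsFiniteMeasure μ] [μ.WeaklyRegular]
    (j : C(X, E3)) (hj : Function.Injective j) (G : Set C(X, ℝ)) (h1 : 1 ∈ G)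
    (hG : ∀ f ∈ G, ∀ i : Fin 3, ∃ g ∈ Submodule.span ℝ G, ∀ x, g x = j x i * f x)
    {u : X → ℝ} (hu : MemLp u 2 μ) (h0 : ∀ f ∈ G, ∫ x, u x * f x ∂μ = 0) : u =ᵐ[μ] 0 := by
  let M := Submodule.span ℝ G
  have hM : ∀ f ∈ M, ∀ i : Fin 3, ∃ g ∈ M, ∀ x, g x = j x i * f x := by
    intro f hf i
    induction hf using Submodule.span_induction with
    | mem g hg => exact hG g hg i
    | zero => exact ⟨0, Submodule.zero_mem _, by simp⟩
    | add f g _ _ hf hg =>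
      obtain ⟨f', hf', hff⟩ := hf
      obtain ⟨g', hg', hgg⟩ := hg
      exact ⟨f' + g', Submodule.add_mem _ hf' hg', fun x => by simp [hff, hgg, mul_add]⟩
    | smul c f _ hf =>
      obtain ⟨f', hf', hff⟩ := hf
      exact ⟨c • f', Submodule.smul_mem _ c hf', fun x => by simp [hff]; ring⟩
  let c : Fin 3 → C(X, ℝ) := fun i => ⟨fun x => j x i, by fun_prop⟩
  let A : Subalgebra ℝ C(X, ℝ) := Algebra.adjoin ℝ (range c)
  have hsep : A.SeparatesPoints := by
    intro x y hxy
    have : j x ≠ j y := fun h => hxy (hj h)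
    obtain ⟨i, hi⟩ : ∃ i, j x i ≠ j y i := by
      by_contra! h
      exact this (by ext i; exact h i)
    exact ⟨c i, ⟨c i, Algebra.subset_adjoin ⟨i, rfl⟩, rfl⟩, hi⟩
  have hAM : ∀ a ∈ A, ∀ f ∈ M, a * f ∈ M := by
    intro a ha
    induction ha using Algebra.adjoin_induction with
    | mem a ha =>
      obtain ⟨i, rfl⟩ := ha
      intro f hf
      obtain ⟨g, hg, hgx⟩ := hM f hf i
      have : c i * f = g := by ext x; simp [c, hgx]
      rwa [this]
    | algebraMap r =>
      intro f hf
      have : algebraMap ℝ C(X, ℝ) r * f = r • f := by ext x; simp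
      rw [this]
      exact M.smul_mem r hf
    | add a b _ _ ha hb => intro f hf; rw [add_mul]; exact M.add_mem (ha f hf) (hb f hf)
    | mul a b _ _ ha hb => intro f hf; rw [mul_assoc]; exact ha _ (hb f hf)
  let U : L2 μ := hu.toLp u
  have hcont : Continuous fun f : C(X, ℝ) => ⟪U, ContinuousMap.toLp 2 μ ℝ f⟫_ℝ :=
    continuous_const.inner (ContinuousMap.toLp 2 μ ℝ).continuous
  have hin : ∀ f : C(X, ℝ), ⟪U, ContinuousMap.toLp 2 μ ℝ f⟫_ℝ = ∫ x, u x * f x ∂μ := by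
    intro f
    rw [L2_inner_eq]
    refine integral_congr_ae ?_
    filter_upwards [hu.coeFn_toLp, ContinuousMap.coeFn_toLp (p := 2) (𝕜 := ℝ) μ f] with x h2 h3
    rw [h2, h3]
  have hMz : ∀ f ∈ M, ⟪U, ContinuousMap.toLp 2 μ ℝ f⟫_ℝ = 0 := by
    intro f hf
    induction hf using Submodule.span_induction with
    | mem g hg => rw [hin, h0 g hg]
    | zero => simp
    | add f g _ _ hf hg => rw [map_add, inner_add_right, hf, hg, add_zero]
    | smul c f _ hf => rw [map_smul, inner_smul_right, hf, mul_zero]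
  have hzero : ∀ f : C(X, ℝ), ⟪U, ContinuousMap.toLp 2 μ ℝ f⟫_ℝ = 0 := by
    intro f
    have hf := ContinuousMap.continuousMap_mem_subalgebra_closure_of_separatesPoints A hsep f
    have hcl : IsClosed {f : C(X, ℝ) | ⟪U, ContinuousMap.toLp 2 μ ℝ f⟫_ℝ = 0} :=
      isClosed_eq hcont continuous_const
    refine closure_minimal (fun a ha => ?_) hcl (hf : f ∈ closure (A : Set C(X, ℝ)))
    have := hAM a ha 1 (Submodule.subset_span h1)
    rw [mul_one] at this
    simp only [Set.mem_ofPred_eq]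
    exact hMz a this
  have hd := ContinuousMap.toLp_denseRange (p := 2) ℝ μ ℝ (by simp)
  have hU : U = 0 := by
    exact hd.eq_zero_of_inner_left ℝ fun f => hzero f
  filter_upwards [hu.coeFn_toLp, Lp.coeFn_zero ℝ 2 μ] with x h2 h3
  rw [← h2, ← h3]
  exact congrArg (fun v : L2 μ => v x) hU

/-- Spherical harmonics are total in `L²(∂Ω)`. -/
theorem sphere_eq_zero {u : L2 sigma}
    (h : ∀ l f, IsSH l f → ∫ x : Sph, u x * f x ∂sigma = 0) : u = 0 := by
  let G : Set C(Sph, ℝ) := {g | ∃ l f, IsSH l f ∧ ∀ x : Sph, g x = f x}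
  have hG : ∀ {l f} (hf : IsSH l f), (⟨fun x : Sph => f x, continuous_sphere hf.smooth.continuous⟩ :
      C(Sph, ℝ)) ∈ Submodule.span ℝ G := fun {l f} hf =>
    Submodule.subset_span ⟨l, f, hf, fun _ => rfl⟩
  have h0 := ae_eq_zero_of_orthogonal sigma ⟨fun x : Sph => (x : E3), continuous_subtype_val⟩
    Subtype.val_injective G ⟨0, _, IsSH.one_mem, fun _ => rfl⟩ ?_ (Lp.memLp u) ?_
  · exact (Lp.eq_zero_iff_ae_eq_zero).2 h0
  · rintro g ⟨l, f, hf, hgf⟩ i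
    cases l with
    | zero =>
      refine ⟨_, hG (hf.raise_mem i), fun x => ?_⟩
      simp [hgf, IsSH.raise, hf.pderiv_eq_zero]
    | succ l =>
      refine ⟨_, Submodule.add_mem _ (hG (hf.raise_mem i))
        (Submodule.smul_mem _ (2 * (l + 1 : ℕ) + 1 : ℝ)⁻¹ (hG (hf.pderiv_mem i))), fun x => ?_⟩
      simp [hgf, IsSH.raise]
  · rintro g ⟨l, f, hf, hgf⟩
    simp only [hgf]
    exact h l f hf

/-- The products of even powers of the norm with solid harmonics are total in `L²(Ω)`. -/
theorem ball_eq_zero {u : L2 volOm}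
    (h : ∀ k l f, IsSH l f → ∫ x in Om, u x * (‖x‖ ^ (2 * k) * f x) = 0) : u = 0 := by
  let X := Metric.closedBall (0 : E3) 1
  let μ : Measure X := (volume : Measure E3).comap Subtype.val
  have hX : MeasurableSet X := measurableSet_closedBall
  have : IsFiniteMeasure μ := ⟨by
    rw [(MeasurableEmbedding.subtype_coe hX).comap_apply]
    exact (measure_mono (Subtype.coe_image_subset _ _)).trans_lt measure_closedBall_lt_top⟩
  let G : Set C(X, ℝ) := {g | ∃ k l f, IsSH l f ∧ ∀ x : X, g x = ‖(x : E3)‖ ^ (2 * k) * f x}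
  have hG : ∀ (k : ℕ) {l f} (hf : IsSH l f), (⟨fun x : X => ‖(x : E3)‖ ^ (2 * k) * f x, by
      have := hf.smooth.continuous; fun_prop⟩ : C(X, ℝ)) ∈ Submodule.span ℝ G := fun k {l f} hf =>
    Submodule.subset_span ⟨k, l, f, hf, fun _ => rfl⟩
  let v : E3 → ℝ := indicator Om u
  have hv : MemLp v 2 volume := (memLp_indicator_iff_restrict measurableSet_ball).2 (Lp.memLp u)
  have hvX : MemLp (fun x : X => v x) 2 μ :=
    (hv.restrict X).comp_measurePreserving (measurePreserving_subtype_coe hX)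
  have h0 := ae_eq_zero_of_orthogonal μ ⟨fun x : X => (x : E3), continuous_subtype_val⟩
    Subtype.val_injective G ⟨0, 0, _, IsSH.one_mem, fun _ => by simp⟩ ?_ hvX ?_
  · have h1 : ∀ᵐ x ∂(volume.restrict X), v x = 0 := by
      rw [← map_comap_subtype_coe hX]
      exact (MeasurableEmbedding.subtype_coe hX).ae_map_iff.2 h0
    refine (Lp.eq_zero_iff_ae_eq_zero).2 ?_
    have h2 := ae_mono (Measure.restrict_mono_set volume
      (Metric.ball_subset_closedBall : Om ⊆ X)) h1
    filter_upwards [h2, ae_restrict_mem measurableSet_ball] with x hx hxm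
    simpa [v, indicator, hxm] using hx
  · rintro g ⟨k, l, f, hf, hgf⟩ i
    cases l with
    | zero =>
      refine ⟨_, hG k (hf.raise_mem i), fun x => ?_⟩
      simp [hgf, IsSH.raise, hf.pderiv_eq_zero]
      ring
    | succ l =>
      refine ⟨_, Submodule.add_mem _ (hG k (hf.raise_mem i))
        (Submodule.smul_mem _ (2 * (l + 1 : ℕ) + 1 : ℝ)⁻¹ (hG (k + 1) (hf.pderiv_mem i))),
        fun x => ?_⟩
      simp [hgf, IsSH.raise]
      ring
  · rintro g ⟨k, l, f, hf, hgf⟩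
    simp only [hgf]
    have h1 : ∫ x : X, v x * (‖(x : E3)‖ ^ (2 * k) * f x) ∂μ =
        ∫ x in X, v x * (‖x‖ ^ (2 * k) * f x) :=
      integral_subtype_comap hX fun x => v x * (‖x‖ ^ (2 * k) * f x)
    have h2 : (fun x => v x * (‖x‖ ^ (2 * k) * f x)) =
        indicator Om fun x => u x * (‖x‖ ^ (2 * k) * f x) := by
      ext x
      by_cases hx : x ∈ Om <;> simp only [v, indicator, hx, if_true, if_false, zero_mul]
    rw [ContinuousMap.coe_mk] at *
    rw [h1, h2, integral_indicator measurableSet_ball, Measure.restrict_restrict measurableSet_ball,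
      inter_eq_self_of_subset_left (Metric.ball_subset_closedBall : Om ⊆ X)]
    exact h k l f hf

/-! ### Inner products of solid harmonics -/

namespace IsSH

variable {l l' : ℕ} {h h' : E3 → ℝ}

theorem integral_rderiv_rderiv (hh : ContDiff ℝ ∞ h) (hh' : IsSH l' h') :
    ∑ j, ∫ x : Sph, rderiv j h x * rderiv j h' x ∂sigma =
      l' * (l' + 1) * ∫ x : Sph, h x * h' x ∂sigma := by
  have h1 : ∀ j, ∫ x : Sph, rderiv j h x * rderiv j h' x ∂sigma =
      - ∫ x : Sph, h x * rderiv j (rderiv j h') x ∂sigma := fun j => by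
    rw [integral_mul_rderiv j hh (contDiff_rderiv j hh'.smooth), neg_neg]
  simp only [h1]
  rw [Finset.sum_neg_distrib, ← integral_finsetSum]
  · simp only [← Finset.mul_sum, hh'.sum_rderiv_rderiv]
    rw [← integral_neg, ← integral_const_mul]
    exact integral_congr_ae (Eventually.of_forall fun x => by simp only; ring)
  · exact fun j _ => integrable_sphere (continuous_sphere
      (hh.mul (contDiff_rderiv j (contDiff_rderiv j hh'.smooth))).continuous)

theorem integral_eq_zero (hh : IsSH l h) (hh' : IsSH l' h') (hl : l ≠ l') :
    ∫ x : Sph, h x * h' x ∂sigma = 0 := by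
  have h1 := integral_rderiv_rderiv hh.smooth hh'
  have h2 := integral_rderiv_rderiv hh'.smooth hh
  have h3 : ∀ f g : E3 → ℝ, ∫ x : Sph, f x * g x ∂sigma = ∫ x : Sph, g x * f x ∂sigma :=
    fun f g => by simp only [mul_comm]
  rw [h3 h' h] at h2
  rw [Finset.sum_congr rfl fun j _ => h3 (rderiv j h) _, h2] at h1
  have h4 : (l * (l + 1) - l' * (l' + 1) : ℝ) * ∫ x : Sph, h x * h' x ∂sigma = 0 := by
    linear_combination h1
  refine (mul_eq_zero.1 h4).resolve_left ?_
  have h5 : (l * (l + 1) - l' * (l' + 1) : ℝ) = (l - l') * (l + l' + 1) := by ring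
  rw [h5]
  exact mul_ne_zero (sub_ne_zero.2 (by exact_mod_cast hl)) (by positivity)

theorem integral_ball (hh : IsSH l h) (hh' : IsSH l' h') :
    ∫ x in Om, h x * h' x = (l + l' + 3 : ℝ)⁻¹ * ∫ x : Sph, h x * h' x ∂sigma := by
  have := integral_ball_homog (hh.smooth.mul hh'.smooth).continuous (l + l') (fun hc x => by
    rw [hh.homog hc, hh'.homog hc]; ring)
  push_cast at this
  exact this

theorem integral_ball_pderiv_pderiv (hh : ContDiff ℝ ∞ h) (hh' : IsSH l' h') :
    ∑ j, ∫ x in Om, pderiv j h x * pderiv j h' x = l' * ∫ x : Sph, h x * h' x ∂sigma := by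
  have h1 : ∀ j, ∫ x in Om, pderiv j h x * pderiv j h' x =
      ∫ x : Sph, (x : E3) j * (h x * pderiv j h' x) ∂sigma -
        ∫ x in Om, h x * pderiv j (pderiv j h') x := fun j => by
    rw [integral_ball_mul_pderiv j hh (contDiff_pderiv j hh'.smooth)]
    ring
  have s1 := fun j => contDiff_pderiv j hh'.smooth
  simp only [h1, Finset.sum_sub_distrib]
  rw [← integral_finsetSum, ← integral_finsetSum]
  · simp only [← Finset.mul_sum, hh'.harmonic, mul_zero, integral_zero, sub_zero]
    rw [← integral_const_mul]
    refine integral_congr_ae (Eventually.of_forall fun x => ?_)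
    simp only
    rw [← mul_left_comm, ← hh'.euler, Finset.mul_sum]
    exact Finset.sum_congr rfl fun j _ => by ring
  · exact fun j _ => integrableOn_ball (hh.mul (contDiff_pderiv j (s1 j))).continuous
  · exact fun j _ => integrable_sphere (continuous_sphere
      ((contDiff_coord j).mul (hh.mul (s1 j))).continuous)

theorem integral_ball_pderiv2 (hh : IsSH l h) (hh' : IsSH l' h') :
    ∑ j, ∑ k, ∫ x in Om, pderiv k (pderiv j h) x * pderiv k (pderiv j h') x =
      (l' - 1) * (l + l' + 1) * l' * ∫ x : Sph, h x * h' x ∂sigma := by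
  rcases l' with _ | m'
  · have : ∀ j, pderiv j h' = fun _ => 0 := fun j => by ext y; exact hh'.pderiv_eq_zero j y
    simp [this, pderiv_const]
  rcases l with _ | m
  · have : ∀ j, pderiv j h = fun _ => 0 := fun j => by ext y; exact hh.pderiv_eq_zero j y
    rw [hh.integral_eq_zero hh' (by omega)]
    simp [this, pderiv_const]
  simp only [integral_ball_pderiv_pderiv (contDiff_pderiv _ hh.smooth) (hh'.pderiv_mem _)]
  have h1 := integral_ball_pderiv_pderiv hh.smooth hh'
  simp only [(hh.pderiv_mem _).integral_ball (hh'.pderiv_mem _), ← Finset.mul_sum] at h1 ⊢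
  have h2 : (m + m' + 3 : ℝ) ≠ 0 := by positivity
  rw [inv_mul_eq_iff_eq_mul₀ h2] at h1
  rw [h1]
  push_cast
  ring

end IsSH

/-! ### An orthonormal basis of spherical harmonics -/

/-- Restriction to the sphere, on solid harmonics. -/
def SH.res (l : ℕ) : SH l →ₗ[ℝ] L2 sigma where
  toFun h := resS h.1
  map_add' f g := toL2_add (memLp_sphere (IsSH.smooth f.2).continuous)
    (memLp_sphere (IsSH.smooth g.2).continuous)
  map_smul' c f := toL2_const_mul c (memLp_sphere (IsSH.smooth f.2).continuous)

/-- Spherical harmonics of degree `l` as a subspace of `L²(∂Ω)`. -/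
def sphHarm (l : ℕ) : Submodule ℝ (L2 sigma) := LinearMap.range (SH.res l)

instance (l : ℕ) : FiniteDimensional ℝ (sphHarm l) := by unfold sphHarm; infer_instance

/-- Index set of an orthonormal basis of spherical harmonics. -/
abbrev Idx : Type := Σ l : ℕ, Fin (Module.finrank ℝ (sphHarm l))

/-- The degree of a basis element. -/
abbrev deg (i : Idx) : ℕ := i.1

theorem inner_sphHarm {l l' : ℕ} (hl : l ≠ l') {u v : L2 sigma} (hu : u ∈ sphHarm l)
    (hv : v ∈ sphHarm l') : ⟪u, v⟫_ℝ = 0 := by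
  obtain ⟨f, rfl⟩ := hu
  obtain ⟨g, rfl⟩ := hv
  exact (inner_resS (IsSH.smooth f.2).continuous (IsSH.smooth g.2).continuous).trans
    (IsSH.integral_eq_zero f.2 g.2 hl)

theorem orthonormal_sphHarm : Orthonormal ℝ fun i : Idx =>
    ((stdOrthonormalBasis ℝ (sphHarm i.1) i.2 : sphHarm i.1) : L2 sigma) := by
  constructor
  · rintro ⟨l, a⟩
    exact (stdOrthonormalBasis ℝ (sphHarm l)).orthonormal.1 a
  · rintro ⟨l, a⟩ ⟨l', b⟩ hab
    by_cases hl : l = l'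
    · subst hl
      exact (stdOrthonormalBasis ℝ (sphHarm l)).orthonormal.2 fun h => hab (Sigma.ext rfl (heq_of_eq h))
    · exact inner_sphHarm hl (SetLike.coe_mem _) (SetLike.coe_mem _)

/-- An orthonormal basis of `L²(∂Ω)` made of spherical harmonics. -/
def eb : HilbertBasis Idx ℝ (L2 sigma) :=
  HilbertBasis.mkOfOrthogonalEqBot orthonormal_sphHarm (by
    rw [Submodule.eq_bot_iff]
    intro u hu
    refine sphere_eq_zero fun l f hf => ?_
    rw [← inner_toL2_right u (memLp_sphere hf.smooth.continuous)]
    have hm : resS f ∈ sphHarm l := ⟨⟨f, hf⟩, rfl⟩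
    have h1 := (stdOrthonormalBasis ℝ (sphHarm l)).sum_repr ⟨resS f, hm⟩
    have h2 : resS f = ((⟨resS f, hm⟩ : sphHarm l) : L2 sigma) := rfl
    change ⟪u, resS f⟫_ℝ = 0
    rw [h2, ← h1, Submodule.coe_sum, inner_sum]
    refine Finset.sum_eq_zero fun j _ => ?_
    rw [Submodule.coe_smul, inner_smul_right]
    rw [Submodule.mem_orthogonal'] at hu
    rw [hu _ (Submodule.subset_span ⟨⟨l, j⟩, rfl⟩), mul_zero])

theorem exists_solid (i : Idx) : ∃ h, IsSH (deg i) h ∧ eb i = resS h := by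
  have h1 : eb i = ((stdOrthonormalBasis ℝ (sphHarm i.1) i.2 : sphHarm i.1) : L2 sigma) := by
    simp [eb]
  obtain ⟨f, hf⟩ := (stdOrthonormalBasis ℝ (sphHarm i.1) i.2 : sphHarm i.1).2
  exact ⟨f.1, f.2, by rw [h1, ← hf]; rfl⟩

/-- The solid harmonic whose restriction to the sphere is the basis element with index `i`. -/
def Yb (i : Idx) : E3 → ℝ := (exists_solid i).choose

theorem isSH_Yb (i : Idx) : IsSH (deg i) (Yb i) := (exists_solid i).choose_spec.1

theorem eb_eq (i : Idx) : eb i = resS (Yb i) := (exists_solid i).choose_spec.2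

theorem contDiff_Yb (i : Idx) : ContDiff ℝ ∞ (Yb i) := (isSH_Yb i).smooth

theorem integral_Yb [DecidableEq Idx] (i j : Idx) :
    ∫ x : Sph, Yb i x * Yb j x ∂sigma = if i = j then 1 else 0 := by
  rw [← inner_resS (contDiff_Yb i).continuous (contDiff_Yb j).continuous, ← eb_eq, ← eb_eq]
  exact orthonormal_iff_ite.1 eb.orthonormal i j

open scoped InnerProductSpace

/-! ### The Poisson kernel -/

/-- A function that is smooth on a neighbourhood of the closed unit ball agrees near that ball
with a function that is smooth everywhere. -/
theorem exists_contDiff_extension {f : E3 → ℝ} {R : ℝ} (hR : 1 < R)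
    (hf : ∀ x ∈ Metric.ball (0 : E3) R, ContDiffAt ℝ ∞ f x) :
    ∃ g : E3 → ℝ, ContDiff ℝ ∞ g ∧ ∀ x ∈ Metric.closedBall (0 : E3) 1, g =ᶠ[𝓝 x] f := by
  let b : ContDiffBump (0 : E3) := ⟨(2 + R) / 3, (1 + 2 * R) / 3, by linarith, by linarith⟩
  refine ⟨fun x => b x * f x, ?_, fun x hx => ?_⟩
  · rw [contDiff_iff_contDiffAt]
    intro x
    by_cases hx : x ∈ Metric.ball (0 : E3) R
    · exact b.contDiffAt.mul (hf x hx)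
    · have h1 : x ∉ tsupport (b : E3 → ℝ) := by
        rw [b.tsupport_eq]
        simp only [Metric.mem_ball, Metric.mem_closedBall, not_lt, not_le] at hx ⊢
        refine lt_of_lt_of_le ?_ hx
        change (1 + 2 * R) / 3 < R
        linarith
      refine (contDiffAt_const (c := (0 : ℝ))).congr_of_eventuallyEq ?_
      filter_upwards [(isClosed_tsupport _).isOpen_compl.mem_nhds h1] with y hy
      rw [image_eq_zero_of_notMem_tsupport hy, zero_mul]
  · have h1 : x ∈ Metric.ball (0 : E3) b.rIn := by
      simp only [Metric.mem_ball, Metric.mem_closedBall] at hx ⊢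
      refine lt_of_le_of_lt hx ?_
      change 1 < (2 + R) / 3
      linarith
    filter_upwards [Metric.isOpen_ball.mem_nhds h1] with y hy
    rw [b.one_of_mem_closedBall (Metric.ball_subset_closedBall hy), one_mul]

theorem hasFDerivAt_distSq_rpow (z : E3) (a : ℝ) {y : E3} (hy : y ≠ z) :
    ∃ L : E3 →L[ℝ] ℝ, HasFDerivAt (fun y : E3 => (‖y - z‖ ^ 2) ^ a) L y ∧
      ∀ j, L (EuclideanSpace.single j 1) = 2 * a * (y j - z j) * (‖y - z‖ ^ 2) ^ (a - 1) := by
  have h0 : ‖y - z‖ ^ 2 ≠ 0 := by simpa [sub_eq_zero] using hy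
  have h2 : HasFDerivAt (fun y : E3 => y - z) (ContinuousLinearMap.id ℝ E3) y :=
    (hasFDerivAt_id y).sub_const z
  have h1 : HasFDerivAt (fun y : E3 => ‖y - z‖ ^ 2) ((2 • innerSL ℝ (y - z)).comp
      (ContinuousLinearMap.id ℝ E3)) y :=
    HasFDerivAt.comp (g := fun w : E3 => ‖w‖ ^ 2) (f := fun y : E3 => y - z) y
      (hasStrictFDerivAt_norm_sq (y - z)).hasFDerivAt h2
  refine ⟨_, h1.rpow_const (Or.inl h0), fun j => ?_⟩
  simp [PiLp.inner_apply]
  ring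

/-- The Newton potential with pole outside the closed ball, as a smooth function, with its
derivatives near the closed ball. -/
theorem exists_newton {z : E3} (hz : 1 < ‖z‖) : ∃ g : E3 → ℝ, ContDiff ℝ ∞ g ∧
    ∀ y ∈ Metric.closedBall (0 : E3) 1, g y = ‖y - z‖⁻¹ ∧
      (∀ j, pderiv j g y = -(y j - z j) * (‖y - z‖ ^ 3)⁻¹) ∧ ∑ j, pderiv j (pderiv j g) y = 0 := by
  have hrp : ∀ y : E3, (‖y - z‖ ^ 2) ^ (-(1 / 2) : ℝ) = ‖y - z‖⁻¹ := fun y => by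
    rw [Real.rpow_neg (sq_nonneg _), ← Real.sqrt_eq_rpow, Real.sqrt_sq (norm_nonneg _)]
  have hne : ∀ y ∈ Metric.ball (0 : E3) ‖z‖, y ≠ z := by
    rintro y hy rfl
    simp at hy
  obtain ⟨g, hg, hge⟩ := exists_contDiff_extension (f := fun y : E3 => (‖y - z‖ ^ 2) ^ (-(1 / 2) : ℝ))
    hz (fun y hy => by
      have h0 : ‖y - z‖ ^ 2 ≠ 0 := by simpa [sub_eq_zero] using hne y hy
      exact ((contDiff_norm_sq ℝ).comp (contDiff_id.sub contDiff_const)).contDiffAt.rpow_const_of_ne h0)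
  refine ⟨g, hg, fun y hy => ?_⟩
  have hyz : y ∈ Metric.ball (0 : E3) ‖z‖ := by
    simp only [Metric.mem_ball, Metric.mem_closedBall] at hy ⊢
    exact lt_of_le_of_lt hy hz
  have hy0 : ‖y - z‖ ^ 2 ≠ 0 := by simpa [sub_eq_zero] using hne y hyz
  have hpos : 0 < ‖y - z‖ := by
    rw [norm_pos_iff]; intro h; simp [h] at hy0
  have e1 : ∀ j, pderiv j g =ᶠ[𝓝 y] fun y => -((y j - z j) * (‖y - z‖ ^ 2) ^ (-(3 / 2) : ℝ)) := by
    intro j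
    filter_upwards [(hge y hy).eventuallyEq_nhds, Metric.isOpen_ball.mem_nhds hyz] with w hw hwz
    obtain ⟨L, hL, hLj⟩ := hasFDerivAt_distSq_rpow z (-(1 / 2)) (hne w hwz)
    simp only [pderiv]
    rw [hw.fderiv_eq, hL.fderiv, hLj]
    norm_num
    ring
  have e3 : ∀ b : ℝ, 0 ≤ b → (b ^ 2) ^ (-(3 / 2) : ℝ) = (b ^ 3)⁻¹ := fun b hb => by
    rw [Real.rpow_neg (sq_nonneg _), ← Real.rpow_natCast b 2, ← Real.rpow_mul hb]
    norm_num
  refine ⟨by rw [(hge y hy).eq_of_nhds, hrp], fun j => ?_, ?_⟩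
  · rw [(e1 j).eq_of_nhds, e3 _ (norm_nonneg _)]
    ring
  · have e2 : ∀ j, pderiv j (pderiv j g) y = -((‖y - z‖ ^ 2) ^ (-(3 / 2) : ℝ) +
        (y j - z j) * (-3 * (y j - z j) * (‖y - z‖ ^ 2) ^ (-(5 / 2) : ℝ))) := by
      intro j
      obtain ⟨L, hL, hLj⟩ := hasFDerivAt_distSq_rpow z (-(3 / 2)) (hne y hyz)
      have h1 : HasFDerivAt (fun y : E3 => y j - z j) (EuclideanSpace.proj (𝕜 := ℝ) j) y :=
        ((EuclideanSpace.proj (𝕜 := ℝ) j).hasFDerivAt).sub_const (z j)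
      have h2 := (h1.mul hL).neg
      simp only [pderiv]
      have h3 : fderiv ℝ (pderiv j g) y = _ := (e1 j).fderiv_eq.trans h2.fderiv
      change fderiv ℝ (pderiv j g) y _ = _
      rw [h3]
      simp [hLj]
      norm_num
      ring
    simp only [e2]
    have h4 : (‖y - z‖ ^ 2) ^ (-(3 / 2) : ℝ) = ‖y - z‖ ^ 2 * (‖y - z‖ ^ 2) ^ (-(5 / 2) : ℝ) := by
      rw [← Real.rpow_one_add' (sq_nonneg _) (by norm_num)]
      norm_num
    have h5 := normSq_eq (y - z)
    simp only [PiLp.sub_apply] at h5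
    rw [h4, Fin.sum_univ_three]
    linear_combination (-3 * (‖y - z‖ ^ 2) ^ (-(5 / 2) : ℝ)) * h5

section Poisson

variable {l : ℕ} {h : E3 → ℝ} (x : Sph)

theorem normSq_sub_smul (y : Sph) (ρ : ℝ) :
    ‖(y : E3) - ρ • (x : E3)‖ ^ 2 = 1 + ρ ^ 2 - 2 * ρ * ⟪(x : E3), y⟫_ℝ := by
  rw [norm_sub_sq_real, norm_smul, inner_smul_right, real_inner_comm]
  simp [norm_eq_of_mem_sphere]
  ring

theorem le_norm_sub_smul (y : Sph) {ρ : ℝ} (hρ : 1 < ρ) : ρ - 1 ≤ ‖(y : E3) - ρ • (x : E3)‖ := by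
  have := norm_sub_norm_le (ρ • (x : E3)) y
  rw [norm_sub_rev, norm_smul] at this
  simpa [norm_eq_of_mem_sphere, abs_of_pos (zero_lt_one.trans hρ)] using this

theorem norm_sub_smul_pos (y : Sph) {ρ : ℝ} (hρ : 1 < ρ) : 0 < ‖(y : E3) - ρ • (x : E3)‖ :=
  lt_of_lt_of_le (by linarith) (le_norm_sub_smul x y hρ)

theorem continuous_inv_norm_sub_smul {ρ : ℝ} (hρ : 1 < ρ) (k : ℕ) :
    Continuous fun y : Sph => (‖(y : E3) - ρ • (x : E3)‖ ^ k)⁻¹ :=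
  Continuous.inv₀ (by fun_prop) fun y => (pow_pos (norm_sub_smul_pos x y hρ) k).ne'

/-- The integral of a solid harmonic against `|y - ρ x|^{-k}`. -/
def potInt (h : E3 → ℝ) (k : ℕ) (ρ : ℝ) : ℝ :=
  ∫ y : Sph, h y * (‖(y : E3) - ρ • (x : E3)‖ ^ k)⁻¹ ∂sigma

theorem integrable_potInt (hh : Continuous h) {ρ : ℝ} (hρ : 1 < ρ) (k : ℕ) :
    Integrable (fun y : Sph => h y * (‖(y : E3) - ρ • (x : E3)‖ ^ k)⁻¹) sigma :=
  integrable_sphere ((continuous_sphere hh).mul (continuous_inv_norm_sub_smul x hρ k))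

/-- Green's second identity for a solid harmonic and a Newton potential. -/
theorem potInt_three (hh : IsSH l h) {ρ : ℝ} (hρ : 1 < ρ) :
    (ρ ^ 2 - 1) * potInt x h 3 ρ = (2 * l + 1) * potInt x h 1 ρ := by
  have hz : 1 < ‖ρ • (x : E3)‖ := by
    rw [norm_smul]; simpa [norm_eq_of_mem_sphere, abs_of_pos (zero_lt_one.trans hρ)]
  obtain ⟨g, hg, hgy⟩ := exists_newton hz
  have s1 := fun j => contDiff_pderiv j hg
  have h1 := IsSH.integral_ball_pderiv_pderiv hg hh
  have h2 : ∀ j, ∫ y in Om, pderiv j g y * pderiv j h y =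
      ∫ y : Sph, (y : E3) j * (h y * pderiv j g y) ∂sigma -
        ∫ y in Om, h y * pderiv j (pderiv j g) y := fun j => by
    have := integral_ball_mul_pderiv j hh.smooth (s1 j)
    have h3 : ∫ y in Om, pderiv j g y * pderiv j h y = ∫ y in Om, pderiv j h y * pderiv j g y := by
      simp only [mul_comm]
    linarith
  simp only [h2, Finset.sum_sub_distrib] at h1
  rw [← integral_finsetSum, ← integral_finsetSum] at h1
  rotate_left
  · exact fun j _ => integrableOn_ball (hh.smooth.mul (contDiff_pderiv j (s1 j))).continuous
  · exact fun j _ => integrable_sphere (continuous_sphere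
      ((contDiff_coord j).mul (hh.smooth.mul (s1 j))).continuous)
  have h3 : ∫ y in Om, ∑ j, h y * pderiv j (pderiv j g) y = 0 := by
    rw [← integral_zero E3 ℝ (μ := volOm)]
    refine setIntegral_congr_fun measurableSet_ball fun y hy => ?_
    simp only [← Finset.mul_sum, (hgy y (Metric.ball_subset_closedBall hy)).2.2, mul_zero]
  have hyc : ∀ y : Sph, (y : E3) ∈ Metric.closedBall (0 : E3) 1 := fun y =>
    Metric.sphere_subset_closedBall y.2
  have h4 : ∫ y : Sph, g y * h y ∂sigma = potInt x h 1 ρ := by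
    refine integral_congr_ae (Eventually.of_forall fun y => ?_)
    simp only [(hgy y (hyc y)).1, pow_one, mul_comm]
  have h5 : ∫ y : Sph, ∑ j, (y : E3) j * (h y * pderiv j g y) ∂sigma =
      -(1 / 2) * potInt x h 1 ρ + (1 / 2) * ((ρ ^ 2 - 1) * potInt x h 3 ρ) := by
    rw [potInt, potInt, ← integral_const_mul, ← integral_const_mul, ← integral_const_mul,
      ← integral_add]
    · refine integral_congr_ae (Eventually.of_forall fun y => ?_)
      simp only [(hgy y (hyc y)).2.1]
      have hp := norm_sub_smul_pos x y hρ
      have h6 := normSq_sub_smul x y ρ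
      have h7 : ‖(y : E3)‖ ^ 2 = 1 := by simp
      rw [normSq_eq] at h7
      have h8 : ⟪(x : E3), y⟫_ℝ = ∑ j, (y : E3) j * (x : E3) j := by simp [PiLp.inner_apply]
      rw [h8, Fin.sum_univ_three] at h6
      rw [Fin.sum_univ_three]
      simp only [PiLp.smul_apply, smul_eq_mul]
      field_simp
      linear_combination (2 * h y) * (-h7) + h y * h6
    · exact (integrable_potInt x hh.smooth.continuous hρ 1).const_mul _
    · exact ((integrable_potInt x hh.smooth.continuous hρ 3).const_mul _).const_mul _
  rw [h3, h4, h5] at h1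
  linarith

theorem hasDerivAt_potInt (hh : Continuous h) {ρ : ℝ} (hρ : 1 < ρ) :
    HasDerivAt (potInt x h 1) (∫ y : Sph, h y * (-(ρ - ⟪(x : E3), y⟫_ℝ) *
      (‖(y : E3) - ρ • (x : E3)‖ ^ 3)⁻¹) ∂sigma) ρ := by
  obtain ⟨C, hC⟩ := (isCompact_closedBall (0 : E3) 1).exists_bound_of_continuousOn hh.continuousOn
  have hC0 : 0 ≤ C := (norm_nonneg _).trans (hC 0 (by simp))
  let s : Set ℝ := Ioo ((1 + ρ) / 2) (2 * ρ)
  have hs : s ∈ 𝓝 ρ := isOpen_Ioo.mem_nhds ⟨by linarith, by linarith⟩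
  have hs1 : ∀ t ∈ s, 1 < t := fun t ht => by have := ht.1; linarith
  refine (hasDerivAt_integral_of_dominated_loc_of_deriv_le (μ := sigma) (s := s)
    (bound := fun _ => C * ((2 * ρ + 1) * (((ρ - 1) / 2) ^ 3)⁻¹))
    (F := fun t (y : Sph) => h y * (‖(y : E3) - t • (x : E3)‖ ^ 1)⁻¹)
    (F' := fun t (y : Sph) => h y * (-(t - ⟪(x : E3), y⟫_ℝ) * (‖(y : E3) - t • (x : E3)‖ ^ 3)⁻¹))
    hs ?_ (integrable_potInt x hh hρ 1) ?_ ?_ (integrable_const _) ?_).2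
  · filter_upwards [hs] with t ht
    exact (integrable_potInt x hh (hs1 t ht) 1).aestronglyMeasurable
  · have c1 := continuous_sphere hh
    have c2 := continuous_inv_norm_sub_smul x hρ 3
    exact Continuous.aestronglyMeasurable (by fun_prop)
  · refine Eventually.of_forall fun y t ht => ?_
    rw [norm_mul, norm_mul, norm_neg]
    have e1 := le_norm_sub_smul x y (hs1 t ht)
    have e2 : |⟪(x : E3), y⟫_ℝ| ≤ 1 := by
      have := abs_real_inner_le_norm (x : E3) y
      simpa [norm_eq_of_mem_sphere] using this
    have e4 := hs1 t ht
    have e5 := ht.1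
    have e6 := ht.2
    have e3 : ‖t - ⟪(x : E3), y⟫_ℝ‖ ≤ 2 * ρ + 1 := by
      refine (abs_sub _ _).trans ?_
      rw [abs_of_pos (by linarith : 0 < t)]
      linarith
    have e7 : ‖(‖(y : E3) - t • (x : E3)‖ ^ 3)⁻¹‖ ≤ (((ρ - 1) / 2) ^ 3)⁻¹ := by
      rw [norm_inv, norm_pow, norm_norm]
      refine inv_anti₀ (by have : 0 < ρ - 1 := by linarith
                           positivity) ?_
      refine pow_le_pow_left₀ (by linarith) ?_ 3
      linarith
    exact mul_le_mul (hC _ (Metric.sphere_subset_closedBall y.2))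
      (mul_le_mul e3 e7 (norm_nonneg _) (by linarith)) (by positivity) hC0
  · refine Eventually.of_forall fun y t ht => ?_
    have hp := norm_sub_smul_pos x y (hs1 t ht)
    have h2 : HasDerivAt (fun t : ℝ => ‖(y : E3) - t • (x : E3)‖ ^ 2) (2 * (t - ⟪(x : E3), y⟫_ℝ)) t := by
      simp only [normSq_sub_smul]
      have := (((hasDerivAt_pow 2 t).const_add 1).sub
        (((hasDerivAt_id t).const_mul 2).mul_const ⟪(x : E3), y⟫_ℝ))
      refine this.congr_deriv ?_
      simp
      ring
    have h3 := (h2.sqrt (by positivity)).inv (by rw [Real.sqrt_sq hp.le]; exact hp.ne')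
    have h4 := h3.const_mul (h y)
    simp only [Real.sqrt_sq (norm_nonneg _), pow_one] at h4 ⊢
    refine (h4.congr_of_eventuallyEq (Eventually.of_forall fun s => ?_)).congr_deriv ?_
    · simp
    · field_simp

theorem potInt_one_eq (hh : IsSH l h) : ∃ c, ∀ ρ, 1 < ρ → ρ ^ (l + 1) * potInt x h 1 ρ = c := by
  have hd : ∀ ρ, 1 < ρ → HasDerivAt (fun ρ => ρ ^ (l + 1) * potInt x h 1 ρ) 0 ρ := by
    intro ρ hρ
    have h1 := hasDerivAt_potInt x hh.smooth.continuous hρ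
    have h2 : ρ * ∫ y : Sph, h y * (-(ρ - ⟪(x : E3), y⟫_ℝ) *
        (‖(y : E3) - ρ • (x : E3)‖ ^ 3)⁻¹) ∂sigma =
        -(1 / 2) * potInt x h 1 ρ - 1 / 2 * ((ρ ^ 2 - 1) * potInt x h 3 ρ) := by
      rw [potInt, potInt, ← integral_const_mul, ← integral_const_mul, ← integral_const_mul,
        ← integral_const_mul, ← integral_sub]
      · refine integral_congr_ae (Eventually.of_forall fun y => ?_)
        have hp := norm_sub_smul_pos x y hρ
        have h6 := normSq_sub_smul x y ρ
        simp only
        field_simp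
        linear_combination (h y) * h6
      · exact (integrable_potInt x hh.smooth.continuous hρ 1).const_mul _
      · exact ((integrable_potInt x hh.smooth.continuous hρ 3).const_mul _).const_mul _
    rw [potInt_three x hh hρ] at h2
    refine ((hasDerivAt_pow (l + 1) ρ).mul h1).congr_deriv ?_
    rw [pow_succ ρ l, mul_assoc (ρ ^ l) ρ, h2]
    push_cast
    simp
    ring
  obtain ⟨a, ha⟩ := isOpen_Ioi.exists_is_const_of_fderiv_eq_zero (𝕜 := ℝ) (s := Ioi (1 : ℝ))
    isPreconnected_Ioi (fun ρ hρ => (hd ρ hρ).differentiableAt.differentiableWithinAt)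
    (fun ρ hρ => by simpa using (hd ρ hρ).hasFDerivAt.fderiv)
  exact ⟨a, ha⟩

/-- The total mass of the surface measure. -/
def sphMass : ℝ := sigma.real univ

theorem sphMass_pos : 0 < sphMass := by
  exact ENNReal.toReal_pos (Measure.measure_univ_ne_zero.2 (Measure.toSphere_ne_zero _))
    (measure_ne_top _ _)

theorem potInt_one_one {ρ : ℝ} (hρ : 1 < ρ) : ρ * potInt x (fun _ => 1) 1 ρ = sphMass := by
  obtain ⟨c, hc⟩ := potInt_one_eq x IsSH.one_mem
  simp only [zero_add, pow_one] at hc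
  rw [hc ρ hρ]
  -- The constant is found by letting `ρ → ∞`.
  have h1 : ∀ t : ℝ, 1 < t → |c - sphMass| ≤ sphMass * (t - 1)⁻¹ := by
    intro t ht
    have h2 : sphMass = ∫ _ : Sph, (1 : ℝ) ∂sigma := by simp [sphMass]
    rw [← hc t ht]
    nth_rw 1 [h2]
    rw [potInt, ← integral_const_mul, ← integral_sub
      ((integrable_potInt x continuous_const ht 1).const_mul t) (integrable_const _)]
    rw [mul_comm sphMass, ← Real.norm_eq_abs]
    refine norm_integral_le_of_norm_le_const (C := (t - 1)⁻¹)
      (Eventually.of_forall fun y => ?_)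
    have hp := norm_sub_smul_pos x y ht
    have hp1 := le_norm_sub_smul x y ht
    have h3 : |t - ‖(y : E3) - t • (x : E3)‖| ≤ 1 := by
      have := abs_norm_sub_norm_le (t • (x : E3)) (t • (x : E3) - y)
      rw [sub_sub_cancel, norm_eq_of_mem_sphere, norm_smul, norm_eq_of_mem_sphere,
        norm_sub_rev (t • (x : E3))] at this
      simpa [abs_of_pos (zero_lt_one.trans ht)] using this
    have h4 : t * (1 * (‖(y : E3) - t • (x : E3)‖ ^ 1)⁻¹) - 1 =
        (t - ‖(y : E3) - t • (x : E3)‖) * ‖(y : E3) - t • (x : E3)‖⁻¹ := by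
      field_simp
    rw [h4, norm_mul, Real.norm_eq_abs, norm_inv, norm_norm]
    calc _ ≤ 1 * (t - 1)⁻¹ := mul_le_mul h3 (inv_anti₀ (by linarith) hp1) (by positivity) zero_le_one
      _ = _ := one_mul _
  have h5 : Tendsto (fun t : ℝ => sphMass * (t - 1)⁻¹) atTop (𝓝 (sphMass * 0)) :=
    (tendsto_inv_atTop_zero.comp (tendsto_atTop_add_const_right _ (-1) tendsto_id)).const_mul _
  have h6 := ge_of_tendsto h5 ((eventually_gt_atTop 1).mono h1)
  rw [mul_zero] at h6
  exact sub_eq_zero.1 (abs_nonpos_iff.1 h6)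

theorem potInt_one_three {ρ : ℝ} (hρ : 1 < ρ) :
    ρ * ((ρ ^ 2 - 1) * potInt x (fun _ => 1) 3 ρ) = sphMass := by
  rw [potInt_three x IsSH.one_mem hρ, ← potInt_one_one x hρ]
  simp

theorem exists_lipschitz_sphere (hh : ContDiff ℝ ∞ h) :
    ∃ L : ℝ, 0 ≤ L ∧ ∀ x y : Sph, |h x - h y| ≤ L * ‖(x : E3) - y‖ := by
  obtain ⟨C, hC⟩ := (isCompact_closedBall (0 : E3) 1).exists_bound_of_continuousOn
    (hh.continuous_fderiv (by simp)).continuousOn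
  refine ⟨C, (norm_nonneg _).trans (hC 0 (by simp)), fun x y => ?_⟩
  exact (convex_closedBall (0 : E3) 1).norm_image_sub_le_of_norm_fderiv_le
    (fun z _ => ContDiff.diffAt hh z) hC (Metric.sphere_subset_closedBall y.2)
    (Metric.sphere_subset_closedBall x.2)

theorem potInt_three_eq (hh : IsSH l h) {ρ : ℝ} (hρ : 1 < ρ) :
    ρ ^ (l + 1) * ((ρ ^ 2 - 1) * potInt x h 3 ρ) = sphMass * h x := by
  obtain ⟨c, hc⟩ := potInt_one_eq x hh
  have key : ∀ t, 1 < t → t ^ (l + 1) * ((t ^ 2 - 1) * potInt x h 3 t) = (2 * l + 1) * c := by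
    intro t ht
    rw [potInt_three x hh ht, ← hc t ht]
    ring
  rw [key ρ hρ]
  -- The constant is found by letting `ρ → 1`, where the kernel is an approximate identity.
  obtain ⟨L, hL0, hL⟩ := exists_lipschitz_sphere hh.smooth
  have h1 : ∀ t : ℝ, 1 < t →
      |(t ^ l)⁻¹ * ((2 * l + 1) * c) - h x * sphMass| ≤ 2 * L * sphMass * √(t ^ 2 - 1) := by
    intro t ht
    set δ := √(t ^ 2 - 1) with hδ
    have ht2 : 0 < t ^ 2 - 1 := by nlinarith
    have hδ0 : 0 < δ := Real.sqrt_pos.2 ht2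
    have hδ2 : δ ^ 2 = t ^ 2 - 1 := Real.sq_sqrt ht2.le
    have i3 := integrable_potInt x hh.smooth.continuous ht 3
    have j3 := integrable_potInt (h := fun _ => (1 : ℝ)) x continuous_const ht 3
    have j1 := integrable_potInt (h := fun _ => (1 : ℝ)) x continuous_const ht 1
    have e1 : (t ^ l)⁻¹ * ((2 * l + 1) * c) - h x * sphMass =
        (t * (t ^ 2 - 1)) * (potInt x h 3 t - h x * potInt x (fun _ => 1) 3 t) := by
      rw [← key t ht, ← potInt_one_three x ht, pow_succ]
      have : t ≠ 0 := by positivity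
      field_simp
    have e2 : |potInt x h 3 t - h x * potInt x (fun _ => 1) 3 t| ≤
        L * (δ * potInt x (fun _ => 1) 3 t + δ⁻¹ * potInt x (fun _ => 1) 1 t) := by
      rw [potInt, potInt, potInt, ← integral_const_mul, ← integral_const_mul, ← integral_const_mul,
        ← integral_add (j3.const_mul _) (j1.const_mul _), ← integral_const_mul,
        ← integral_sub i3 (j3.const_mul _)]
      rw [← Real.norm_eq_abs]
      refine norm_integral_le_of_norm_le (((j3.const_mul _).add (j1.const_mul _)).const_mul _)
        (Eventually.of_forall fun y => ?_)
      have hp := norm_sub_smul_pos x y ht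
      have hp1 := le_norm_sub_smul x y ht
      set N := ‖(y : E3) - t • (x : E3)‖
      have h3 : ‖(y : E3) - x‖ ≤ 2 * N := by
        have : (y : E3) - x = (y - t • (x : E3)) + (t - 1) • (x : E3) := by
          rw [sub_smul, one_smul]; abel
        rw [this]
        refine (norm_add_le _ _).trans ?_
        rw [norm_smul, norm_eq_of_mem_sphere, mul_one, Real.norm_eq_abs, abs_of_pos (by linarith)]
        linarith
      have h4 : h y * (N ^ 3)⁻¹ - h x * (1 * (N ^ 3)⁻¹) = (h y - h x) * (N ^ 3)⁻¹ := by ring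
      rw [h4, norm_mul, norm_inv, norm_pow, Real.norm_eq_abs, Real.norm_eq_abs, abs_of_pos hp]
      have h5 : |h y - h x| * (N ^ 3)⁻¹ ≤ L * (2 * N) * (N ^ 3)⁻¹ :=
        mul_le_mul_of_nonneg_right ((hL y x).trans (mul_le_mul_of_nonneg_left h3 hL0))
          (by positivity)
      refine h5.trans ?_
      rw [mul_assoc]
      refine mul_le_mul_of_nonneg_left ?_ hL0
      have h6 : 2 * N * (N ^ 3)⁻¹ = 2 * N⁻¹ ^ 2 := by field_simp
      have h7 : δ * (1 * (N ^ 3)⁻¹) + δ⁻¹ * (1 * (N ^ 1)⁻¹) =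
          N⁻¹ * (δ * N⁻¹ ^ 2 + δ⁻¹) := by field_simp
      rw [h6, h7]
      have h8 : 2 * N⁻¹ ≤ δ * N⁻¹ ^ 2 + δ⁻¹ := by
        have h9 : δ * N⁻¹ ^ 2 + δ⁻¹ - 2 * N⁻¹ = δ * (N⁻¹ - δ⁻¹) ^ 2 := by field_simp; ring
        nlinarith [mul_nonneg hδ0.le (sq_nonneg (N⁻¹ - δ⁻¹))]
      have h10 : 0 < N⁻¹ := by positivity
      nlinarith
    rw [e1, abs_mul, abs_of_pos (by positivity)]
    refine (mul_le_mul_of_nonneg_left e2 (by positivity)).trans (le_of_eq ?_)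
    have k3 := potInt_one_three x ht
    have k1 := potInt_one_one x ht
    have hδi : (t ^ 2 - 1) * δ⁻¹ = δ := by rw [← hδ2]; field_simp
    linear_combination L * δ * k3 + L * (t * potInt x (fun _ => 1) 1 t) * hδi + L * δ * k1
  have c1 : ContinuousAt (fun t : ℝ => |(t ^ l)⁻¹ * ((2 * l + 1) * c) - h x * sphMass|) 1 := by
    have : ContinuousAt (fun t : ℝ => (t ^ l)⁻¹) 1 :=
      ContinuousAt.inv₀ (by fun_prop) (by simp)
    fun_prop
  have c2 : ContinuousAt (fun t : ℝ => 2 * L * sphMass * √(t ^ 2 - 1)) 1 := by fun_prop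
  have h2 := le_of_tendsto_of_tendsto (b := 𝓝[>] (1 : ℝ)) (c1.tendsto.mono_left nhdsWithin_le_nhds)
    (c2.tendsto.mono_left nhdsWithin_le_nhds)
    (by filter_upwards [self_mem_nhdsWithin] with t ht using h1 t ht)
  simp only [one_pow, inv_one, one_mul, sub_self, Real.sqrt_zero, mul_zero] at h2
  rw [sub_eq_zero.1 (abs_nonpos_iff.1 h2), mul_comm]

/-- The Poisson integral of a spherical harmonic. -/
theorem poisson (hh : IsSH l h) {r : ℝ} (h0 : 0 < r) (h1 : r < 1) :
    (1 - r ^ 2) * ∫ y : Sph, h y * (‖(y : E3) - r • (x : E3)‖ ^ 3)⁻¹ ∂sigma =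
      sphMass * (r ^ l * h x) := by
  have h2 := potInt_three_eq x hh (ρ := r⁻¹) ((one_lt_inv₀ h0).2 h1)
  have h3 : ∀ y : Sph, ‖(y : E3) - r⁻¹ • (x : E3)‖ = r⁻¹ * ‖(y : E3) - r • (x : E3)‖ := by
    intro y
    rw [← sq_eq_sq₀ (norm_nonneg _) (by positivity), mul_pow, normSq_sub_smul, normSq_sub_smul]
    field_simp
    ring
  have h4 : potInt x h 3 r⁻¹ = r ^ 3 *
      ∫ y : Sph, h y * (‖(y : E3) - r • (x : E3)‖ ^ 3)⁻¹ ∂sigma := by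
    rw [potInt, ← integral_const_mul]
    refine integral_congr_ae (Eventually.of_forall fun y => ?_)
    simp only [h3, mul_pow, mul_inv, inv_pow, inv_inv]
    ring
  rw [h4] at h2
  set I := ∫ y : Sph, h y * (‖(y : E3) - r • (x : E3)‖ ^ 3)⁻¹ ∂sigma
  rw [← mul_left_comm, ← h2, inv_pow, inv_pow, pow_succ r l]
  field_simp

end Poisson

open scoped InnerProductSpace

/-! ### Synthesis and analysis operators of a Hilbert basis -/

section Bessel

variable {ι H Z V : Type*} [NormedAddCommGroup H] [InnerProductSpace ℝ H]
  [NormedAddCommGroup Z] [NormedSpace ℝ Z] [NormedAddCommGroup V] [NormedSpace ℝ V]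

/-- A family satisfying a Bessel bound is the image of a Hilbert basis under a bounded operator. -/
theorem exists_synthesis [CompleteSpace Z] (b : HilbertBasis ι ℝ H) (z : ι → Z) {C : ℝ}
    (hC : 0 ≤ C) (hz : ∀ (s : Finset ι) (c : ι → ℝ), ‖∑ i ∈ s, c i • z i‖ ^ 2 ≤ C * ∑ i ∈ s, c i ^ 2) :
    ∃ T : H →L[ℝ] Z, ∀ i, T (b i) = z i := by
  classical
  have hsq : ∀ u : H, Summable fun i => ⟪b i, u⟫_ℝ ^ 2 := fun u => by
    have := b.summable_inner_mul_inner u u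
    refine this.congr fun i => ?_
    rw [real_inner_comm, sq]
  have hsum : ∀ u : H, Summable fun i => ⟪b i, u⟫_ℝ • z i := by
    intro u
    rw [summable_iff_vanishing_norm]
    intro ε hε
    obtain ⟨s, hs⟩ := summable_iff_vanishing_norm.1 (hsq u) (ε ^ 2 / (C + 1)) (by positivity)
    refine ⟨s, fun t ht => ?_⟩
    have h1 := hs t ht
    rw [Real.norm_of_nonneg (Finset.sum_nonneg fun _ _ => sq_nonneg _)] at h1
    have h2 := hz t fun i => ⟪b i, u⟫_ℝ
    refine lt_of_pow_lt_pow_left₀ 2 hε.le (h2.trans_lt ?_)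
    rw [lt_div_iff₀ (by positivity)] at h1
    nlinarith [Finset.sum_nonneg fun i (_ : i ∈ t) => sq_nonneg ⟪b i, u⟫_ℝ]
  let T : H →ₗ[ℝ] Z :=
    { toFun := fun u => ∑' i, ⟪b i, u⟫_ℝ • z i
      map_add' := fun u v => by
        rw [← (hsum u).tsum_add (hsum v)]
        exact tsum_congr fun i => by rw [inner_add_right, add_smul]
      map_smul' := fun c u => by
        rw [RingHom.id_apply, ← (hsum u).tsum_const_smul]
        exact tsum_congr fun i => by rw [inner_smul_right, mul_smul] }
  refine ⟨T.mkContinuous (√C) fun u => ?_, fun i => ?_⟩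
  · refine le_of_tendsto ((hsum u).hasSum.norm) (Eventually.of_forall fun s => ?_)
    refine le_of_sq_le_sq ?_ (by positivity)
    rw [mul_pow, Real.sq_sqrt hC]
    refine (hz s _).trans (mul_le_mul_of_nonneg_left ?_ hC)
    have h1 := b.orthonormal.sum_inner_products_le (s := s) u
    simpa using h1
  · change ∑' j, ⟪b j, b i⟫_ℝ • z j = z i
    rw [tsum_eq_single i]
    · simp [b.orthonormal.1 i]
    · intro j hj
      rw [b.orthonormal.2 hj, zero_smul]

/-- Linear functionals satisfying a Bessel bound are the coordinates of a bounded operator. -/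
theorem exists_analysis [CompleteSpace H] (b : HilbertBasis ι ℝ H) (a : ι → V →ₗ[ℝ] ℝ) {C : ℝ}
    (hC : 0 ≤ C) (ha : ∀ (s : Finset ι) (v : V), ∑ i ∈ s, a i v ^ 2 ≤ C * ‖v‖ ^ 2) :
    ∃ J : V →L[ℝ] H, ∀ v i, ⟪b i, J v⟫_ℝ = a i v := by
  have hm : ∀ v, Memℓp (fun i => a i v) 2 := fun v => by
    rw [memℓp_gen_iff (by norm_num)]
    simp only [ENNReal.toReal_ofNat, Real.rpow_two, Real.norm_eq_abs, sq_abs]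
    exact summable_of_sum_le (fun i => sq_nonneg _) fun s => ha s v
  let L : V →ₗ[ℝ] lp (fun _ : ι => ℝ) 2 :=
    { toFun := fun v => ⟨fun i => a i v, hm v⟩
      map_add' := fun u v => by ext i; exact map_add (a i) u v
      map_smul' := fun c v => by ext i; exact map_smul (a i) c v }
  have hL : ∀ v, ‖L v‖ ≤ √C * ‖v‖ := by
    intro v
    refine le_of_sq_le_sq ?_ (by positivity)
    rw [mul_pow, Real.sq_sqrt hC]
    have h1 := lp.norm_rpow_eq_tsum (p := 2) (by norm_num) (L v)
    simp only [ENNReal.toReal_ofNat, Real.rpow_two, Real.norm_eq_abs, sq_abs] at h1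
    rw [h1]
    exact Real.tsum_le_of_sum_le (fun i => sq_nonneg _) fun s => ha s v
  refine ⟨(b.repr.symm.toContinuousLinearEquiv : _ →L[ℝ] H).comp (L.mkContinuous _ hL), fun v i => ?_⟩
  rw [← b.repr_apply_apply]
  simp [L]

theorem norm_sq_sum_smul (z : ι → H) [DecidableEq ι] (lam : ι → ℝ)
    (hz : ∀ i j, ⟪z i, z j⟫_ℝ = if i = j then lam i else 0) (s : Finset ι) (c : ι → ℝ) :
    ‖∑ i ∈ s, c i • z i‖ ^ 2 = ∑ i ∈ s, lam i * c i ^ 2 := by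
  rw [← real_inner_self_eq_norm_sq, sum_inner]
  refine Finset.sum_congr rfl fun i hi => ?_
  rw [inner_sum]
  simp only [inner_smul_left, inner_smul_right, hz, RCLike.conj_to_real]
  rw [Finset.sum_eq_single i]
  · simp; ring
  · intro j _ hj
    simp [hj.symm]
  · exact fun h => absurd hi h

end Bessel

/-! ### Smooth functions as elements of the Sobolev spaces -/

/-- Iterated derivatives along a word. -/
def iterD (d : Fin 3 → (E3 → ℝ) → E3 → ℝ) : (k : ℕ) → (Fin k → Fin 3) → (E3 → ℝ) → E3 → ℝ
  | 0, _, φ => φ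
  | k + 1, α, φ => d (α 0) (iterD d k (Fin.tail α) φ)

theorem contDiff_iterD {d : Fin 3 → (E3 → ℝ) → E3 → ℝ}
    (hd : ∀ i φ, ContDiff ℝ ∞ φ → ContDiff ℝ ∞ (d i φ)) {φ : E3 → ℝ} (h : ContDiff ℝ ∞ φ) :
    ∀ (k : ℕ) (α : Fin k → Fin 3), ContDiff ℝ ∞ (iterD d k α φ)
  | 0, _ => h
  | k + 1, _ => hd _ _ (contDiff_iterD hd h k _)

theorem integral_ball_test (i : Fin 3) {φ p : E3 → ℝ} (h : ContDiff ℝ ∞ φ) (hp : ContDiff ℝ ∞ p)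
    (hs : ∀ x : Sph, p x = 0) :
    ∫ x in Om, pderiv i φ x * p x = - ∫ x in Om, φ x * pderiv i p x := by
  have := integral_ball_mul_pderiv i h hp
  simp only [hs, mul_zero, integral_zero, zero_sub] at this
  linarith

theorem eq_zero_of_tsupport_subset {p : E3 → ℝ} (hp : tsupport p ⊆ Om) (x : Sph) : p x = 0 :=
  image_eq_zero_of_notMem_tsupport fun h => by
    have := hp h
    simp at this

theorem toL2_mem_ballD (i : Fin 3) {φ : E3 → ℝ} (h : ContDiff ℝ ∞ φ) :
    (toL2 volOm φ, toL2 volOm (pderiv i φ)) ∈ ballD i := by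
  rintro ⟨p, p'⟩ ⟨hp, -, hps, hp'⟩
  simp only at hp hps hp'
  subst hp'
  have h1 := memLp_ball h.continuous
  have h2 := memLp_ball (contDiff_pderiv i h).continuous
  have h3 := memLp_ball hp.continuous
  have h4 := memLp_ball (contDiff_pderiv i hp).continuous
  simp only
  rw [← inner_toL2_right _ h3, ← inner_toL2_right _ h4, inner_toL2 h2 h3, inner_toL2 h1 h4]
  exact integral_ball_test i h hp (eq_zero_of_tsupport_subset hps)

theorem resS_mem_sphereD (i : Fin 3) {φ : E3 → ℝ} (h : ContDiff ℝ ∞ φ) :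
    (resS φ, resS (rderiv i φ)) ∈ sphereD i := by
  rintro ⟨p, p'⟩ ⟨ψ, hψ, hp, hp'⟩
  simp only at hp hp'
  subst hp hp'
  have h3 := memLp_sphere hψ.continuous
  have h4 := memLp_sphere (contDiff_rderiv i hψ).continuous
  simp only
  rw [← inner_toL2_right _ h3, ← inner_toL2_right _ h4]
  change ⟪resS _, resS _⟫_ℝ = -⟪resS _, resS _⟫_ℝ
  rw [inner_resS (contDiff_rderiv i h).continuous hψ.continuous,
    inner_resS h.continuous (contDiff_rderiv i hψ).continuous, integral_mul_rderiv i h hψ, neg_neg]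

/-- A smooth function as an element of `H^m(Ω)`. -/
def ballSob (m : ℕ) (φ : E3 → ℝ) (h : ContDiff ℝ ∞ φ) : sobolev ballD m :=
  ⟨WithLp.toLp 2 fun w : Words m => toL2 volOm (iterD pderiv w.1 w.2 φ), fun k _ α i => by
    have h1 := toL2_mem_ballD i (contDiff_iterD (fun i _ => contDiff_pderiv i) h k α)
    simpa [iterD] using h1⟩

/-- The restriction of a smooth function as an element of `H^m(∂Ω)`. -/
def sphSob (m : ℕ) (φ : E3 → ℝ) (h : ContDiff ℝ ∞ φ) : sobolev sphereD m :=
  ⟨WithLp.toLp 2 fun w : Words m => resS (iterD rderiv w.1 w.2 φ), fun k _ α i => by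
    have h1 := resS_mem_sphereD i (contDiff_iterD (fun i _ => contDiff_rderiv i) h k α)
    simpa [iterD] using h1⟩

theorem sum_words_zero (f : (Fin 0 → Fin 3) → ℝ) : ∑ α, f α = f ![] := by
  rw [Fintype.sum_unique]
  congr 1

theorem sum_words_succ {k : ℕ} (f : (Fin (k + 1) → Fin 3) → ℝ) :
    ∑ α, f α = ∑ i, ∑ β : Fin k → Fin 3, f (Fin.cons i β) := by
  rw [← Fintype.sum_prod_type']
  exact (Fintype.sum_equiv (Fin.consEquiv fun _ => Fin 3) _ _ fun p => rfl).symm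

theorem inner_ballSob {φ ψ : E3 → ℝ} (h : ContDiff ℝ ∞ φ) (k : ContDiff ℝ ∞ ψ) :
    ⟪ballSob 2 φ h, ballSob 2 ψ k⟫_ℝ = (∫ x in Om, φ x * ψ x) +
      (∑ i, ∫ x in Om, pderiv i φ x * pderiv i ψ x) +
      ∑ i, ∑ j, ∫ x in Om, pderiv j (pderiv i φ) x * pderiv j (pderiv i ψ) x := by
  rw [Submodule.coe_inner, PiLp.inner_apply, Fintype.sum_sigma, Fin.sum_univ_three]
  have hi : ∀ (n : ℕ) (α : Fin n → Fin 3), ⟪toL2 volOm (iterD pderiv n α φ),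
      toL2 volOm (iterD pderiv n α ψ)⟫_ℝ = ∫ x in Om, iterD pderiv n α φ x * iterD pderiv n α ψ x :=
    fun n α => inner_toL2
      (memLp_ball (contDiff_iterD (fun i _ => contDiff_pderiv i) h n α).continuous)
      (memLp_ball (contDiff_iterD (fun i _ => contDiff_pderiv i) k n α).continuous)
  have e0 : ∀ f : (Fin 0 → Fin 3) → ℝ, ∑ α, f α = f ![] := sum_words_zero
  have e1 : ∀ f : (Fin 1 → Fin 3) → ℝ, ∑ α, f α = ∑ i, f (Fin.cons i ![]) := fun f => by
    rw [sum_words_succ]; simp only [sum_words_zero]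
  have e2 : ∀ f : (Fin 2 → Fin 3) → ℝ, ∑ α, f α = ∑ i, ∑ j, f (Fin.cons i (Fin.cons j ![])) :=
    fun f => by rw [sum_words_succ]; simp only [e1]
  refine (congrArg₂ (· + ·) (congrArg₂ (· + ·) (e0 _) (e1 _)) (e2 _)).trans ?_
  simp only [ballSob]
  rw [Finset.sum_comm (s := (Finset.univ : Finset (Fin 3)))]
  refine congrArg₂ (· + ·) (congrArg₂ (· + ·) (hi 0 _) ?_) ?_
  · exact Finset.sum_congr rfl fun i _ => hi 1 _
  · exact Finset.sum_congr rfl fun i _ => Finset.sum_congr rfl fun j _ => hi 2 _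

theorem inner_ballSob_Yb [DecidableEq Idx] (i j : Idx) :
    ⟪ballSob 2 (Yb i) (contDiff_Yb i), ballSob 2 (Yb j) (contDiff_Yb j)⟫_ℝ =
      if i = j then ((2 * deg i + 3 : ℝ)⁻¹ + deg i + (deg i - 1) * (2 * deg i + 1) * deg i) else 0 := by
  rw [inner_ballSob, (isSH_Yb i).integral_ball (isSH_Yb j),
    IsSH.integral_ball_pderiv_pderiv (contDiff_Yb i) (isSH_Yb j),
    (isSH_Yb i).integral_ball_pderiv2 (isSH_Yb j), integral_Yb]
  split_ifs with h
  · subst h; ring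
  · simp

open scoped InnerProductSpace

/-! ### The Gagliardo form on the sphere -/

theorem L2_norm_sq {X : Type*} [MeasurableSpace X] {μ : Measure X} (f : L2 μ) :
    ENNReal.ofReal (‖f‖ ^ 2) = ∫⁻ x, ENNReal.ofReal (f x ^ 2) ∂μ := by
  rw [← real_inner_self_eq_norm_sq, L2_inner_eq, ofReal_integral_eq_lintegral_ofReal]
  · simp only [sq]
  · exact (Lp.memLp f).integrable_mul (Lp.memLp f)
  · exact Eventually.of_forall fun x => mul_self_nonneg _

/-- The Poisson kernel of the ball between the sphere of radius `r` and the unit sphere. -/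
def pk (r : ℝ) (p : Sph × Sph) : ℝ :=
  (1 - r ^ 2) / sphMass * (‖(p.2 : E3) - r • (p.1 : E3)‖ ^ 3)⁻¹

section pk

variable {r : ℝ}

theorem norm_sub_smul_comm (x y : Sph) : ‖(y : E3) - r • (x : E3)‖ = ‖(x : E3) - r • (y : E3)‖ := by
  rw [← sq_eq_sq₀ (norm_nonneg _) (norm_nonneg _), normSq_sub_smul, normSq_sub_smul,
    real_inner_comm]

theorem norm_sub_smul_pos' (h0 : 0 < r) (h1 : r < 1) (x y : Sph) :
    0 < ‖(y : E3) - r • (x : E3)‖ := by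
  rw [norm_pos_iff, sub_ne_zero]
  intro h
  have := congrArg norm h
  rw [norm_smul, norm_eq_of_mem_sphere, norm_eq_of_mem_sphere, Real.norm_of_nonneg h0.le] at this
  linarith

theorem pk_swap (p : Sph × Sph) : pk r p.swap = pk r p := by
  simp only [pk, Prod.fst_swap, Prod.snd_swap]
  rw [norm_sub_smul_comm]

theorem pk_nonneg (h0 : 0 < r) (h1 : r < 1) (p : Sph × Sph) : 0 ≤ pk r p := by
  have : 0 < 1 - r ^ 2 := by nlinarith
  have := sphMass_pos
  unfold pk
  positivity

theorem continuous_pk (h0 : 0 < r) (h1 : r < 1) : Continuous (pk r) := by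
  unfold pk
  refine continuous_const.mul (Continuous.inv₀ (by fun_prop) fun p => ?_)
  exact (pow_pos (norm_sub_smul_pos' h0 h1 p.1 p.2) 3).ne'

theorem integral_pk_mul (h0 : 0 < r) (h1 : r < 1) {l : ℕ} {h : E3 → ℝ} (hh : IsSH l h) (x : Sph) :
    ∫ y : Sph, pk r (x, y) * h y ∂sigma = r ^ l * h x := by
  have h2 := poisson x hh h0 h1
  have h3 := sphMass_pos
  have h4 : ∫ y : Sph, pk r (x, y) * h y ∂sigma = (1 - r ^ 2) / sphMass *
      ∫ y : Sph, h y * (‖(y : E3) - r • (x : E3)‖ ^ 3)⁻¹ ∂sigma := by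
    rw [← integral_const_mul]
    refine integral_congr_ae (Eventually.of_forall fun y => ?_)
    simp only [pk]
    ring
  rw [h4, div_mul_eq_mul_div, h2]
  field_simp

theorem integrable_pk_mul (h0 : 0 < r) (h1 : r < 1) {f : Sph × Sph → ℝ}
    (hf : Integrable f (sigma.prod sigma)) :
    Integrable (fun p => pk r p * f p) (sigma.prod sigma) := by
  obtain ⟨C, hC⟩ := isCompact_univ.exists_bound_of_continuousOn (continuous_pk h0 h1).continuousOn
  exact hf.bdd_mul (continuous_pk h0 h1).aestronglyMeasurable
    (Eventually.of_forall fun p => hC p (mem_univ p))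

theorem integrable_prod_of_memLp {v w : Sph → ℝ} (hv : MemLp v 2 sigma) (hw : MemLp w 2 sigma) :
    Integrable (fun p : Sph × Sph => v p.1 * w p.1) (sigma.prod sigma) ∧
    Integrable (fun p : Sph × Sph => v p.1 * w p.2) (sigma.prod sigma) := by
  refine ⟨?_, (hv.integrable (by norm_num)).mul_prod (hw.integrable (by norm_num))⟩
  have := (hv.integrable_mul hw).mul_prod (integrable_const (μ := sigma) (1 : ℝ))
  simpa using this

theorem integrable_diff_mul {v w : Sph → ℝ} (hv : MemLp v 2 sigma) (hw : MemLp w 2 sigma) :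
    Integrable (fun p : Sph × Sph => (v p.1 - v p.2) * (w p.1 - w p.2)) (sigma.prod sigma) := by
  obtain ⟨i1, i2⟩ := integrable_prod_of_memLp hv hw
  obtain ⟨-, i3⟩ := integrable_prod_of_memLp hw hv
  have := ((i1.sub i2).sub i3).add i1.swap
  refine this.congr (Eventually.of_forall fun p => ?_)
  simp
  ring

/-- The quadratic form with the Poisson kernel is diagonal in spherical harmonics. -/
theorem integral_pk_diff_mul (h0 : 0 < r) (h1 : r < 1) {v : Sph → ℝ} (hv : MemLp v 2 sigma)
    {l : ℕ} {h : E3 → ℝ} (hh : IsSH l h) :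
    ∫ p : Sph × Sph, pk r p * ((v p.1 - v p.2) * (h p.1 - h p.2)) ∂(sigma.prod sigma) =
      2 * (1 - r ^ l) * ∫ x : Sph, v x * h x ∂sigma := by
  have hm := memLp_sphere hh.smooth.continuous
  obtain ⟨i1, i2⟩ := integrable_prod_of_memLp hv hm
  have j1 := integrable_pk_mul h0 h1 i1
  have j2 := integrable_pk_mul h0 h1 i2
  have e1 : ∫ p : Sph × Sph, pk r p * (v p.1 * h p.1) ∂(sigma.prod sigma) =
      ∫ x : Sph, v x * h x ∂sigma := by
    rw [integral_prod _ j1]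
    refine integral_congr_ae (Eventually.of_forall fun x => ?_)
    simp only [integral_mul_const]
    have := integral_pk_mul h0 h1 IsSH.one_mem x
    simp only [mul_one, pow_zero] at this
    rw [this, one_mul]
  have e2 : ∫ p : Sph × Sph, pk r p * (v p.1 * h p.2) ∂(sigma.prod sigma) =
      r ^ l * ∫ x : Sph, v x * h x ∂sigma := by
    rw [integral_prod _ j2, ← integral_const_mul]
    refine integral_congr_ae (Eventually.of_forall fun x => ?_)
    simp only
    have := integral_pk_mul h0 h1 hh x
    calc _ = ∫ y : Sph, v x * (pk r (x, y) * h y) ∂sigma :=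
          integral_congr_ae (Eventually.of_forall fun y => by simp only; ring)
      _ = _ := by rw [integral_const_mul, this]; ring
  have e3 := integral_prod_swap (μ := sigma) (ν := sigma)
    fun p : Sph × Sph => pk r p * (v p.1 * h p.1)
  have e4 := integral_prod_swap (μ := sigma) (ν := sigma)
    fun p : Sph × Sph => pk r p * (v p.1 * h p.2)
  have j3 := j1.swap
  have j4 := j2.swap
  simp only [Function.comp_def, pk_swap, Prod.fst_swap, Prod.snd_swap] at e3 e4 j3 j4
  have e5 : ∀ p : Sph × Sph, pk r p * ((v p.1 - v p.2) * (h p.1 - h p.2)) =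
      (pk r p * (v p.1 * h p.1) - pk r p * (v p.1 * h p.2)) +
      (pk r p * (v p.2 * h p.2) - pk r p * (v p.2 * h p.1)) := fun p => by ring
  simp only [e5]
  rw [integral_add (by exact j1.sub j2) (by exact j3.sub j4), integral_sub j1 j2,
    integral_sub j3 j4, e3, e4, e1, e2]
  ring

/-- The combination `∑ cᵢ Rⱼ Yᵢ`. -/
def rsum (s : Finset Idx) (c : Idx → ℝ) (j : Fin 3) (x : E3) : ℝ :=
  ∑ i ∈ s, c i * rderiv j (Yb i) x

theorem contDiff_rsum (s : Finset Idx) (c : Idx → ℝ) (j : Fin 3) : ContDiff ℝ ∞ (rsum s c j) :=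
  ContDiff.sum fun i _ => contDiff_const.mul (contDiff_rderiv j (contDiff_Yb i))

theorem sum_integral_pk_rsum (h0 : 0 < r) (h1 : r < 1) (s : Finset Idx) (c : Idx → ℝ)
    (v : Fin 3 → Sph → ℝ) (hv : ∀ j, MemLp (v j) 2 sigma)
    (hc : ∀ i ∈ s, ∑ j, ∫ x : Sph, v j x * rderiv j (Yb i) x ∂sigma = deg i * (deg i + 1) * c i) :
    ∑ j, ∫ p : Sph × Sph, pk r p * ((v j p.1 - v j p.2) * (rsum s c j p.1 - rsum s c j p.2))
      ∂(sigma.prod sigma) =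
      ∑ i ∈ s, 2 * (1 - r ^ deg i) * (deg i * (deg i + 1)) * c i ^ 2 := by
  have e1 : ∀ j, ∫ p : Sph × Sph, pk r p * ((v j p.1 - v j p.2) *
      (rsum s c j p.1 - rsum s c j p.2)) ∂(sigma.prod sigma) =
      ∑ i ∈ s, c i * (2 * (1 - r ^ deg i) * ∫ x : Sph, v j x * rderiv j (Yb i) x ∂sigma) := by
    intro j
    have e2 : ∀ p : Sph × Sph, pk r p * ((v j p.1 - v j p.2) *
        (rsum s c j p.1 - rsum s c j p.2)) = ∑ i ∈ s, c i * (pk r p * ((v j p.1 - v j p.2) *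
          (rderiv j (Yb i) p.1 - rderiv j (Yb i) p.2))) := by
      intro p
      simp only [rsum]
      rw [← Finset.sum_sub_distrib, Finset.mul_sum, Finset.mul_sum]
      exact Finset.sum_congr rfl fun i _ => by ring
    simp only [e2]
    rw [integral_finsetSum]
    · refine Finset.sum_congr rfl fun i _ => ?_
      rw [integral_const_mul, integral_pk_diff_mul h0 h1 (hv j) ((isSH_Yb i).rderiv_mem j)]
    · intro i _
      exact (integrable_pk_mul h0 h1 (integrable_diff_mul (hv j) (memLp_sphere
        (contDiff_rderiv j (contDiff_Yb i)).continuous))).const_mul _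
  simp only [e1]
  rw [Finset.sum_comm]
  refine Finset.sum_congr rfl fun i hi => ?_
  rw [← Finset.mul_sum, ← Finset.mul_sum, hc i hi]
  ring

theorem sum_integral_rsum [DecidableEq Idx] (s : Finset Idx) (c : Idx → ℝ) (i : Idx) (hi : i ∈ s) :
    ∑ j, ∫ x : Sph, rsum s c j x * rderiv j (Yb i) x ∂sigma = deg i * (deg i + 1) * c i := by
  have h1 : ∀ j, rsum s c j = rderiv j (fun x => ∑ k ∈ s, c k * Yb k x) := fun j => by
    ext x
    rw [rderiv_sum _ _ (fun k _ => contDiff_const.mul (contDiff_Yb k))]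
    exact Finset.sum_congr rfl fun k _ => (rderiv_const_mul _ _ (contDiff_Yb k) _).symm
  simp only [h1]
  rw [IsSH.integral_rderiv_rderiv (ContDiff.sum fun k _ => contDiff_const.mul (contDiff_Yb k))
    (isSH_Yb i)]
  congr 1
  simp only [Finset.sum_mul, mul_assoc]
  rw [integral_finsetSum]
  · simp only [integral_const_mul, integral_Yb]
    simp [hi]
  · exact fun k _ => integrable_sphere (continuous_sphere
      (contDiff_const.mul ((contDiff_Yb k).mul (contDiff_Yb i))).continuous)

end pk

/-! ### Comparison of the Gagliardo seminorm with the Poisson form -/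

theorem lintegral_gagliardo {F : Sph × Sph → ℝ} (hF : AEStronglyMeasurable F (sigma.prod sigma)) :
    ∫⁻ p, ENNReal.ofReal (F p) ∂(gagliardo 2 sigma) =
      ∫⁻ p, ENNReal.ofReal ((dist p.1 p.2 ^ 3)⁻¹ * F p) ∂(sigma.prod sigma) := by
  rw [gagliardo, lintegral_withDensity_eq_lintegral_mul₀ (by fun_prop)
    hF.aemeasurable.ennreal_ofReal]
  refine lintegral_congr fun p => ?_
  rw [Pi.mul_apply, ENNReal.ofReal_mul (by positivity)]

theorem gagliardo_ac : gagliardo 2 sigma ≪ sigma.prod sigma := withDensity_absolutelyContinuous _ _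

theorem mul_dist_le {r : ℝ} (h0 : 0 < r) (h1 : r < 1) (x y : Sph) :
    r * dist x y ≤ ‖(y : E3) - r • (x : E3)‖ := by
  refine le_of_sq_le_sq ?_ (norm_nonneg _)
  have h2 := normSq_sub_smul y x r
  have h3 := normSq_sub_smul y x 1
  have h4 := abs_le.1 (abs_real_inner_le_norm (y : E3) (x : E3))
  rw [norm_eq_of_mem_sphere, norm_eq_of_mem_sphere] at h4
  rw [one_smul] at h3
  rw [Subtype.dist_eq, dist_comm, dist_eq_norm, mul_pow]
  have h5 := normSq_sub_smul x y r
  have h6 := normSq_sub_smul x y 1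
  rw [real_inner_comm] at h4
  rw [one_smul] at h6
  have h7 := real_inner_comm (x : E3) (y : E3)
  nlinarith [mul_nonneg (sub_nonneg.2 h1.le) (sub_nonneg.2 h1.le), mul_nonneg h0.le (sub_nonneg.2 h1.le)]

theorem integral_pk_sq_le {r : ℝ} (h0 : 0 < r) (h1 : r < 1) {u : Sph → ℝ} (hu : MemLp u 2 sigma)
    (V : L2 (gagliardo 2 sigma)) (hV : V =ᵐ[gagliardo 2 sigma] fun p => u p.1 - u p.2) :
    ∫ p : Sph × Sph, pk r p * ((u p.1 - u p.2) * (u p.1 - u p.2)) ∂(sigma.prod sigma) ≤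
      (1 - r ^ 2) / sphMass * (r ^ 3)⁻¹ * ‖V‖ ^ 2 := by
  have hi := integrable_diff_mul hu hu
  have hm := sphMass_pos
  have hr : 0 < 1 - r ^ 2 := by nlinarith
  refine (ENNReal.ofReal_le_ofReal_iff (by positivity)).1 ?_
  rw [ofReal_integral_eq_lintegral_ofReal (integrable_pk_mul h0 h1 hi)
    (Eventually.of_forall fun p => mul_nonneg (pk_nonneg h0 h1 p) (mul_self_nonneg _)),
    ENNReal.ofReal_mul (by positivity), L2_norm_sq]
  have h2 : ∫⁻ p, ENNReal.ofReal (V p ^ 2) ∂(gagliardo 2 sigma) =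
      ∫⁻ p, ENNReal.ofReal ((u p.1 - u p.2) * (u p.1 - u p.2)) ∂(gagliardo 2 sigma) := by
    refine lintegral_congr_ae ?_
    filter_upwards [hV] with p hp
    rw [hp, sq]
  rw [h2, lintegral_gagliardo hi.aestronglyMeasurable, ← lintegral_const_mul' _ _ ENNReal.ofReal_ne_top]
  refine lintegral_mono fun p => ?_
  rw [← ENNReal.ofReal_mul (by positivity)]
  refine ENNReal.ofReal_le_ofReal ?_
  by_cases hp : p.1 = p.2
  · simp [hp]
  have hd : 0 < dist p.1 p.2 := dist_pos.2 hp
  have h3 := mul_dist_le h0 h1 p.1 p.2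
  unfold pk
  rw [mul_assoc, mul_assoc, ← mul_assoc (r ^ 3)⁻¹]
  gcongr _ * ?_
  refine mul_le_mul_of_nonneg_right ?_ (mul_self_nonneg _)
  rw [← mul_inv, ← mul_pow]
  gcongr

/-- Passing to the limit `r → 1` in the Poisson form. -/
theorem lintegral_gagliardo_le {f : Sph → ℝ} (hf : Continuous f) {K : ℝ} (hK : 0 ≤ K)
    (h : ∀ r : ℝ, 0 < r → r < 1 → ∫ p : Sph × Sph, pk r p * ((f p.1 - f p.2) * (f p.1 - f p.2))
      ∂(sigma.prod sigma) ≤ (1 - r) * K) :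
    ∫⁻ p, ENNReal.ofReal ((f p.1 - f p.2) * (f p.1 - f p.2)) ∂(gagliardo 2 sigma) ≤
      ENNReal.ofReal (sphMass * K) := by
  have hm := sphMass_pos
  have hL : MemLp f 2 sigma := hf.memLp_of_hasCompactSupport (HasCompactSupport.of_compactSpace _)
  have hi := integrable_diff_mul hL hL
  rw [lintegral_gagliardo hi.aestronglyMeasurable]
  let r : ℕ → ℝ := fun n => 1 - 1 / (n + 2 : ℝ)
  have hr0 : ∀ n, 0 < r n := fun n => by
    have : (1 : ℝ) / (n + 2) < 1 := by rw [div_lt_one (by positivity)]; linarith [(Nat.cast_nonneg n : (0 : ℝ) ≤ n)]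
    simp only [r]; linarith
  have hr1 : ∀ n, r n < 1 := fun n => by
    have : (0 : ℝ) < 1 / (n + 2) := by positivity
    simp only [r]; linarith
  have hr : Tendsto r atTop (𝓝 1) := by
    have := (tendsto_const_div_atTop_nhds_zero_nat (1 : ℝ)).comp (tendsto_add_atTop_nat 2)
    have := this.const_sub 1
    simpa [r, Function.comp_def] using this
  let F : ℕ → Sph × Sph → ℝ≥0∞ := fun n p => ENNReal.ofReal (sphMass / (1 - r n ^ 2) *
    (pk (r n) p * ((f p.1 - f p.2) * (f p.1 - f p.2))))
  have hr2 : ∀ n, 0 < 1 - r n ^ 2 := fun n => by nlinarith [hr0 n, hr1 n]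
  have hlim : ∀ p : Sph × Sph, Tendsto (fun n => F n p) atTop
      (𝓝 (ENNReal.ofReal ((dist p.1 p.2 ^ 3)⁻¹ * ((f p.1 - f p.2) * (f p.1 - f p.2))))) := by
    intro p
    refine ENNReal.tendsto_ofReal ?_
    by_cases hp : p.1 = p.2
    · simp [hp]
    have hd : 0 < dist p.1 p.2 := dist_pos.2 hp
    have e : ∀ n, sphMass / (1 - r n ^ 2) * (pk (r n) p * ((f p.1 - f p.2) * (f p.1 - f p.2))) =
        (‖(p.2 : E3) - r n • (p.1 : E3)‖ ^ 3)⁻¹ * ((f p.1 - f p.2) * (f p.1 - f p.2)) := fun n => by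
      unfold pk
      have := (hr2 n).ne'
      field_simp
    simp only [e]
    refine Tendsto.mul_const _ (Tendsto.inv₀ ?_ (by positivity))
    have h1 : Tendsto (fun n => ‖(p.2 : E3) - r n • (p.1 : E3)‖ ^ 3) atTop
        (𝓝 (‖(p.2 : E3) - (1 : ℝ) • (p.1 : E3)‖ ^ 3)) :=
      ((tendsto_const_nhds.sub (hr.smul_const _)).norm).pow 3
    rwa [one_smul, ← dist_eq_norm, dist_comm] at h1
  have hFm : ∀ n, Measurable (F n) := fun n => by
    have := continuous_pk (hr0 n) (hr1 n)
    have : Continuous fun p : Sph × Sph => sphMass / (1 - r n ^ 2) *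
      (pk (r n) p * ((f p.1 - f p.2) * (f p.1 - f p.2))) := by fun_prop
    exact this.measurable.ennreal_ofReal
  calc _ = ∫⁻ p, liminf (fun n => F n p) atTop ∂(sigma.prod sigma) :=
        lintegral_congr fun p => (hlim p).liminf_eq.symm
    _ ≤ liminf (fun n => ∫⁻ p, F n p ∂(sigma.prod sigma)) atTop := lintegral_liminf_le hFm
    _ ≤ liminf (fun _ : ℕ => ENNReal.ofReal (sphMass * K)) atTop := by
        refine liminf_le_liminf (Eventually.of_forall fun n => ?_)
        simp only [F]
        rw [← ofReal_integral_eq_lintegral_ofReal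
          ((integrable_pk_mul (hr0 n) (hr1 n) hi).const_mul _)
          (Eventually.of_forall fun p => mul_nonneg (by have := hr2 n; positivity)
            (mul_nonneg (pk_nonneg (hr0 n) (hr1 n) p) (mul_self_nonneg _))), integral_const_mul]
        refine ENNReal.ofReal_le_ofReal ?_
        rw [div_mul_eq_mul_div, div_le_iff₀ (hr2 n)]
        have := h (r n) (hr0 n) (hr1 n)
        rw [mul_assoc]
        refine mul_le_mul_of_nonneg_left (this.trans ?_) hm.le
        nlinarith [hr0 n, hr1 n, mul_nonneg (mul_nonneg (hr0 n).le (sub_nonneg.2 (hr1 n).le)) hK]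
    _ = _ := by simp

theorem one_sub_pow_le {r : ℝ} (h0 : 0 < r) (l : ℕ) : 1 - r ^ l ≤ l * (1 - r) := by
  have := one_add_mul_le_pow (a := r - 1) (by linarith) l
  rw [add_sub_cancel] at this
  linarith

theorem lintegral_gagliardo_rsum (s : Finset Idx) (c : Idx → ℝ) (j : Fin 3) :
    ∫⁻ p : Sph × Sph, ENNReal.ofReal ((rsum s c j p.1 - rsum s c j p.2) *
      (rsum s c j p.1 - rsum s c j p.2)) ∂(gagliardo 2 sigma) ≤
      ENNReal.ofReal (sphMass * ∑ i ∈ s, 2 * (deg i ^ 2 * (deg i + 1)) * c i ^ 2) := by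
  classical
  have hm := fun j => memLp_sphere (contDiff_rsum s c j).continuous
  refine lintegral_gagliardo_le (f := fun x : Sph => rsum s c j x)
    (continuous_sphere (contDiff_rsum s c j).continuous)
    (Finset.sum_nonneg fun i _ => by positivity) fun r h0 h1 => ?_
  have h2 := sum_integral_pk_rsum h0 h1 s c (fun j (x : Sph) => rsum s c j x) hm
    fun i hi => sum_integral_rsum s c i hi
  have h3 : ∀ j, 0 ≤ ∫ p : Sph × Sph, pk r p * ((rsum s c j p.1 - rsum s c j p.2) *
      (rsum s c j p.1 - rsum s c j p.2)) ∂(sigma.prod sigma) := fun j =>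
    integral_nonneg fun p => mul_nonneg (pk_nonneg h0 h1 p) (mul_self_nonneg _)
  refine (Finset.single_le_sum (f := fun j => ∫ p : Sph × Sph, pk r p * ((rsum s c j p.1 -
    rsum s c j p.2) * (rsum s c j p.1 - rsum s c j p.2)) ∂(sigma.prod sigma))
    (fun j _ => h3 j) (Finset.mem_univ j)).trans ?_
  rw [h2, Finset.mul_sum]
  refine Finset.sum_le_sum fun i _ => ?_
  have h4 := one_sub_pow_le h0 (deg i)
  have h5 : (0 : ℝ) ≤ 2 * (deg i * (deg i + 1)) * c i ^ 2 := by positivity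
  nlinarith [mul_le_mul_of_nonneg_right h4 h5]

/-- The lower bound of the `H^{3/2}` norm by spherical harmonic coefficients: the Poisson form is
nonnegative on the difference between the function and a partial sum of its expansion. -/
theorem sum_coeff_le (u : L2 sigma) (U : Fin 3 → L2 sigma) (hU : ∀ j, (u, U j) ∈ sphereD j)
    (V : Fin 3 → L2 (gagliardo 2 sigma))
    (hV : ∀ j, V j =ᵐ[gagliardo 2 sigma] fun p => U j p.1 - U j p.2) (s : Finset Idx) :
    ∑ i ∈ s, (deg i : ℝ) ^ 2 * (deg i + 1) * ⟪eb i, u⟫_ℝ ^ 2 ≤ sphMass⁻¹ * ∑ j, ‖V j‖ ^ 2 := by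
  classical
  have hm0 := sphMass_pos
  let c : Idx → ℝ := fun i => ⟪eb i, u⟫_ℝ
  have hm := fun j => memLp_sphere (contDiff_rsum s c j).continuous
  have hUc : ∀ i, ∑ j, ∫ x : Sph, U j x * rderiv j (Yb i) x ∂sigma = deg i * (deg i + 1) * c i := by
    intro i
    have h1 : ∀ j, ∫ x : Sph, U j x * rderiv j (Yb i) x ∂sigma =
        -∫ x : Sph, u x * rderiv j (rderiv j (Yb i)) x ∂sigma := fun j =>
      hU j (_, _) ⟨rderiv j (Yb i), contDiff_rderiv j (contDiff_Yb i), rfl, rfl⟩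
    simp only [h1]
    rw [Finset.sum_neg_distrib, ← integral_finsetSum]
    · simp only [← Finset.mul_sum, (isSH_Yb i).sum_rderiv_rderiv]
      simp only [c]
      rw [real_inner_comm, eb_eq, resS, inner_toL2_right _ (memLp_sphere (contDiff_Yb i).continuous),
        ← integral_neg, ← integral_const_mul]
      exact integral_congr_ae (Eventually.of_forall fun x => by simp only; ring)
    · exact fun j _ => (Lp.memLp u).integrable_mul (memLp_sphere
        (contDiff_rderiv j (contDiff_rderiv j (contDiff_Yb i))).continuous)
  have key : ∀ r : ℝ, 0 < r → r < 1 → ∑ i ∈ s, 2 * (∑ k ∈ Finset.range (deg i), r ^ k) *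
      (deg i * (deg i + 1)) * c i ^ 2 ≤ (1 + r) / sphMass * (r ^ 3)⁻¹ * ∑ j, ‖V j‖ ^ 2 := by
    intro r h0 h1
    have hl := fun j => Lp.memLp (U j)
    have h2 := sum_integral_pk_rsum h0 h1 s c (fun j x => U j x) hl fun i _ => hUc i
    have h3 := sum_integral_pk_rsum h0 h1 s c (fun j (x : Sph) => rsum s c j x) hm
      fun i hi => sum_integral_rsum s c i hi
    have h4 : ∀ j, 0 ≤ (∫ p : Sph × Sph, pk r p * ((U j p.1 - U j p.2) * (U j p.1 - U j p.2))
        ∂(sigma.prod sigma)) - 2 * (∫ p : Sph × Sph, pk r p * ((U j p.1 - U j p.2) *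
        (rsum s c j p.1 - rsum s c j p.2)) ∂(sigma.prod sigma)) + ∫ p : Sph × Sph, pk r p *
        ((rsum s c j p.1 - rsum s c j p.2) * (rsum s c j p.1 - rsum s c j p.2))
        ∂(sigma.prod sigma) := by
      intro j
      have k1 := integrable_pk_mul h0 h1 (integrable_diff_mul (hl j) (hl j))
      have k2 := integrable_pk_mul h0 h1 (integrable_diff_mul (hl j) (hm j))
      have k3 := integrable_pk_mul h0 h1 (integrable_diff_mul (hm j) (hm j))
      rw [← integral_const_mul, ← integral_sub k1 (k2.const_mul 2),
        ← integral_add (by exact k1.sub (k2.const_mul 2)) k3]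
      refine integral_nonneg fun p => ?_
      have e := mul_nonneg (pk_nonneg h0 h1 p) (sq_nonneg ((U j p.1 - U j p.2) -
        (rsum s c j p.1 - rsum s c j p.2)))
      simp only [Pi.zero_apply]
      linarith
    have h5 := Finset.sum_nonneg fun j (_ : j ∈ Finset.univ) => h4 j
    rw [Finset.sum_add_distrib, Finset.sum_sub_distrib, ← Finset.mul_sum, h2, h3] at h5
    have h6 := Finset.sum_le_sum fun j (_ : j ∈ Finset.univ) =>
      integral_pk_sq_le h0 h1 (hl j) (V j) (hV j)
    rw [← Finset.mul_sum] at h6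
    have h7 : ∑ i ∈ s, 2 * (1 - r ^ deg i) * (deg i * (deg i + 1)) * c i ^ 2 =
        (1 - r) * ∑ i ∈ s, 2 * (∑ k ∈ Finset.range (deg i), r ^ k) *
          (deg i * (deg i + 1)) * c i ^ 2 := by
      rw [Finset.mul_sum]
      refine Finset.sum_congr rfl fun i _ => ?_
      rw [← mul_neg_geom_sum]
      ring
    rw [h7] at h5
    refine le_of_mul_le_mul_left ?_ (sub_pos.2 h1)
    calc _ ≤ _ := by linarith
      _ ≤ _ := h6
      _ = _ := by ring
  have l1 : Tendsto (fun r : ℝ => ∑ i ∈ s, 2 * (∑ k ∈ Finset.range (deg i), r ^ k) *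
      (deg i * (deg i + 1)) * c i ^ 2) (𝓝[<] 1) (𝓝 (∑ i ∈ s, 2 * (∑ k ∈ Finset.range (deg i), 1 ^ k) *
      (deg i * (deg i + 1)) * c i ^ 2)) :=
    (Continuous.tendsto (by fun_prop) 1).mono_left nhdsWithin_le_nhds
  have l2 : Tendsto (fun r : ℝ => (1 + r) / sphMass * (r ^ 3)⁻¹ * ∑ j, ‖V j‖ ^ 2) (𝓝[<] 1)
      (𝓝 ((1 + 1) / sphMass * (1 ^ 3)⁻¹ * ∑ j, ‖V j‖ ^ 2)) := by
    refine (ContinuousAt.tendsto ?_).mono_left nhdsWithin_le_nhds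
    have : ContinuousAt (fun r : ℝ => (r ^ 3)⁻¹) 1 := (continuousAt_id.pow 3).inv₀ (by simp)
    fun_prop
  have h8 := le_of_tendsto_of_tendsto l1 l2 (by
    filter_upwards [Ioo_mem_nhdsLT (zero_lt_one (α := ℝ))] with r hr
    exact key r hr.1 hr.2)
  simp only [one_pow, Finset.sum_const, Finset.card_range, nsmul_eq_mul, mul_one, inv_one] at h8
  have h9 : ∑ i ∈ s, 2 * (deg i : ℝ) * (deg i * (deg i + 1)) * c i ^ 2 =
      2 * ∑ i ∈ s, (deg i : ℝ) ^ 2 * (deg i + 1) * c i ^ 2 := by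
    rw [Finset.mul_sum]
    exact Finset.sum_congr rfl fun i _ => by ring
  rw [h9] at h8
  have h10 : (1 + 1) / sphMass * ∑ j, ‖V j‖ ^ 2 = 2 * (sphMass⁻¹ * ∑ j, ‖V j‖ ^ 2) := by ring
  linarith

/-! ### Completeness of the Sobolev spaces -/

section complete

variable {X : Type*} [MeasurableSpace X] {μ : Measure X}

theorem isClosed_weakGraph (P : Set ((X → ℝ) × (X → ℝ)))
    (hP : ∀ p ∈ P, MemLp p.1 2 μ ∧ MemLp p.2 2 μ) :
    IsClosed (weakGraph μ P hP : Set (L2 μ × L2 μ)) := by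
  have : (weakGraph μ P hP : Set (L2 μ × L2 μ)) =
      ⋂ p ∈ P, {w | ⟪w.2, toL2 μ p.1⟫_ℝ = -⟪w.1, toL2 μ p.2⟫_ℝ} := by
    ext w
    simp only [mem_iInter]
    refine forall_congr' fun p => forall_congr' fun hp => ?_
    rw [Set.mem_ofPred_eq, inner_toL2_right _ (hP p hp).1, inner_toL2_right _ (hP p hp).2]
  rw [this]
  exact isClosed_biInter fun p _ => isClosed_eq (by fun_prop) (by fun_prop)

theorem isClosed_ballD (i : Fin 3) : IsClosed (ballD i : Set (L2 volOm × L2 volOm)) :=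
  isClosed_weakGraph _ _

theorem isClosed_sphereD (i : Fin 3) : IsClosed (sphereD i : Set (L2 sigma × L2 sigma)) :=
  isClosed_weakGraph _ _

theorem isClosed_sobolev {D : Fin 3 → Submodule ℝ (L2 μ × L2 μ)}
    (hD : ∀ i, IsClosed (D i : Set (L2 μ × L2 μ))) (m : ℕ) :
    IsClosed (sobolev D m : Set (PiLp 2 (fun _ : Words m => L2 μ))) := by
  have : (sobolev D m : Set (PiLp 2 (fun _ : Words m => L2 μ))) =
      ⋂ (k : ℕ) (hk : k + 1 ≤ m) (α : Fin k → Fin 3) (i : Fin 3),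
        (fun U : PiLp 2 (fun _ : Words m => L2 μ) => (U (word k (Nat.le_of_succ_le hk) α),
          U (word (k + 1) hk (Fin.cons i α)))) ⁻¹' (D i : Set (L2 μ × L2 μ)) := by
    ext w
    simp only [mem_iInter]
    rfl
  rw [this]
  refine isClosed_iInter fun k => isClosed_iInter fun hk => isClosed_iInter fun α =>
    isClosed_iInter fun i => (hD i).preimage ?_
  fun_prop

theorem isClosed_sobolevHalf [Dist X] [SFinite μ] {D : Fin 3 → Submodule ℝ (L2 μ × L2 μ)}
    (hD : ∀ i, IsClosed (D i : Set (L2 μ × L2 μ))) (n m : ℕ) :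
    IsClosed (sobolevHalf n D m : Set (WithLp 2 (PiLp 2 (fun _ : Words m => L2 μ) ×
      PiLp 2 (fun _ : Fin m → Fin 3 => L2 (gagliardo n μ))))) := by
  refine IsSeqClosed.isClosed fun W W₀ hW hlim => ⟨?_, fun α => ?_⟩
  · have h1 : Continuous fun W : WithLp 2 (PiLp 2 (fun _ : Words m => L2 μ) ×
        PiLp 2 (fun _ : Fin m → Fin 3 => L2 (gagliardo n μ))) => W.fst := by fun_prop
    exact (isClosed_sobolev hD m).mem_of_tendsto ((h1.tendsto W₀).comp hlim)
      (Eventually.of_forall fun k => (hW k).1)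
  · have h1 : Continuous fun W : WithLp 2 (PiLp 2 (fun _ : Words m => L2 μ) ×
        PiLp 2 (fun _ : Fin m → Fin 3 => L2 (gagliardo n μ))) => W.fst (word m le_rfl α) := by
      fun_prop
    have h2 : Continuous fun W : WithLp 2 (PiLp 2 (fun _ : Words m => L2 μ) ×
        PiLp 2 (fun _ : Fin m → Fin 3 => L2 (gagliardo n μ))) => W.snd α := by
      fun_prop
    have hac : gagliardo n μ ≪ μ.prod μ := withDensity_absolutelyContinuous _ _
    obtain ⟨a, ha, ha'⟩ := (tendstoInMeasure_of_tendsto_Lp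
      ((h1.tendsto W₀).comp hlim)).exists_seq_tendsto_ae
    obtain ⟨b, hb, hb'⟩ := (tendstoInMeasure_of_tendsto_Lp
      ((h2.tendsto W₀).comp (hlim.comp ha.tendsto_atTop))).exists_seq_tendsto_ae
    have h3 : ∀ᵐ p ∂(gagliardo n μ), ∀ k, (W k).snd α p =
        (W k).fst (word m le_rfl α) p.1 - (W k).fst (word m le_rfl α) p.2 :=
      ae_all_iff.2 fun k => (hW k).2 α
    filter_upwards [h3, hb', hac.ae_le (Measure.quasiMeasurePreserving_fst.ae ha'),
      hac.ae_le (Measure.quasiMeasurePreserving_snd.ae ha')] with p h4 h5 h6 h7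
    refine tendsto_nhds_unique h5 ?_
    have h8 := (h6.sub h7).comp hb.tendsto_atTop
    refine h8.congr fun k => ?_
    simp only [Function.comp_apply]
    rw [h4]

end complete

instance : CompleteSpace H2Om := (isClosed_sobolev isClosed_ballD 2).completeSpace_coe

instance : CompleteSpace H12Om := (isClosed_sobolevHalf isClosed_ballD 3 0).completeSpace_coe

instance : CompleteSpace H32S := (isClosed_sobolevHalf isClosed_sphereD 2 1).completeSpace_coe

/-! ### Traces as a closed linear relation -/

/-- The triples of a smooth function, its gradient and its restriction to the sphere. -/
def smoothTriples : Submodule ℝ (L2 volOm × (Fin 3 → L2 volOm) × L2 sigma) where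
  carrier := {w | ∃ φ : E3 → ℝ, ContDiff ℝ ∞ φ ∧
    w = (toL2 volOm φ, fun j => toL2 volOm (pderiv j φ), resS φ)}
  zero_mem' := ⟨fun _ => 0, contDiff_const, by
    have h0 : ∀ {Y : Type} [MeasurableSpace Y] (ν : Measure Y), toL2 ν (fun _ : Y => (0 : ℝ)) = 0 :=
      fun ν => by
        have := toL2_const_mul (μ := ν) (f := fun _ => (0 : ℝ)) 0 MemLp.zero
        simpa using this
    have h1 : ∀ j, pderiv j (fun _ => (0 : ℝ)) = fun _ => 0 := fun j => by
      ext x; exact pderiv_const j 0 x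
    simp only [h1, resS, h0]
    rfl⟩
  add_mem' := by
    rintro a b ⟨φ, hφ, rfl⟩ ⟨ψ, hψ, rfl⟩
    refine ⟨fun x => φ x + ψ x, hφ.add hψ, ?_⟩
    have h1 : ∀ j, pderiv j (fun x => φ x + ψ x) = fun x => pderiv j φ x + pderiv j ψ x := fun j => by
      ext x; exact pderiv_add j hφ hψ x
    simp only [h1, resS]
    rw [toL2_add (memLp_ball hφ.continuous) (memLp_ball hψ.continuous),
      toL2_add (memLp_sphere hφ.continuous) (memLp_sphere hψ.continuous)]
    simp only [toL2_add (memLp_ball (contDiff_pderiv _ hφ).continuous)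
      (memLp_ball (contDiff_pderiv _ hψ).continuous)]
    rfl
  smul_mem' := by
    rintro c a ⟨φ, hφ, rfl⟩
    refine ⟨fun x => c * φ x, contDiff_const.mul hφ, ?_⟩
    have h1 : ∀ j, pderiv j (fun x => c * φ x) = fun x => c * pderiv j φ x := fun j => by
      ext x; exact pderiv_const_mul j c hφ x
    simp only [h1, resS]
    rw [toL2_const_mul c (memLp_ball hφ.continuous), toL2_const_mul c (memLp_sphere hφ.continuous)]
    simp only [toL2_const_mul c (memLp_ball (contDiff_pderiv _ hφ).continuous)]
    rfl

theorem tendsto_toL2_iff {X : Type*} [MeasurableSpace X] {μ : Measure X} {φ : ℕ → X → ℝ}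
    (hφ : ∀ n, MemLp (φ n) 2 μ) (u : L2 μ) :
    Tendsto (fun n => eLpNorm (fun x => φ n x - u x) 2 μ) atTop (𝓝 0) ↔
      Tendsto (fun n => toL2 μ (φ n)) atTop (𝓝 u) := by
  rw [tendsto_iff_edist_tendsto_0]
  refine tendsto_congr fun n => ?_
  rw [Lp.edist_def]
  refine eLpNorm_congr_ae ?_
  filter_upwards [coeFn_toL2 (hφ n)] with x hx
  rw [Pi.sub_apply, hx]

/-- Traces are the closure of restrictions of smooth functions. -/
theorem isTrace_iff {u : L2 volOm} {du : Fin 3 → L2 volOm} {g : H0S} :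
    IsTrace u du g ↔ (u, du, g) ∈ smoothTriples.topologicalClosure := by
  rw [← SetLike.mem_coe, Submodule.topologicalClosure_coe, mem_closure_iff_seq_limit]
  constructor
  · rintro ⟨φ, hφ, h1, h2, h3⟩
    rw [tendsto_toL2_iff fun n => memLp_ball (hφ n).continuous] at h1
    simp only [tendsto_toL2_iff fun n => memLp_ball (contDiff_pderiv _ (hφ n)).continuous] at h2
    rw [tendsto_toL2_iff fun n => memLp_sphere (hφ n).continuous] at h3
    exact ⟨fun n => (toL2 volOm (φ n), fun j => toL2 volOm (pderiv j (φ n)), resS (φ n)),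
      fun n => ⟨φ n, hφ n, rfl⟩, h1.prodMk_nhds ((tendsto_pi_nhds.2 h2).prodMk_nhds h3)⟩
  · rintro ⟨w, hw, hlim⟩
    choose φ hφ hw using hw
    obtain rfl : w = fun n => (toL2 volOm (φ n), fun j => toL2 volOm (pderiv j (φ n)), resS (φ n)) :=
      funext hw
    rw [Prod.tendsto_iff, Prod.tendsto_iff, tendsto_pi_nhds] at hlim
    obtain ⟨h1, h2, h3⟩ := hlim
    refine ⟨φ, hφ, (tendsto_toL2_iff (fun n => memLp_ball (hφ n).continuous) _).2 h1, fun j => ?_,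
      (tendsto_toL2_iff (fun n => memLp_sphere (hφ n).continuous) _).2 h3⟩
    exact (tendsto_toL2_iff (fun n => memLp_ball (contDiff_pderiv j (hφ n)).continuous) _).2 (h2 j)

theorem isTrace_smooth {φ : E3 → ℝ} (hφ : ContDiff ℝ ∞ φ) :
    IsTrace (toL2 volOm φ) (fun j => toL2 volOm (pderiv j φ)) (resS φ) :=
  isTrace_iff.2 (Submodule.le_topologicalClosure _ ⟨φ, hφ, rfl⟩)

/-! ### Spherical harmonics in `H^{3/2}(∂Ω)` -/

theorem toL2_sum {X : Type*} [MeasurableSpace X] {μ : Measure X} {ι : Type*} (s : Finset ι)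
    (c : ι → ℝ) {f : ι → X → ℝ} (hf : ∀ i, MemLp (f i) 2 μ) :
    toL2 μ (fun x => ∑ i ∈ s, c i * f i x) = ∑ i ∈ s, c i • toL2 μ (f i) := by
  classical
  induction s using Finset.induction_on with
  | empty =>
    have := toL2_const_mul (μ := μ) (f := fun _ => (0 : ℝ)) 0 MemLp.zero
    simpa using this
  | insert a s ha ih =>
    simp only [Finset.sum_insert ha]
    rw [← ih, ← toL2_const_mul _ (hf a)]
    exact toL2_add ((hf a).const_mul _) (memLp_finsetSum s fun i _ => (hf i).const_mul _)

theorem memLp_of_lintegral {X : Type*} [MeasurableSpace X] {μ : Measure X} {f : X → ℝ}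
    (hf : AEStronglyMeasurable f μ) (h : ∫⁻ x, ENNReal.ofReal (f x * f x) ∂μ < ⊤) :
    MemLp f 2 μ := by
  rw [memLp_two_iff_integrable_sq hf]
  refine ⟨hf.pow 2, ?_⟩
  rw [hasFiniteIntegral_iff_ofReal (Eventually.of_forall fun x => sq_nonneg _)]
  simpa only [sq] using h

theorem memLp_diff_rderiv {l : ℕ} {h : E3 → ℝ} (hh : IsSH l h) (j : Fin 3) :
    MemLp (fun p : Sph × Sph => rderiv j h p.1 - rderiv j h p.2) 2 (gagliardo 2 sigma) := by
  have hc := continuous_sphere (contDiff_rderiv j hh.smooth).continuous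
  have hm := memLp_sphere (contDiff_rderiv j hh.smooth).continuous
  refine memLp_of_lintegral (by
    have : Continuous fun p : Sph × Sph => rderiv j h p.1 - rderiv j h p.2 :=
      (hc.comp continuous_fst).sub (hc.comp continuous_snd)
    exact this.aestronglyMeasurable) ?_
  have h0 : 0 ≤ ∫ x : Sph, rderiv j h x * rderiv j h x ∂sigma :=
    integral_nonneg fun x => mul_self_nonneg _
  have h1 := lintegral_gagliardo_le hc (K := l * (2 * ∫ x : Sph, rderiv j h x * rderiv j h x ∂sigma))
    (by positivity) fun r h2 h3 => by
      rw [integral_pk_diff_mul h2 h3 hm (hh.rderiv_mem j)]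
      nlinarith [mul_le_mul_of_nonneg_right (one_sub_pow_le h2 l) h0]
  exact h1.trans_lt ENNReal.ofReal_lt_top

/-- The restriction of a solid harmonic as an element of `H^{3/2}(∂Ω)`. -/
def solid32 {l : ℕ} {h : E3 → ℝ} (hh : IsSH l h) : H32S :=
  ⟨WithLp.toLp 2 ((sphSob 1 h hh.smooth).1, WithLp.toLp 2 fun α : Fin 1 → Fin 3 =>
    toL2 (gagliardo 2 sigma) fun p : Sph × Sph => rderiv (α 0) h p.1 - rderiv (α 0) h p.2),
    (sphSob 1 h hh.smooth).2, fun α => by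
      have h0 := coeFn_toL2 (memLp_sphere (contDiff_rderiv (α 0) hh.smooth).continuous)
      filter_upwards [coeFn_toL2 (memLp_diff_rderiv hh (α 0)),
        gagliardo_ac.ae_le (Measure.quasiMeasurePreserving_fst.ae h0),
        gagliardo_ac.ae_le (Measure.quasiMeasurePreserving_snd.ae h0)] with p h1 h2 h3
      refine h1.trans ?_
      rw [← h2, ← h3]
      rfl⟩

/-- A basis spherical harmonic as an element of `H^{3/2}(∂Ω)`. -/
def h32 (i : Idx) : H32S := solid32 (isSH_Yb i)

theorem baseHalf_h32 (i : Idx) : baseHalf (h32 i) = eb i := (eb_eq i).symm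

theorem inner_sphSob_Yb [DecidableEq Idx] (i j : Idx) :
    ⟪sphSob 1 (Yb i) (contDiff_Yb i), sphSob 1 (Yb j) (contDiff_Yb j)⟫_ℝ =
      if i = j then (1 + deg i * (deg i + 1) : ℝ) else 0 := by
  rw [Submodule.coe_inner, PiLp.inner_apply, Fintype.sum_sigma, Fin.sum_univ_two]
  have e0 : ∀ f : (Fin 0 → Fin 3) → ℝ, ∑ α, f α = f ![] := sum_words_zero
  have e1 : ∀ f : (Fin 1 → Fin 3) → ℝ, ∑ α, f α = ∑ i, f (Fin.cons i ![]) := fun f => by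
    rw [sum_words_succ]; simp only [sum_words_zero]
  refine (congrArg₂ (· + ·) (e0 _) (e1 _)).trans ?_
  have h1 : ⟪resS (Yb i), resS (Yb j)⟫_ℝ + ∑ k, ⟪resS (rderiv k (Yb i)), resS (rderiv k (Yb j))⟫_ℝ =
      if i = j then (1 + deg i * (deg i + 1) : ℝ) else 0 := by
    simp only [inner_resS (contDiff_Yb i).continuous (contDiff_Yb j).continuous,
      inner_resS (contDiff_rderiv _ (contDiff_Yb i)).continuous
        (contDiff_rderiv _ (contDiff_Yb j)).continuous]
    rw [IsSH.integral_rderiv_rderiv (contDiff_Yb i) (isSH_Yb j), integral_Yb]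
    split_ifs with h
    · subst h; ring
    · simp
  exact h1

theorem norm_sq_H32S (W : H32S) : ‖W‖ ^ 2 = ‖W.1.fst‖ ^ 2 + ∑ j, ‖W.1.snd ![j]‖ ^ 2 := by
  have h1 : ‖W‖ ^ 2 = ‖W.1‖ ^ 2 := rfl
  rw [h1, WithLp.prod_norm_sq_eq_of_L2, PiLp.norm_sq_eq_of_L2 _ W.1.snd, sum_words_succ]
  simp only [sum_words_zero]
  rfl

theorem norm_baseHalf_sq_le (W : H32S) : ‖baseHalf W‖ ^ 2 ≤ ‖W.1.fst‖ ^ 2 := by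
  rw [PiLp.norm_sq_eq_of_L2]
  exact Finset.single_le_sum (f := fun a => ‖W.1.fst a‖ ^ 2) (fun _ _ => sq_nonneg _)
    (Finset.mem_univ _)

/-- The function underlying an element of `H^{3/2}(∂Ω)`, as a bounded operator. -/
def baseHalfL : H32S →L[ℝ] H0S :=
  LinearMap.mkContinuous { toFun := baseHalf, map_add' := baseHalf_add, map_smul' := baseHalf_smul } 1
    fun W => by
      refine le_of_sq_le_sq ?_ (by positivity)
      rw [one_mul, norm_sq_H32S]
      have := norm_baseHalf_sq_le W
      have h2 := Finset.sum_nonneg fun j (_ : j ∈ Finset.univ) => sq_nonneg ‖W.1.snd ![j]‖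
      exact this.trans (by linarith)

theorem baseHalfL_apply (W : H32S) : baseHalfL W = baseHalf W := rfl

theorem h32_deriv_mem (W : H32S) (j : Fin 3) :
    (baseHalf W, W.1.fst (word 1 le_rfl ![j])) ∈ sphereD j := W.2.1 0 le_rfl ![] j

/-- An element of `H^{3/2}(∂Ω)` is determined by the underlying function. -/
theorem baseHalf_eq_zero {W : H32S} (h : baseHalf W = 0) : W = 0 := by
  have h1 : ∀ j, W.1.fst (word 1 le_rfl ![j]) = 0 := fun j => by
    refine sphere_eq_zero fun l f hf => ?_
    have h2 : ∫ x : Sph, W.1.fst (word 1 le_rfl ![j]) x * f x ∂sigma =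
        -∫ x : Sph, baseHalf W x * rderiv j f x ∂sigma :=
      h32_deriv_mem W j (_, _) ⟨f, hf.smooth, rfl, rfl⟩
    rw [h2, neg_eq_zero, ← inner_toL2_right _ (memLp_sphere (contDiff_rderiv j hf.smooth).continuous),
      h, inner_zero_left]
  have h2 : ∀ j, W.1.snd ![j] = 0 := fun j => by
    rw [Lp.eq_zero_iff_ae_eq_zero]
    have h3 := (Lp.eq_zero_iff_ae_eq_zero (f := W.1.fst (word 1 le_rfl ![j]))).1 (h1 j)
    filter_upwards [W.2.2 ![j], gagliardo_ac.ae_le (Measure.quasiMeasurePreserving_fst.ae h3),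
        gagliardo_ac.ae_le (Measure.quasiMeasurePreserving_snd.ae h3)] with p h4 h5 h6
    rw [h4, h5, h6]
    simp
  have h3 : ‖W.1.fst‖ ^ 2 = 0 := by
    rw [PiLp.norm_sq_eq_of_L2, Fintype.sum_sigma, Fin.sum_univ_two]
    have e0 : ∀ f : (Fin 0 → Fin 3) → ℝ, ∑ α, f α = f ![] := sum_words_zero
    have e1 : ∀ f : (Fin 1 → Fin 3) → ℝ, ∑ α, f α = ∑ i, f (Fin.cons i ![]) := fun f => by
      rw [sum_words_succ]; simp only [sum_words_zero]
    refine (congrArg₂ (· + ·) (e0 _) (e1 _)).trans ?_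
    have h4 : ‖baseHalf W‖ ^ 2 + ∑ j, ‖W.1.fst (word 1 le_rfl ![j])‖ ^ 2 = 0 := by
      simp [h, h1]
    exact h4
  have h4 : ‖W‖ ^ 2 = 0 := by rw [norm_sq_H32S, h3]; simp [h2]
  exact norm_eq_zero.1 ((pow_eq_zero_iff two_ne_zero).1 h4)

theorem baseHalf_injective : Function.Injective (baseHalf : H32S → H0S) := fun U V h => by
  refine sub_eq_zero.1 (baseHalf_eq_zero ?_)
  rw [← baseHalfL_apply, map_sub, sub_eq_zero]
  exact h

/-- The weight of `H^{3/2}(∂Ω)` at a spherical harmonic. -/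
def wt (i : Idx) : ℝ := √((1 + deg i) ^ 3)

theorem wt_pos (i : Idx) : 0 < wt i := Real.sqrt_pos.2 (by positivity)

theorem wt_sq (i : Idx) : wt i ^ 2 = (1 + deg i) ^ 3 := Real.sq_sqrt (by positivity)

/-- Coefficients of elements of `H^{3/2}(∂Ω)` are square summable with weight. -/
theorem exists_analysis_H32S : ∃ J : H32S →L[ℝ] H0S,
    ∀ W i, ⟪eb i, J W⟫_ℝ = wt i * ⟪eb i, baseHalf W⟫_ℝ := by
  have hm := sphMass_pos
  let a : Idx → H32S →ₗ[ℝ] ℝ := fun i => wt i • ((innerSL ℝ (eb i)).comp baseHalfL).toLinearMap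
  obtain ⟨J, hJ⟩ := exists_analysis eb a (C := 4 + 4 * sphMass⁻¹) (by positivity) fun s W => by
    have h1 := sum_coeff_le (baseHalf W) _ (h32_deriv_mem W) (fun j => W.1.snd ![j])
      (fun j => W.2.2 ![j]) s
    have h2 := eb.orthonormal.sum_inner_products_le (s := s) (baseHalf W)
    have h3 := norm_baseHalf_sq_le W
    have h4 : ∀ i, a i W ^ 2 ≤ 4 * ‖⟪eb i, baseHalf W⟫_ℝ‖ ^ 2 +
        4 * ((deg i : ℝ) ^ 2 * (deg i + 1) * ⟪eb i, baseHalf W⟫_ℝ ^ 2) := fun i => by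
      have h5 : a i W = wt i * ⟪eb i, baseHalf W⟫_ℝ := rfl
      rw [h5, mul_pow, wt_sq, Real.norm_eq_abs, sq_abs]
      have h6 : (1 + deg i : ℝ) ^ 3 ≤ 4 + 4 * ((deg i : ℝ) ^ 2 * (deg i + 1)) := by
        have : (0 : ℝ) ≤ deg i := by positivity
        nlinarith [mul_nonneg this (sq_nonneg ((deg i : ℝ) - 1)), sq_nonneg ((deg i : ℝ) - 1)]
      nlinarith [mul_le_mul_of_nonneg_right h6 (sq_nonneg ⟪eb i, baseHalf W⟫_ℝ)]
    refine (Finset.sum_le_sum fun i _ => h4 i).trans ?_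
    rw [Finset.sum_add_distrib, ← Finset.mul_sum, ← Finset.mul_sum, norm_sq_H32S]
    have h7 := Finset.sum_nonneg fun j (_ : j ∈ Finset.univ) => sq_nonneg ‖W.1.snd ![j]‖
    have h8 : 0 ≤ sphMass⁻¹ := by positivity
    nlinarith [mul_nonneg h8 (sq_nonneg ‖W.1.fst‖), mul_nonneg h8 h7]
  exact ⟨J, fun W i => hJ W i⟩

theorem norm_sum_h32_le (s : Finset Idx) (c : Idx → ℝ) :
    ‖∑ i ∈ s, c i • h32 i‖ ^ 2 ≤ (1 + 6 * sphMass) * ∑ i ∈ s, (wt i * c i) ^ 2 := by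
  classical
  have hm := sphMass_pos
  let P : H32S →ₗ[ℝ] PiLp 2 (fun _ : Words 1 => L2 sigma) :=
    { toFun := fun W => W.1.fst, map_add' := fun _ _ => rfl, map_smul' := fun _ _ => rfl }
  let Q : Fin 3 → H32S →ₗ[ℝ] L2 (gagliardo 2 sigma) := fun j =>
    { toFun := fun W => W.1.snd ![j], map_add' := fun _ _ => rfl, map_smul' := fun _ _ => rfl }
  have f1 : (∑ i ∈ s, c i • h32 i : H32S).1.fst =
      ((∑ i ∈ s, c i • sphSob 1 (Yb i) (contDiff_Yb i) : sobolev sphereD 1)).1 := by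
    refine ((map_sum P _ s).trans (Finset.sum_congr rfl fun i _ => ?_)).trans
      (Submodule.coe_sum _ (fun i => c i • sphSob 1 (Yb i) (contDiff_Yb i)) s).symm
    rw [map_smul]
    rfl
  have f2 : ∀ j, (∑ i ∈ s, c i • h32 i : H32S).1.snd ![j] = toL2 (gagliardo 2 sigma)
      fun p => ∑ i ∈ s, c i * (rderiv j (Yb i) p.1 - rderiv j (Yb i) p.2) := fun j => by
    rw [toL2_sum s c fun i => memLp_diff_rderiv (isSH_Yb i) j]
    refine (map_sum (Q j) _ s).trans (Finset.sum_congr rfl fun i _ => ?_)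
    rw [map_smul]
    rfl
  have g1 : ‖(∑ i ∈ s, c i • h32 i : H32S).1.fst‖ ^ 2 =
      ∑ i ∈ s, (1 + deg i * (deg i + 1) : ℝ) * c i ^ 2 := by
    rw [f1]
    exact norm_sq_sum_smul _ (fun i : Idx => (1 + deg i * (deg i + 1) : ℝ)) inner_sphSob_Yb s c
  have g2 : ∀ j, ‖(∑ i ∈ s, c i • h32 i : H32S).1.snd ![j]‖ ^ 2 ≤
      sphMass * ∑ i ∈ s, 2 * (deg i ^ 2 * (deg i + 1)) * c i ^ 2 := fun j => by
    have hK : 0 ≤ sphMass * ∑ i ∈ s, 2 * ((deg i : ℝ) ^ 2 * (deg i + 1)) * c i ^ 2 :=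
      mul_nonneg hm.le (Finset.sum_nonneg fun i _ => by positivity)
    rw [f2, ← ENNReal.ofReal_le_ofReal_iff hK, L2_norm_sq]
    refine le_trans (le_of_eq ?_) (lintegral_gagliardo_rsum s c j)
    refine lintegral_congr_ae ?_
    filter_upwards [coeFn_toL2 (memLp_finsetSum s fun i _ =>
      (memLp_diff_rderiv (isSH_Yb i) j).const_mul (c i))] with p hp
    rw [hp]
    simp only [rsum, mul_sub, Finset.sum_sub_distrib, sq]
  rw [norm_sq_H32S, g1]
  refine (add_le_add_right (Finset.sum_le_sum fun j _ => g2 j) _).trans ?_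
  simp only [Finset.sum_const, Finset.card_univ, Fintype.card_fin, nsmul_eq_mul]
  rw [Finset.mul_sum, Finset.mul_sum, Finset.mul_sum, ← Finset.sum_add_distrib]
  refine Finset.sum_le_sum fun i _ => ?_
  rw [mul_pow, wt_sq]
  have h0 : (0 : ℝ) ≤ deg i := by positivity
  have e : (1 + deg i * (deg i + 1) : ℝ) + 6 * sphMass * (deg i ^ 2 * (deg i + 1)) ≤
      (1 + 6 * sphMass) * (1 + deg i) ^ 3 := by
    have e1 : (1 + deg i * (deg i + 1) : ℝ) ≤ (1 + deg i) ^ 3 := by nlinarith [mul_nonneg h0 h0, mul_nonneg (mul_nonneg h0 h0) h0]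
    have e2 : ((deg i : ℝ) ^ 2 * (deg i + 1)) ≤ (1 + deg i) ^ 3 := by nlinarith [mul_nonneg h0 h0]
    nlinarith [mul_le_mul_of_nonneg_left e2 hm.le]
  push_cast
  nlinarith [mul_le_mul_of_nonneg_right e (sq_nonneg (c i))]

theorem exists_synthesis_H32S : ∃ B : H0S →L[ℝ] H32S, ∀ i, B (eb i) = (wt i)⁻¹ • h32 i := by
  have hm := sphMass_pos
  refine exists_synthesis eb _ (C := 1 + 6 * sphMass) (by positivity) fun s c => ?_
  simp only [smul_smul]
  refine (norm_sum_h32_le s _).trans (le_of_eq ?_)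
  congr 1
  refine Finset.sum_congr rfl fun i _ => ?_
  have := (wt_pos i).ne'
  field_simp

theorem ext_eb {Z : Type*} [NormedAddCommGroup Z] [NormedSpace ℝ Z] {S T : H0S →L[ℝ] Z}
    (h : ∀ i, S (eb i) = T (eb i)) : S = T := by
  refine ContinuousLinearMap.ext_on (s := range eb) ?_ ?_
  · rw [dense_iff_closure_eq, ← Submodule.topologicalClosure_coe, eb.dense_span]
    rfl
  · rintro _ ⟨i, rfl⟩
    exact h i

theorem eq_of_inner_eb {u v : H0S} (h : ∀ i, ⟪eb i, u⟫_ℝ = ⟪eb i, v⟫_ℝ) : u = v := by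
  refine eb.repr.injective ?_
  ext i
  rw [eb.repr_apply_apply, eb.repr_apply_apply, h i]

/-- The isomorphism of `H^{3/2}(∂Ω)` with `L²(∂Ω)` multiplying coefficients by the weights. -/
def Jw : H32S →L[ℝ] H0S := exists_analysis_H32S.choose

theorem inner_Jw (W : H32S) (i : Idx) : ⟪eb i, Jw W⟫_ℝ = wt i * ⟪eb i, baseHalf W⟫_ℝ :=
  exists_analysis_H32S.choose_spec W i

/-- The inverse of `Jw`, dividing coefficients by the weights. -/
def Bw : H0S →L[ℝ] H32S := exists_synthesis_H32S.choose

theorem Bw_eb (i : Idx) : Bw (eb i) = (wt i)⁻¹ • h32 i := exists_synthesis_H32S.choose_spec i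

theorem inner_baseHalf_Bw (i : Idx) (v : H0S) :
    ⟪eb i, baseHalf (Bw v)⟫_ℝ = (wt i)⁻¹ * ⟪eb i, v⟫_ℝ := by
  have h1 : (innerSL ℝ (eb i)).comp (baseHalfL.comp Bw) = (wt i)⁻¹ • innerSL ℝ (eb i) := by
    refine ext_eb fun j => ?_
    simp only [ContinuousLinearMap.comp_apply, Bw_eb, map_smul, baseHalfL_apply, baseHalf_h32,
      _root_.smul_apply, innerSL_apply_apply, smul_eq_mul]
    by_cases h : i = j
    · subst h; rfl
    · rw [eb.orthonormal.2 h]; simp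
  have := congrArg (fun T => T v) h1
  simpa [baseHalfL_apply] using this

theorem Bw_Jw (W : H32S) : Bw (Jw W) = W := by
  refine baseHalf_injective (eq_of_inner_eb fun i => ?_)
  rw [inner_baseHalf_Bw, inner_Jw, inv_mul_cancel_left₀ (wt_pos i).ne']

/-! ### The harmonic extension to `H²(Ω)` -/

theorem exists_extension : ∃ E : H0S →L[ℝ] H2Om,
    ∀ i, E (eb i) = (wt i)⁻¹ • ballSob 2 (Yb i) (contDiff_Yb i) := by
  classical
  refine exists_synthesis eb _ (C := 3) (by positivity) fun s c => ?_
  simp only [smul_smul]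
  rw [norm_sq_sum_smul _ _ inner_ballSob_Yb, Finset.mul_sum]
  refine Finset.sum_le_sum fun i _ => ?_
  have h0 : (0 : ℝ) ≤ deg i := by positivity
  have h1 : ((2 * deg i + 3 : ℝ)⁻¹ + deg i + (deg i - 1) * (2 * deg i + 1) * deg i) ≤
      3 * wt i ^ 2 := by
    have : (2 * deg i + 3 : ℝ)⁻¹ ≤ 1 := inv_le_one_of_one_le₀ (by linarith)
    rw [wt_sq]
    nlinarith [mul_nonneg h0 h0, mul_nonneg (mul_nonneg h0 h0) h0]
  refine (mul_le_mul_of_nonneg_right h1 (sq_nonneg _)).trans (le_of_eq ?_)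
  have := (wt_pos i).ne'
  field_simp

/-- The harmonic extension, as a bounded operator from `H^{3/2}(∂Ω)` to `H²(Ω)`. -/
def E2 : H32S →L[ℝ] H2Om := exists_extension.choose.comp Jw

theorem isClosed_harmonic_trace : IsClosed {p : H32S × H2Om | lap p.2 = 0 ∧
    IsBdry p.2 (baseHalf p.1)} := by
  have h1 : IsClosed {p : H32S × H2Om | lap p.2 = 0} := by
    refine isClosed_eq ?_ continuous_const
    unfold lap
    fun_prop
  have h2 : IsClosed {p : H32S × H2Om | IsBdry p.2 (baseHalf p.1)} := by
    simp only [IsBdry, isTrace_iff]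
    refine smoothTriples.isClosed_topologicalClosure.preimage
      (f := fun p : H32S × H2Om => (base p.2, fun j => p.2.1 (word 1 one_le_two ![j]), baseHalf p.1)) ?_
    have h3 : Continuous fun p : H32S × H2Om => baseHalf p.1 := baseHalfL.continuous.comp continuous_fst
    unfold base
    fun_prop
  exact h1.inter h2

theorem harmonic_trace_ballSob (i : Idx) : lap (ballSob 2 (Yb i) (contDiff_Yb i)) = 0 ∧
    IsBdry (ballSob 2 (Yb i) (contDiff_Yb i)) (eb i) := by
  have hd := fun j => contDiff_pderiv j (contDiff_pderiv j (contDiff_Yb i))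
  constructor
  · have h1 := toL2_sum (μ := volOm) Finset.univ (fun _ => 1)
      (f := fun j => pderiv j (pderiv j (Yb i))) fun j => memLp_ball (hd j).continuous
    simp only [one_mul, one_smul] at h1
    refine Eq.trans h1.symm ?_
    have h2 : (fun x => ∑ j, pderiv j (pderiv j (Yb i)) x) = fun x => (0 : ℝ) := by
      ext x; exact (isSH_Yb i).harmonic x
    rw [h2]
    have := toL2_const_mul (μ := volOm) (f := fun _ => (0 : ℝ)) 0 MemLp.zero
    simpa using this
  · rw [eb_eq]
    exact isTrace_smooth (contDiff_Yb i)

/-- `E2` is the harmonic extension: this holds for the basis functions and is a closed linear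
condition. -/
theorem lap_E2_and_isBdry (W : H32S) : lap (E2 W) = 0 ∧ IsBdry (E2 W) (baseHalf W) := by
  let N : Submodule ℝ (H32S × H2Om) :=
    { carrier := {p | lap p.2 = 0 ∧ IsBdry p.2 (baseHalf p.1)}
      zero_mem' := ⟨by simp [lap], isTrace_iff.2 (Submodule.zero_mem _)⟩
      add_mem' := fun {a b} ha hb => ⟨by
        have h1 : lap (a.2 + b.2) = lap a.2 + lap b.2 := Finset.sum_add_distrib
        exact h1.trans (by rw [ha.1, hb.1, add_zero]),
        isTrace_iff.2 (Submodule.add_mem _ (isTrace_iff.1 ha.2) (isTrace_iff.1 hb.2))⟩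
      smul_mem' := fun c a ha => ⟨by
        have h1 : lap (c • a.2) = c • lap a.2 := by
          simp only [lap, Finset.smul_sum]
          rfl
        exact h1.trans (by rw [ha.1, smul_zero]),
        isTrace_iff.2 (Submodule.smul_mem _ c (isTrace_iff.1 ha.2))⟩ }
  have hN : IsClosed (N : Set (H32S × H2Om)) := isClosed_harmonic_trace
  let T : H0S →L[ℝ] H32S × H2Om := Bw.prod exists_extension.choose
  have hT : ∀ v, T v ∈ N := by
    intro v
    have h1 : IsClosed ((N.comap T.toLinearMap : Submodule ℝ H0S) : Set H0S) :=
      hN.preimage T.continuous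
    have h2 : (⊤ : Submodule ℝ H0S) ≤ N.comap T.toLinearMap := by
      rw [← eb.dense_span]
      refine Submodule.topologicalClosure_minimal _ (Submodule.span_le.2 ?_) h1
      rintro _ ⟨i, rfl⟩
      have h3 : T (eb i) = (wt i)⁻¹ • (h32 i, ballSob 2 (Yb i) (contDiff_Yb i)) :=
        Prod.ext (Bw_eb i) (exists_extension.choose_spec i)
      change T (eb i) ∈ N
      rw [h3]
      refine N.smul_mem _ ?_
      have := harmonic_trace_ballSob i
      exact ⟨this.1, by rw [baseHalf_h32]; exact this.2⟩
    exact h2 (Submodule.mem_top : v ∈ ⊤)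
  have := hT (Jw W)
  have h4 : T (Jw W) = (W, E2 W) := Prod.ext (Bw_Jw W) rfl
  rw [h4] at this
  exact this

/-! ### Differences of functions on the ball -/

theorem sq_integral_le {f : ℝ → ℝ} (hf : Continuous f) :
    (∫ t in (0 : ℝ)..1, f t) ^ 2 ≤ ∫ t in (0 : ℝ)..1, f t ^ 2 := by
  have i0 : IntervalIntegrable f volume 0 1 := hf.intervalIntegrable _ _
  have i1 : IntervalIntegrable (fun t => f t ^ 2) volume 0 1 := (hf.pow 2).intervalIntegrable _ _
  set a := ∫ t in (0 : ℝ)..1, f t with ha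
  have h : 0 ≤ ∫ t in (0 : ℝ)..1, (f t ^ 2 - 2 * a * f t + a ^ 2) := by
    refine intervalIntegral.integral_nonneg zero_le_one fun t _ => ?_
    nlinarith [sq_nonneg (f t - a)]
  rw [intervalIntegral.integral_add (i1.sub (i0.const_mul _)) (by simp),
    intervalIntegral.integral_sub i1 (i0.const_mul _), intervalIntegral.integral_const_mul,
    intervalIntegral.integral_const, ← ha] at h
  simp only [sub_zero, one_smul] at h
  nlinarith

theorem sq_sub_le_integral {G : E3 → ℝ} (hG : ContDiff ℝ ∞ G) (x z : E3) :
    (G x - G (x + z)) ^ 2 ≤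
      ∫ t in (0 : ℝ)..1, ‖z‖ ^ 2 * ∑ j, pderiv j G (x + t • z) ^ 2 := by
  have hc := fun j => (contDiff_pderiv j hG).continuous
  have hd : ∀ t : ℝ, HasDerivAt (fun t : ℝ => G (x + t • z)) (∑ j, z j * pderiv j G (x + t • z)) t := by
    intro t
    rw [← fderiv_eq_sum]
    have h1 : HasDerivAt (fun t : ℝ => x + t • z) z t := by
      simpa using ((hasDerivAt_id t).smul_const z).const_add x
    exact (ContDiff.diffAt hG _).hasFDerivAt.comp_hasDerivAt t h1
  have hcont : Continuous fun t : ℝ => ∑ j, z j * pderiv j G (x + t • z) := by fun_prop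
  have h1 := intervalIntegral.integral_eq_sub_of_hasDerivAt (a := 0) (b := 1) (fun t _ => hd t)
    (hcont.intervalIntegrable _ _)
  have h2 := sq_integral_le hcont
  rw [h1] at h2
  simp only [one_smul, zero_smul, add_zero] at h2
  rw [← neg_sub, neg_sq]
  refine h2.trans (intervalIntegral.integral_mono_on zero_le_one
    ((hcont.pow 2).intervalIntegrable _ _)
    (Continuous.intervalIntegrable (by fun_prop) _ _) fun t _ => ?_)
  have hz : ‖z‖ ^ 2 = ∑ j, z j ^ 2 := by rw [normSq_eq, Fin.sum_univ_three]
  rw [hz]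
  exact Finset.sum_mul_sq_le_sq_mul_sq _ (fun j => z j) fun j => pderiv j G (x + t • z)

/-- The indicator function of the ball. -/
def chi (x : E3) : ℝ≥0∞ := Om.indicator (fun _ => 1) x

theorem measurable_chi : Measurable chi := measurable_const.indicator measurableSet_ball

theorem chi_mul_chi_le {x z : E3} {t : ℝ} (ht : t ∈ Ioc (0 : ℝ) 1) :
    chi x * chi (x + z) ≤ chi (x + t • z) := by
  by_cases h1 : x ∈ Om
  · by_cases h2 : x + z ∈ Om
    · have h3 : x + t • z ∈ Om := by
        have := (convex_ball (0 : E3) 1).add_smul_sub_mem h1 h2 (t := t) ⟨ht.1.le, ht.2⟩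
        simpa using this
      simp [chi, h1, h2, h3]
    · simp [chi, h2]
  · simp [chi, h1]

theorem lintegral_chi_mul {h : E3 → ℝ} (hh : Continuous h) (h0 : ∀ x, 0 ≤ h x) (z : E3) :
    ∫⁻ x, chi (x + z) * ENNReal.ofReal (h (x + z)) = ENNReal.ofReal (∫ x in Om, h x) := by
  rw [lintegral_add_right_eq_self (fun x => chi x * ENNReal.ofReal (h x)) z,
    ofReal_integral_eq_lintegral_ofReal (integrableOn_ball hh) (Eventually.of_forall h0),
    ← lintegral_indicator measurableSet_ball]
  refine lintegral_congr fun x => ?_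
  by_cases hx : x ∈ Om <;> simp [chi, hx]

/-- The translation estimate on the ball, which is convex. -/
theorem lintegral_translate_le {G : E3 → ℝ} (hG : ContDiff ℝ ∞ G) (z : E3) :
    ∫⁻ x, chi x * chi (x + z) * ENNReal.ofReal ((G x - G (x + z)) ^ 2) ≤
      ENNReal.ofReal (‖z‖ ^ 2 * ∫ x in Om, ∑ j, pderiv j G x ^ 2) := by
  have hc := fun j => (contDiff_pderiv j hG).continuous
  have hk : Continuous fun x => ‖z‖ ^ 2 * ∑ j, pderiv j G x ^ 2 := by fun_prop
  have hk0 : ∀ x, 0 ≤ ‖z‖ ^ 2 * ∑ j, pderiv j G x ^ 2 := fun x =>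
    mul_nonneg (sq_nonneg _) (Finset.sum_nonneg fun _ _ => sq_nonneg _)
  have hm : Measurable fun p : E3 × ℝ => chi (p.1 + p.2 • z) *
      ENNReal.ofReal (‖z‖ ^ 2 * ∑ j, pderiv j G (p.1 + p.2 • z) ^ 2) := by
    have := measurable_chi
    have h2 : Continuous fun p : E3 × ℝ => p.1 + p.2 • z := by fun_prop
    exact (this.comp h2.measurable).mul ((hk.comp h2).measurable.ennreal_ofReal)
  calc _ ≤ ∫⁻ x, ∫⁻ t in Ioc (0 : ℝ) 1, chi (x + t • z) *
        ENNReal.ofReal (‖z‖ ^ 2 * ∑ j, pderiv j G (x + t • z) ^ 2) := by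
        refine lintegral_mono fun x => ?_
        have hkx : Continuous fun t : ℝ => ‖z‖ ^ 2 * ∑ j, pderiv j G (x + t • z) ^ 2 := by fun_prop
        calc _ ≤ chi x * chi (x + z) * ENNReal.ofReal (∫ t in (0 : ℝ)..1,
              ‖z‖ ^ 2 * ∑ j, pderiv j G (x + t • z) ^ 2) := by
              gcongr
              exact sq_sub_le_integral hG x z
          _ = ∫⁻ t in Ioc (0 : ℝ) 1, chi x * chi (x + z) *
              ENNReal.ofReal (‖z‖ ^ 2 * ∑ j, pderiv j G (x + t • z) ^ 2) := by
              rw [intervalIntegral.integral_of_le zero_le_one, ofReal_integral_eq_lintegral_ofReal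
                (hkx.integrableOn_Ioc) (Eventually.of_forall fun t => hk0 _),
                lintegral_const_mul _ hkx.measurable.ennreal_ofReal]
          _ ≤ _ := by
              refine setLIntegral_mono' measurableSet_Ioc fun t ht => ?_
              gcongr
              exact chi_mul_chi_le ht
    _ = ∫⁻ t in Ioc (0 : ℝ) 1, ∫⁻ x, chi (x + t • z) *
        ENNReal.ofReal (‖z‖ ^ 2 * ∑ j, pderiv j G (x + t • z) ^ 2) :=
        lintegral_lintegral_swap hm.aemeasurable
    _ = ∫⁻ t in Ioc (0 : ℝ) 1, ENNReal.ofReal (∫ x in Om, ‖z‖ ^ 2 * ∑ j, pderiv j G x ^ 2) :=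
        lintegral_congr fun t => lintegral_chi_mul hk hk0 _
    _ = _ := by
        rw [integral_const_mul]
        simp

theorem lintegral_diff_le {F G : E3 → ℝ} (hF : ContDiff ℝ ∞ F) (hG : ContDiff ℝ ∞ G) (z : E3) :
    ∫⁻ x, chi x * chi (x + z) * ENNReal.ofReal ((F x - F (x + z)) ^ 2) ≤
      ENNReal.ofReal (6 * (∫ x in Om, (F x - G x) ^ 2) +
        3 * (‖z‖ ^ 2 * ∫ x in Om, ∑ j, pderiv j G x ^ 2)) := by
  have hc : Continuous fun x => (F x - G x) ^ 2 := (hF.continuous.sub hG.continuous).pow 2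
  have h1 := lintegral_chi_mul hc (fun _ => sq_nonneg _) 0
  have h2 := lintegral_chi_mul hc (fun _ => sq_nonneg _) z
  have h3 := lintegral_translate_le hG z
  simp only [add_zero] at h1
  have m1 := measurable_chi
  have m2 : Measurable fun x => chi (x + z) := measurable_chi.comp (by fun_prop)
  have c1 := hF.continuous
  have c2 := hG.continuous
  have k0 : 0 ≤ ∫ x in Om, (F x - G x) ^ 2 := integral_nonneg fun _ => sq_nonneg _
  have k1 : 0 ≤ ‖z‖ ^ 2 * ∫ x in Om, ∑ j, pderiv j G x ^ 2 := mul_nonneg (sq_nonneg _)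
    (integral_nonneg fun _ => Finset.sum_nonneg fun _ _ => sq_nonneg _)
  calc _ ≤ ∫⁻ x, (3 * (chi x * ENNReal.ofReal ((F x - G x) ^ 2)) +
        3 * (chi (x + z) * ENNReal.ofReal ((F (x + z) - G (x + z)) ^ 2)) +
        3 * (chi x * chi (x + z) * ENNReal.ofReal ((G x - G (x + z)) ^ 2))) := by
        refine lintegral_mono fun x => ?_
        have e : (F x - F (x + z)) ^ 2 ≤ 3 * (F x - G x) ^ 2 + 3 * (F (x + z) - G (x + z)) ^ 2 +
            3 * (G x - G (x + z)) ^ 2 := by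
          nlinarith [sq_nonneg ((F x - G x) + (F (x + z) - G (x + z))),
            sq_nonneg ((F x - G x) - (G x - G (x + z))),
            sq_nonneg ((F (x + z) - G (x + z)) + (G x - G (x + z)))]
        by_cases hx : x ∈ Om
        · by_cases hz : x + z ∈ Om
          · simp only [chi, hx, hz, indicator_of_mem, one_mul]
            refine (ENNReal.ofReal_le_ofReal e).trans (le_of_eq ?_)
            rw [ENNReal.ofReal_add (by positivity) (by positivity),
              ENNReal.ofReal_add (by positivity) (by positivity), ENNReal.ofReal_mul (by norm_num),
              ENNReal.ofReal_mul (by norm_num), ENNReal.ofReal_mul (by norm_num)]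
            simp
          · simp [chi, hz]
        · simp [chi, hx]
    _ = 3 * (∫⁻ x, chi x * ENNReal.ofReal ((F x - G x) ^ 2)) +
        3 * (∫⁻ x, chi (x + z) * ENNReal.ofReal ((F (x + z) - G (x + z)) ^ 2)) +
        3 * ∫⁻ x, chi x * chi (x + z) * ENNReal.ofReal ((G x - G (x + z)) ^ 2) := by
        rw [lintegral_add_left (by fun_prop), lintegral_add_left (by fun_prop),
          lintegral_const_mul _ (by fun_prop), lintegral_const_mul _ (by fun_prop),
          lintegral_const_mul _ (by fun_prop)]
    _ ≤ 3 * ENNReal.ofReal (∫ x in Om, (F x - G x) ^ 2) +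
        3 * ENNReal.ofReal (∫ x in Om, (F x - G x) ^ 2) +
        3 * ENNReal.ofReal (‖z‖ ^ 2 * ∫ x in Om, ∑ j, pderiv j G x ^ 2) := by
        rw [h1, h2]
        gcongr
    _ = _ := by
        have e3 : (3 : ℝ≥0∞) = ENNReal.ofReal 3 := by simp
        rw [e3, ← ENNReal.ofReal_mul (by norm_num), ← ENNReal.ofReal_mul (by norm_num),
          ← ENNReal.ofReal_add (by positivity) (by positivity),
          ← ENNReal.ofReal_add (by positivity) (by positivity)]
        congr 1
        ring

theorem lintegral_ball_prod {f : E3 × E3 → ℝ≥0∞} (hf : Measurable f) :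
    ∫⁻ p, f p ∂(volOm.prod volOm) = ∫⁻ z, ∫⁻ x, chi x * chi (x + z) * f (x, x + z) := by
  have m1 := measurable_chi
  have hm : Measurable ((Om ×ˢ Om).indicator f) :=
    hf.indicator (measurableSet_ball.prod measurableSet_ball)
  rw [Measure.prod_restrict, ← lintegral_indicator (measurableSet_ball.prod measurableSet_ball),
    lintegral_prod _ hm.aemeasurable]
  have h1 : ∀ x, ∫⁻ y, (Om ×ˢ Om).indicator f (x, y) =
      ∫⁻ z, chi x * chi (x + z) * f (x, x + z) := fun x => by
    rw [← lintegral_add_left_eq_self _ x]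
    refine lintegral_congr fun z => ?_
    by_cases hx : x ∈ Om <;> by_cases hz : x + z ∈ Om <;> simp [chi, hx, hz, indicator]
  simp only [h1]
  refine lintegral_lintegral_swap (Measurable.aemeasurable ?_)
  have h2 : Measurable fun p : E3 × E3 => p.1 + p.2 := by fun_prop
  exact ((m1.comp measurable_fst).mul (m1.comp h2)).mul (hf.comp (measurable_fst.prodMk h2))

/-! ### The harmonic extension from `L²(∂Ω)` to `H^{1/2}(Ω)` -/

theorem integral_geom_sq_le (l : ℕ) :
    ∫ s in (0 : ℝ)..1, (∑ k ∈ Finset.range l, s ^ k) ^ 2 ≤ 2 * l := by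
  induction l with
  | zero => simp
  | succ l ih =>
    have hc : Continuous fun s : ℝ => ∑ k ∈ Finset.range l, s ^ k := by fun_prop
    have e : ∀ s : ℝ, (∑ k ∈ Finset.range (l + 1), s ^ k) ^ 2 =
        (∑ k ∈ Finset.range l, s ^ k) ^ 2 + ((∑ k ∈ Finset.range l, 2 * s ^ (k + l)) + s ^ (l + l)) := by
      intro s
      rw [Finset.sum_range_succ, ← Finset.mul_sum]
      simp only [pow_add, ← Finset.sum_mul]
      ring
    simp only [e]
    have i1 : IntervalIntegrable (fun s : ℝ => (∑ k ∈ Finset.range l, s ^ k) ^ 2) volume 0 1 :=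
      (hc.pow 2).intervalIntegrable _ _
    have c2 : Continuous fun s : ℝ => ∑ k ∈ Finset.range l, 2 * s ^ (k + l) := by fun_prop
    have c3 : Continuous fun s : ℝ => s ^ (l + l) := by fun_prop
    rw [intervalIntegral.integral_add i1 (by exact (c2.add c3).intervalIntegrable _ _),
      intervalIntegral.integral_add (c2.intervalIntegrable _ _) (c3.intervalIntegrable _ _),
      intervalIntegral.integral_finsetSum fun k _ => Continuous.intervalIntegrable (by fun_prop) _ _]
    simp only [intervalIntegral.integral_const_mul, integral_pow]
    have h1 : ∀ k ∈ Finset.range l, 2 * ((1 ^ (k + l + 1) - 0 ^ (k + l + 1)) / ((k + l : ℕ) + 1 : ℝ)) ≤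
        2 * (1 / (l + 1 : ℝ)) := fun k _ => by
      rw [one_pow, zero_pow (by omega), sub_zero]
      gcongr
      linarith [(Nat.cast_nonneg k : (0 : ℝ) ≤ k)]
    have h2 := Finset.sum_le_sum h1
    rw [Finset.sum_const, Finset.card_range, nsmul_eq_mul] at h2
    have h3 : (1 ^ (l + l + 1) - 0 ^ (l + l + 1)) / ((l + l : ℕ) + 1 : ℝ) ≤ 1 / (l + 1 : ℝ) := by
      rw [one_pow, zero_pow (by omega), sub_zero]
      gcongr
      linarith [(Nat.cast_nonneg l : (0 : ℝ) ≤ l)]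
    have h4 : l * (2 * (1 / (l + 1 : ℝ))) + 1 / (l + 1 : ℝ) ≤ 2 := by
      have : (0 : ℝ) < l + 1 := by positivity
      rw [← sub_nonneg]
      have e2 : 2 - (l * (2 * (1 / (l + 1 : ℝ))) + 1 / (l + 1 : ℝ)) = 1 / (l + 1) := by
        field_simp
        ring
      rw [e2]
      positivity
    push_cast at *
    linarith

/-- The harmonic function `∑ cᵢ Yᵢ`. -/
def ysum (s : Finset Idx) (c : Idx → ℝ) (x : E3) : ℝ := ∑ i ∈ s, c i * Yb i x

theorem contDiff_ysum (s : Finset Idx) (c : Idx → ℝ) : ContDiff ℝ ∞ (ysum s c) :=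
  ContDiff.sum fun i _ => contDiff_const.mul (contDiff_Yb i)

theorem inner_toL2_Yb [DecidableEq Idx] (i j : Idx) :
    ⟪toL2 volOm (Yb i), toL2 volOm (Yb j)⟫_ℝ = if i = j then (2 * deg i + 3 : ℝ)⁻¹ else 0 := by
  rw [inner_toL2 (memLp_ball (contDiff_Yb i).continuous) (memLp_ball (contDiff_Yb j).continuous),
    (isSH_Yb i).integral_ball (isSH_Yb j), integral_Yb]
  split_ifs with h
  · subst h; rw [mul_one]; congr 1; ring
  · simp

theorem norm_sq_sum_toL2 (s : Finset Idx) (c : Idx → ℝ) :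
    ‖∑ i ∈ s, c i • toL2 volOm (Yb i)‖ ^ 2 = ∑ i ∈ s, (2 * deg i + 3 : ℝ)⁻¹ * c i ^ 2 := by
  classical
  exact norm_sq_sum_smul _ _ inner_toL2_Yb s c

theorem integral_ysum_sq (s : Finset Idx) (c : Idx → ℝ) :
    ∫ x in Om, ysum s c x ^ 2 = ∑ i ∈ s, (2 * deg i + 3 : ℝ)⁻¹ * c i ^ 2 := by
  have hm := memLp_ball (contDiff_ysum s c).continuous
  rw [← norm_sq_sum_toL2, ← toL2_sum s c fun i => memLp_ball (contDiff_Yb i).continuous,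
    ← real_inner_self_eq_norm_sq]
  refine Eq.trans ?_ (inner_toL2 hm hm).symm
  simp only [sq]

theorem integral_pderiv_ysum_sq (s : Finset Idx) (c : Idx → ℝ) :
    ∫ x in Om, ∑ j, pderiv j (ysum s c) x ^ 2 = ∑ i ∈ s, deg i * c i ^ 2 := by
  classical
  have hd := fun j => contDiff_pderiv j (contDiff_ysum s c)
  have hy := fun i j => contDiff_pderiv j (contDiff_Yb i)
  have e1 : ∀ j x, pderiv j (ysum s c) x ^ 2 =
      ∑ i ∈ s, c i * (pderiv j (ysum s c) x * pderiv j (Yb i) x) := fun j x => by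
    have : pderiv j (ysum s c) x = ∑ i ∈ s, c i * pderiv j (Yb i) x := by
      unfold ysum
      rw [pderiv_sum _ _ fun k _ => contDiff_const.mul (contDiff_Yb k)]
      exact Finset.sum_congr rfl fun k _ => pderiv_const_mul _ _ (contDiff_Yb k) _
    rw [sq]
    nth_rewrite 2 [this]
    rw [Finset.mul_sum]
    exact Finset.sum_congr rfl fun i _ => by ring
  rw [integral_finsetSum]
  · have e2 : ∀ j, ∫ x in Om, pderiv j (ysum s c) x ^ 2 =
        ∑ i ∈ s, c i * ∫ x in Om, pderiv j (ysum s c) x * pderiv j (Yb i) x := fun j => by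
      simp only [e1]
      rw [integral_finsetSum]
      · simp only [integral_const_mul]
      · exact fun i _ => integrableOn_ball (contDiff_const.mul ((hd j).mul (hy i j))).continuous
    simp only [e2]
    rw [Finset.sum_comm]
    refine Finset.sum_congr rfl fun i hi => ?_
    rw [← Finset.mul_sum, IsSH.integral_ball_pderiv_pderiv (contDiff_ysum s c) (isSH_Yb i)]
    have e3 : ∫ x : Sph, ysum s c x * Yb i x ∂sigma = c i := by
      simp only [ysum, Finset.sum_mul, mul_assoc]
      rw [integral_finsetSum]
      · simp only [integral_const_mul, integral_Yb]
        simp [hi]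
      · exact fun k _ => integrable_sphere (continuous_sphere
          (contDiff_const.mul ((contDiff_Yb k).mul (contDiff_Yb i))).continuous)
    rw [e3]
    ring
  · exact fun j _ => integrableOn_ball ((hd j).pow 2).continuous

/-- The density, in terms of `s = 1 - |z| / 2`, of the bound for translation by `z`. -/
def transBound (s : Finset Idx) (c : Idx → ℝ) (t : ℝ) : ℝ :=
  ∑ i ∈ s, c i ^ 2 * (3 / 2 * (2 * deg i + 3 : ℝ)⁻¹ * (∑ k ∈ Finset.range (deg i), t ^ k) ^ 2 +
    3 * deg i * t ^ (2 * deg i))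

theorem continuous_transBound (s : Finset Idx) (c : Idx → ℝ) : Continuous (transBound s c) := by
  unfold transBound
  fun_prop

theorem transBound_nonneg (s : Finset Idx) (c : Idx → ℝ) (t : ℝ) : 0 ≤ transBound s c t := by
  refine Finset.sum_nonneg fun i _ => ?_
  have : 0 ≤ t ^ (2 * deg i) := by rw [pow_mul']; positivity
  positivity

theorem integral_transBound_le (s : Finset Idx) (c : Idx → ℝ) :
    ∫ t in (0 : ℝ)..1, transBound s c t ≤ 3 * ∑ i ∈ s, c i ^ 2 := by
  unfold transBound
  rw [intervalIntegral.integral_finsetSum fun i _ => Continuous.intervalIntegrable (by fun_prop) _ _,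
    Finset.mul_sum]
  refine Finset.sum_le_sum fun i _ => ?_
  rw [intervalIntegral.integral_const_mul, intervalIntegral.integral_add
    (Continuous.intervalIntegrable (by fun_prop) _ _)
    (Continuous.intervalIntegrable (by fun_prop) _ _), intervalIntegral.integral_const_mul,
    intervalIntegral.integral_const_mul, integral_pow, mul_comm]
  refine mul_le_mul_of_nonneg_right ?_ (sq_nonneg _)
  have h1 := integral_geom_sq_le (deg i)
  have h0 : (0 : ℝ) ≤ deg i := Nat.cast_nonneg _
  have h2 : 3 / 2 * (2 * deg i + 3 : ℝ)⁻¹ * (2 * deg i) ≤ 3 / 2 := by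
    rw [mul_assoc]
    refine mul_le_of_le_one_right (by norm_num) ?_
    rw [inv_mul_le_iff₀ (by positivity)]
    linarith
  have h3 : 3 * deg i * ((1 ^ (2 * deg i + 1) - 0 ^ (2 * deg i + 1)) / ((2 * deg i : ℕ) + 1 : ℝ)) ≤
      3 / 2 := by
    rw [one_pow, zero_pow (by omega), sub_zero, mul_one_div, div_le_iff₀ (by positivity)]
    push_cast
    linarith
  have h4 := mul_le_mul_of_nonneg_left h1
    (by positivity : 0 ≤ 3 / 2 * (2 * deg i + 3 : ℝ)⁻¹)
  linarith

theorem lintegral_ysum_diff_le (s : Finset Idx) (c : Idx → ℝ) (z : E3) :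
    ∫⁻ x, chi x * chi (x + z) * ENNReal.ofReal ((ysum s c x - ysum s c (x + z)) ^ 2) ≤
      (Metric.ball 0 2).indicator
        (fun z => ENNReal.ofReal (‖z‖ ^ 2 * transBound s c (1 - ‖z‖ / 2))) z := by
  by_cases hz : z ∈ Metric.ball (0 : E3) 2
  · rw [indicator_of_mem hz]
    -- comparison with the dilation of the harmonic function by `t = 1 - |z| / 2`
    set t := 1 - ‖z‖ / 2 with ht
    refine (lintegral_diff_le (contDiff_ysum s c)
      (contDiff_ysum s fun i => c i * t ^ deg i) z).trans (ENNReal.ofReal_le_ofReal (le_of_eq ?_))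
    have e1 : ∀ x, ysum s c x - ysum s (fun i => c i * t ^ deg i) x =
        ysum s (fun i => c i * (1 - t ^ deg i)) x := fun x => by
      unfold ysum
      rw [← Finset.sum_sub_distrib]
      exact Finset.sum_congr rfl fun i _ => by ring
    simp only [e1]
    rw [integral_ysum_sq, integral_pderiv_ysum_sq, transBound, Finset.mul_sum, Finset.mul_sum,
      Finset.mul_sum, Finset.mul_sum, ← Finset.sum_add_distrib]
    refine Finset.sum_congr rfl fun i _ => ?_
    have hz2 : ‖z‖ = 2 * (1 - t) := by rw [ht]; ring
    rw [← mul_neg_geom_sum, hz2]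
    ring
  · rw [indicator_of_notMem hz]
    refine le_of_eq ?_
    rw [lintegral_eq_zero_iff']
    · refine Eventually.of_forall fun x => ?_
      by_cases hx : x ∈ Om
      · have : x + z ∉ Om := fun hxz => hz (by
          simp only [Metric.mem_ball, dist_zero_right] at *
          have := norm_sub_le (x + z) x
          rw [add_sub_cancel_left] at this
          linarith)
        simp [chi, this]
      · simp [chi, hx]
    · have := measurable_chi
      have c1 := (contDiff_ysum s c).continuous
      have m2 : Measurable fun x => chi (x + z) := measurable_chi.comp (by fun_prop)
      fun_prop

/-- The Gagliardo seminorm of harmonic functions on the ball is controlled by the `L²` norm of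
the boundary values. -/
theorem lintegral_gagliardo_ysum (s : Finset Idx) (c : Idx → ℝ) :
    ∫⁻ p, ENNReal.ofReal ((ysum s c p.1 - ysum s c p.2) ^ 2) ∂(gagliardo 3 volOm) ≤
      ENNReal.ofReal (6 * sphMass * ∑ i ∈ s, c i ^ 2) := by
  have c1 := (contDiff_ysum s c).continuous
  have hT := continuous_transBound s c
  have hm := sphMass_pos
  let g : E3 → ℝ≥0∞ := fun z => ENNReal.ofReal ((‖z‖ ^ 4)⁻¹) * (Metric.ball 0 2).indicator
    (fun z => ENNReal.ofReal (‖z‖ ^ 2 * transBound s c (1 - ‖z‖ / 2))) z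
  have hg : Measurable g := by
    have h1 : Measurable fun z : E3 => ENNReal.ofReal ((‖z‖ ^ 4)⁻¹) := by fun_prop
    have h2 : Measurable fun z : E3 => ENNReal.ofReal (‖z‖ ^ 2 * transBound s c (1 - ‖z‖ / 2)) := by
      fun_prop
    exact h1.mul (h2.indicator measurableSet_ball)
  have m1 : Measurable fun p : E3 × E3 => ENNReal.ofReal ((dist p.1 p.2 ^ (3 + 1))⁻¹) := by fun_prop
  have m2 : Measurable fun p : E3 × E3 => ENNReal.ofReal ((ysum s c p.1 - ysum s c p.2) ^ 2) := by
    fun_prop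
  rw [gagliardo, lintegral_withDensity_eq_lintegral_mul _ m1 m2, lintegral_ball_prod (m1.mul m2)]
  calc _ ≤ ∫⁻ z, g z := by
        refine lintegral_mono fun z => ?_
        have e : ∀ x : E3, dist x (x + z) = ‖z‖ := fun x => by
          rw [dist_eq_norm, sub_add_cancel_left, norm_neg]
        simp only [Pi.mul_apply, e]
        have e2 : ∀ x, chi x * chi (x + z) * (ENNReal.ofReal ((‖z‖ ^ (3 + 1))⁻¹) *
            ENNReal.ofReal ((ysum s c x - ysum s c (x + z)) ^ 2)) =
            ENNReal.ofReal ((‖z‖ ^ 4)⁻¹) * (chi x * chi (x + z) *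
            ENNReal.ofReal ((ysum s c x - ysum s c (x + z)) ^ 2)) := fun x => by ring
        simp only [e2]
        rw [lintegral_const_mul' _ _ ENNReal.ofReal_ne_top]
        exact mul_le_mul_right (lintegral_ysum_diff_le s c z) _
    _ = ∫⁻ w : Sph, (∫⁻ r in Ioc (0 : ℝ) 2, ENNReal.ofReal (transBound s c (1 - r / 2))) ∂sigma := by
        rw [lintegral_polar hg]
        refine lintegral_congr fun w => ?_
        have hae : (fun r : ℝ => (Ioc (0 : ℝ) 2).indicator
            (fun r => ENNReal.ofReal (transBound s c (1 - r / 2))) r) =ᵐ[volume.restrict (Ioi 0)]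
            fun r => ENNReal.ofReal (r ^ 2) * g (r • (w : E3)) := by
          have h2 : ∀ᵐ r : ℝ ∂(volume.restrict (Ioi 0)), r ≠ 2 :=
            ae_restrict_of_ae (by simp [ae_iff])
          filter_upwards [h2, ae_restrict_mem measurableSet_Ioi] with r hr2 hr
          have hr0 : (0 : ℝ) < r := hr
          have hn : ‖r • (w : E3)‖ = r := by
            rw [norm_smul, norm_eq_of_mem_sphere, mul_one, Real.norm_of_nonneg hr0.le]
          by_cases h : r < 2
          · have hmem : r ∈ Ioc (0 : ℝ) 2 := ⟨hr0, h.le⟩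
            rw [indicator_of_mem hmem]
            simp only [g]
            rw [indicator_of_mem (by simpa [hn] using h), hn, ← ENNReal.ofReal_mul (by positivity),
              ← ENNReal.ofReal_mul (by positivity)]
            congr 1
            field_simp
          · have h3 : r ∉ Ioc (0 : ℝ) 2 := fun h4 => h (lt_of_le_of_ne h4.2 hr2)
            rw [indicator_of_notMem h3]
            simp only [g]
            rw [indicator_of_notMem (by simpa [hn] using h)]
            simp
        rw [← lintegral_congr_ae hae, lintegral_indicator measurableSet_Ioc,
          Measure.restrict_restrict measurableSet_Ioc,
          inter_eq_self_of_subset_left Ioc_subset_Ioi_self]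
    _ = ENNReal.ofReal (∫ r in (0 : ℝ)..2, transBound s c (1 - r / 2)) * ENNReal.ofReal sphMass := by
        rw [intervalIntegral.integral_of_le (by norm_num), ofReal_integral_eq_lintegral_ofReal
          (Continuous.integrableOn_Ioc (by fun_prop))
          (Eventually.of_forall fun r => transBound_nonneg s c _), lintegral_const]
        congr 1
        simp [sphMass]
    _ ≤ _ := by
        rw [intervalIntegral.integral_comp_sub_div (fun t => transBound s c t) two_ne_zero,
          ← ENNReal.ofReal_mul (by
            rw [smul_eq_mul]
            refine mul_nonneg zero_le_two (intervalIntegral.integral_nonneg (by norm_num)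
              fun t _ => transBound_nonneg s c t))]
        refine ENNReal.ofReal_le_ofReal ?_
        norm_num
        have := integral_transBound_le s c
        nlinarith

theorem memLp_diff_Yb (i : Idx) :
    MemLp (fun p : E3 × E3 => Yb i p.1 - Yb i p.2) 2 (gagliardo 3 volOm) := by
  have hc := (contDiff_Yb i).continuous
  refine memLp_of_lintegral (Continuous.aestronglyMeasurable (by fun_prop)) ?_
  have h := lintegral_gagliardo_ysum {i} (fun _ => 1)
  simp only [ysum, Finset.sum_singleton, one_mul, sq] at h
  exact h.trans_lt ENNReal.ofReal_lt_top

/-- A solid harmonic as an element of `H^{1/2}(Ω)`. -/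
def hOm (i : Idx) : H12Om :=
  ⟨WithLp.toLp 2 ((ballSob 0 (Yb i) (contDiff_Yb i)).1, WithLp.toLp 2 fun _ : Fin 0 → Fin 3 =>
    toL2 (gagliardo 3 volOm) fun p : E3 × E3 => Yb i p.1 - Yb i p.2),
    (ballSob 0 (Yb i) (contDiff_Yb i)).2, fun α => by
      have hac : gagliardo 3 volOm ≪ volOm.prod volOm := withDensity_absolutelyContinuous _ _
      have h := coeFn_toL2 (memLp_ball (contDiff_Yb i).continuous)
      filter_upwards [coeFn_toL2 (memLp_diff_Yb i),
        hac.ae_le (Measure.quasiMeasurePreserving_fst.ae h),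
        hac.ae_le (Measure.quasiMeasurePreserving_snd.ae h)] with p h1 h2 h3
      refine h1.trans ?_
      rw [← h2, ← h3]
      rfl⟩

theorem norm_sq_H12Om (W : H12Om) : ‖W‖ ^ 2 = ‖baseHalf W‖ ^ 2 + ‖W.1.snd ![]‖ ^ 2 := by
  have h1 : ‖W‖ ^ 2 = ‖W.1‖ ^ 2 := rfl
  rw [h1, WithLp.prod_norm_sq_eq_of_L2, PiLp.norm_sq_eq_of_L2 _ W.1.snd,
    PiLp.norm_sq_eq_of_L2 _ W.1.fst, Fintype.sum_sigma, Fin.sum_univ_one]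
  exact congrArg₂ (· + ·) (sum_words_zero _) (sum_words_zero _)

theorem norm_sum_hOm_le (s : Finset Idx) (c : Idx → ℝ) :
    ‖∑ i ∈ s, c i • hOm i‖ ^ 2 ≤ (1 + 6 * sphMass) * ∑ i ∈ s, c i ^ 2 := by
  have hm := sphMass_pos
  let P : H12Om →ₗ[ℝ] L2 volOm :=
    { toFun := baseHalf, map_add' := fun _ _ => rfl, map_smul' := fun _ _ => rfl }
  let Q : H12Om →ₗ[ℝ] L2 (gagliardo 3 volOm) :=
    { toFun := fun W => W.1.snd ![], map_add' := fun _ _ => rfl, map_smul' := fun _ _ => rfl }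
  have f1 : baseHalf (∑ i ∈ s, c i • hOm i : H12Om) = ∑ i ∈ s, c i • toL2 volOm (Yb i) := by
    refine (map_sum P _ s).trans (Finset.sum_congr rfl fun i _ => ?_)
    rw [map_smul]
    rfl
  have f2 : (∑ i ∈ s, c i • hOm i : H12Om).1.snd ![] = toL2 (gagliardo 3 volOm)
      fun p => ∑ i ∈ s, c i * (Yb i p.1 - Yb i p.2) := by
    rw [toL2_sum s c memLp_diff_Yb]
    refine (map_sum Q _ s).trans (Finset.sum_congr rfl fun i _ => ?_)
    rw [map_smul]
    rfl
  have g2 : ‖(∑ i ∈ s, c i • hOm i : H12Om).1.snd ![]‖ ^ 2 ≤ 6 * sphMass * ∑ i ∈ s, c i ^ 2 := by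
    have hK : 0 ≤ 6 * sphMass * ∑ i ∈ s, c i ^ 2 :=
      mul_nonneg (by positivity) (Finset.sum_nonneg fun i _ => sq_nonneg _)
    rw [f2, ← ENNReal.ofReal_le_ofReal_iff hK, L2_norm_sq]
    refine le_trans (le_of_eq ?_) (lintegral_gagliardo_ysum s c)
    refine lintegral_congr_ae ?_
    filter_upwards [coeFn_toL2 (memLp_finsetSum s fun i _ => (memLp_diff_Yb i).const_mul (c i))]
      with p hp
    rw [hp]
    simp only [ysum, mul_sub, Finset.sum_sub_distrib]
  rw [norm_sq_H12Om, f1, norm_sq_sum_toL2]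
  have g1 : ∑ i ∈ s, (2 * deg i + 3 : ℝ)⁻¹ * c i ^ 2 ≤ ∑ i ∈ s, c i ^ 2 :=
    Finset.sum_le_sum fun i _ => mul_le_of_le_one_left (sq_nonneg _)
      (inv_le_one_of_one_le₀ (by linarith [(Nat.cast_nonneg (deg i) : (0 : ℝ) ≤ deg i)]))
  linarith

theorem exists_extension_L2 : ∃ E : H0S →L[ℝ] H12Om, ∀ i, E (eb i) = hOm i := by
  have hm := sphMass_pos
  exact exists_synthesis eb _ (C := 1 + 6 * sphMass) (by positivity) norm_sum_hOm_le

/-- The harmonic extension, as a bounded operator from `L²(∂Ω)` to `H^{1/2}(Ω)`. -/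
def E0 : H0S →L[ℝ] H12Om := exists_extension_L2.choose

/-- `E0` and `E2` give the same function, since both do so for the basis functions. -/
theorem baseHalf_E0 (W : H32S) : baseHalf (E0 (baseHalf W)) = base (E2 W) := by
  let P : H12Om →L[ℝ] L2 volOm := LinearMap.mkContinuous
    { toFun := baseHalf, map_add' := fun _ _ => rfl, map_smul' := fun _ _ => rfl } 1 fun W => by
      refine le_of_sq_le_sq ?_ (by positivity)
      rw [one_mul, norm_sq_H12Om]
      exact le_add_of_nonneg_right (sq_nonneg _)
  let Q : H2Om →L[ℝ] L2 volOm :=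
    { toFun := base, map_add' := fun _ _ => rfl, map_smul' := fun _ _ => rfl
      cont := by unfold base; fun_prop }
  have h : (P.comp E0).comp (baseHalfL.comp Bw) = Q.comp exists_extension.choose := by
    refine ext_eb fun i => ?_
    simp only [ContinuousLinearMap.comp_apply, Bw_eb, exists_extension.choose_spec, map_smul,
      baseHalfL_apply, baseHalf_h32]
    congr 1
    have h2 : E0 (eb i) = hOm i := exists_extension_L2.choose_spec i
    rw [h2]
    rfl
  have h3 := congrArg (fun T => T (Jw W)) h
  simp only [ContinuousLinearMap.comp_apply, Bw_Jw] at h3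
  exact h3

/-! ### Green's formula and uniqueness for the Dirichlet problem -/

theorem integrable_L2_mul {X : Type*} [MeasurableSpace X] {μ : Measure X} (u : L2 μ) {f : X → ℝ}
    (hf : MemLp f 2 μ) : Integrable (fun x => u x * f x) μ := (Lp.memLp u).integrable_mul hf

theorem IsTrace.sub {u u' : L2 volOm} {du du' : Fin 3 → L2 volOm} {g g' : H0S}
    (h : IsTrace u du g) (h' : IsTrace u' du' g') : IsTrace (u - u') (du - du') (g - g') :=
  isTrace_iff.2 (Submodule.sub_mem _ (isTrace_iff.1 h) (isTrace_iff.1 h'))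

theorem IsTrace.green {u : L2 volOm} {du : Fin 3 → L2 volOm} {g : H0S} (h : IsTrace u du g)
    {ψ : E3 → ℝ} (hψ : ContDiff ℝ ∞ ψ) (j : Fin 3) :
    ∫ x : Sph, g x * ((x : E3) j * ψ x) ∂sigma =
      (∫ x in Om, du j x * ψ x) + ∫ x in Om, u x * pderiv j ψ x := by
  have m1 := memLp_sphere ((contDiff_coord j).mul hψ).continuous
  have m2 := memLp_ball hψ.continuous
  have m3 := memLp_ball (contDiff_pderiv j hψ).continuous
  rw [← inner_toL2_right g m1, ← inner_toL2_right _ m2, ← inner_toL2_right u m3]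
  have hcl : IsClosed {w : L2 volOm × (Fin 3 → L2 volOm) × L2 sigma |
      ⟪w.2.2, toL2 sigma fun x : Sph => (x : E3) j * ψ x⟫_ℝ =
        ⟪w.2.1 j, toL2 volOm ψ⟫_ℝ + ⟪w.1, toL2 volOm (pderiv j ψ)⟫_ℝ} :=
    isClosed_eq (by fun_prop) (by fun_prop)
  refine closure_minimal ?_ hcl (isTrace_iff.1 h)
  rintro _ ⟨φ, hφ, rfl⟩
  simp only [Set.mem_ofPred_eq]
  rw [resS, inner_toL2 (memLp_sphere hφ.continuous) m1,
    inner_toL2 (memLp_ball (contDiff_pderiv j hφ).continuous) m2,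
    inner_toL2 (memLp_ball hφ.continuous) m3, integral_ball_mul_pderiv j hφ hψ, add_sub_cancel]
  exact integral_congr_ae (Eventually.of_forall fun x => by simp only; ring)

/-- A smooth cutoff of the half-line, equal to `0` up to `1` and to `1` from `2` on. -/
def cut (t : ℝ) : ℝ := Real.smoothTransition (t - 1)

theorem contDiff_cut : ContDiff ℝ ∞ cut :=
  Real.smoothTransition.contDiff.comp (contDiff_id.sub contDiff_const)

theorem cut_of_le {t : ℝ} (ht : t ≤ 1) : cut t = 0 :=
  Real.smoothTransition.zero_of_nonpos (by linarith)

theorem cut_of_ge {t : ℝ} (ht : 2 ≤ t) : cut t = 1 :=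
  Real.smoothTransition.one_of_one_le (by linarith)

theorem deriv_cut_of_lt {t : ℝ} (ht : t < 1) : deriv cut t = 0 := by
  have : cut =ᶠ[𝓝 t] fun _ => 0 := by
    filter_upwards [gt_mem_nhds ht] with s hs
    exact cut_of_le (le_of_lt hs)
  rw [this.deriv_eq, deriv_const]

theorem deriv_cut_of_gt {t : ℝ} (ht : 2 < t) : deriv cut t = 0 := by
  have : cut =ᶠ[𝓝 t] fun _ => 1 := by
    filter_upwards [lt_mem_nhds ht] with s hs
    exact cut_of_ge (le_of_lt hs)
  rw [this.deriv_eq, deriv_const]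

theorem exists_bound_mul_deriv_cut : ∃ M : ℝ, 0 ≤ M ∧ ∀ t, |t * deriv cut t| ≤ M := by
  have hc : Continuous fun t => t * deriv cut t :=
    continuous_id.mul (contDiff_cut.continuous_deriv (by simp))
  obtain ⟨M, hM⟩ := (isCompact_Icc (a := (1 : ℝ)) (b := 2)).exists_bound_of_continuousOn hc.continuousOn
  have hM0 : 0 ≤ M := (norm_nonneg _).trans (hM 1 ⟨le_rfl, one_le_two⟩)
  refine ⟨M, hM0, fun t => ?_⟩
  by_cases h1 : t < 1
  · rw [deriv_cut_of_lt h1]; simpa using hM0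
  by_cases h2 : 2 < t
  · rw [deriv_cut_of_gt h2]; simpa using hM0
  exact hM t ⟨not_lt.1 h1, not_lt.1 h2⟩

/-- The cutoff of the ball that vanishes at distance of order `1 / n` from the sphere. -/
def cutB (n : ℕ) (x : E3) : ℝ := cut (n * (1 - ‖x‖ ^ 2))

theorem contDiff_cutB (n : ℕ) : ContDiff ℝ ∞ (cutB n) :=
  contDiff_cut.comp (contDiff_const.mul (contDiff_const.sub contDiff_normSq))

theorem pderiv_cutB (n : ℕ) (j : Fin 3) (x : E3) :
    pderiv j (cutB n) x = -(2 * n * x j) * deriv cut (n * (1 - ‖x‖ ^ 2)) := by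
  have hs : ContDiff ℝ ∞ fun x : E3 => (n : ℝ) * (1 - ‖x‖ ^ 2) :=
    contDiff_const.mul (contDiff_const.sub contDiff_normSq)
  have h1 : HasDerivAt cut (deriv cut (n * (1 - ‖x‖ ^ 2))) (n * (1 - ‖x‖ ^ 2)) :=
    (contDiff_cut.differentiable (by simp) _).hasDerivAt
  have h2 := h1.comp_hasFDerivAt x (ContDiff.diffAt hs x).hasFDerivAt
  have h3 : pderiv j (fun x : E3 => (n : ℝ) * (1 - ‖x‖ ^ 2)) x = -(2 * n * x j) := by
    rw [pderiv_const_mul _ _ (contDiff_const.sub contDiff_normSq)]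
    simp only [sub_eq_add_neg, ← neg_one_mul (‖_‖ ^ 2)]
    rw [pderiv_add _ contDiff_const (contDiff_const.mul contDiff_normSq), pderiv_const,
      pderiv_const_mul _ _ contDiff_normSq, pderiv_normSq]
    ring
  rw [← h3]
  unfold pderiv cutB
  have h4 : fderiv ℝ (fun x : E3 => cut (n * (1 - ‖x‖ ^ 2))) x = _ := h2.fderiv
  rw [h4, _root_.smul_apply, smul_eq_mul, mul_comm]

theorem cutB_mem_test (n : ℕ) {φ : E3 → ℝ} (hφ : ContDiff ℝ ∞ φ) (j : Fin 3) :
    ((fun x => cutB n x * φ x), pderiv j fun x => cutB n x * φ x) ∈ ballTest j := by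
  have hsub : tsupport (fun x => cutB n x * φ x) ⊆ {x : E3 | 1 ≤ n * (1 - ‖x‖ ^ 2)} := by
    refine closure_minimal (fun x hx => ?_) (isClosed_le continuous_const (by fun_prop))
    by_contra h
    rw [Set.mem_ofPred_eq, not_le] at h
    exact hx (by simp only [cutB, cut_of_le h.le, zero_mul])
  have hOm : tsupport (fun x => cutB n x * φ x) ⊆ Om := fun x hx => by
    have h1 : 1 ≤ n * (1 - ‖x‖ ^ 2) := hsub hx
    have h2 : 0 < 1 - ‖x‖ ^ 2 := by
      by_contra h
      have := mul_nonpos_of_nonneg_of_nonpos (Nat.cast_nonneg n : (0 : ℝ) ≤ n) (not_lt.1 h)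
      linarith
    rw [Metric.mem_ball, dist_zero_right]
    nlinarith [norm_nonneg x]
  refine ⟨(contDiff_cutB n).mul hφ, ?_, hOm, rfl⟩
  exact HasCompactSupport.of_support_subset_isCompact (isCompact_closedBall (0 : E3) 1)
    ((subset_tsupport _).trans (hOm.trans Metric.ball_subset_closedBall))

/-- Pairs in the graph of the weak derivative may be tested with smooth functions that vanish on
the sphere but are not compactly supported in the ball. -/
theorem ballD_test {j : Fin 3} {u v : L2 volOm} (h : (u, v) ∈ ballD j) {θ : E3 → ℝ}
    (hθ : ContDiff ℝ ∞ θ) : ∫ x in Om, v x * ((‖x‖ ^ 2 - 1) * θ x) =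
      -∫ x in Om, u x * pderiv j (fun x => (‖x‖ ^ 2 - 1) * θ x) x := by
  obtain ⟨M, hM0, hM⟩ := exists_bound_mul_deriv_cut
  let η : E3 → ℝ := fun x => (‖x‖ ^ 2 - 1) * θ x
  have hη : ContDiff ℝ ∞ η := (contDiff_normSq.sub contDiff_const).mul hθ
  have hdη := contDiff_pderiv j hη
  have hu : Integrable u volOm := (Lp.memLp u).integrable (by norm_num)
  have hv : Integrable v volOm := (Lp.memLp v).integrable (by norm_num)
  have bdd : ∀ f : E3 → ℝ, Continuous f → ∃ C, ∀ x ∈ Om, |f x| ≤ C := fun f hf => by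
    obtain ⟨C, hC⟩ := (isCompact_closedBall (0 : E3) 1).exists_bound_of_continuousOn hf.continuousOn
    exact ⟨C, fun x hx => hC x (Metric.ball_subset_closedBall hx)⟩
  have cut1 : ∀ t, |cut t| ≤ 1 := fun t => by
    rw [cut, abs_of_nonneg (Real.smoothTransition.nonneg _)]
    exact Real.smoothTransition.le_one _
  have hτ : ∀ x ∈ Om, Tendsto (fun n : ℕ => n * (1 - ‖x‖ ^ 2)) atTop atTop := fun x hx => by
    refine tendsto_natCast_atTop_atTop.atTop_mul_const ?_
    rw [Metric.mem_ball, dist_zero_right] at hx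
    nlinarith [norm_nonneg x]
  have hcut : ∀ x ∈ Om, ∀ᶠ n : ℕ in atTop, cutB n x = 1 ∧ deriv cut (n * (1 - ‖x‖ ^ 2)) = 0 :=
    fun x hx => by
      filter_upwards [(hτ x hx).eventually_gt_atTop 2] with n hn
      exact ⟨cut_of_ge hn.le, deriv_cut_of_gt hn⟩
  have ed : ∀ n x, pderiv j (fun x => cutB n x * η x) x = cutB n x * pderiv j η x +
      2 * (x j * θ x) * ((n * (1 - ‖x‖ ^ 2)) * deriv cut (n * (1 - ‖x‖ ^ 2))) := fun n x => by
    rw [pderiv_mul j (contDiff_cutB n) hη, pderiv_cutB]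
    simp only [η]
    ring
  have h1 : ∀ n, ∫ x in Om, v x * (cutB n x * η x) =
      -∫ x in Om, u x * pderiv j (fun x => cutB n x * η x) x := fun n =>
    h (_, _) (cutB_mem_test n hη j)
  have l1 : Tendsto (fun n => ∫ x in Om, v x * (cutB n x * η x)) atTop
      (𝓝 (∫ x in Om, v x * η x)) := by
    obtain ⟨C, hC⟩ := bdd η hη.continuous
    refine tendsto_integral_of_dominated_convergence (fun x => |v x| * C) (fun n => ?_)
      (hv.abs.mul_const C) (fun n => ?_) ?_
    · exact hv.aestronglyMeasurable.mul
        ((contDiff_cutB n).continuous.mul hη.continuous).aestronglyMeasurable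
    · filter_upwards [ae_restrict_mem measurableSet_ball] with x hx
      rw [norm_mul, Real.norm_eq_abs, norm_mul, Real.norm_eq_abs, Real.norm_eq_abs]
      exact mul_le_mul_of_nonneg_left ((mul_le_of_le_one_left (abs_nonneg _) (cut1 _)).trans (hC x hx))
        (abs_nonneg _)
    · filter_upwards [ae_restrict_mem measurableSet_ball] with x hx
      refine tendsto_const_nhds.congr' ?_
      filter_upwards [hcut x hx] with n hn
      rw [hn.1, one_mul]
  have l2 : Tendsto (fun n => ∫ x in Om, u x * pderiv j (fun x => cutB n x * η x) x) atTop
      (𝓝 (∫ x in Om, u x * pderiv j η x)) := by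
    obtain ⟨C, hC⟩ := bdd (pderiv j η) hdη.continuous
    obtain ⟨D, hD⟩ := bdd (fun x => 2 * (x j * θ x)) (by have := hθ.continuous; fun_prop)
    refine tendsto_integral_of_dominated_convergence (fun x => |u x| * (C + D * M)) (fun n => ?_)
      (hu.abs.mul_const _) (fun n => ?_) ?_
    · exact hu.aestronglyMeasurable.mul
        (contDiff_pderiv j ((contDiff_cutB n).mul hη)).continuous.aestronglyMeasurable
    · filter_upwards [ae_restrict_mem measurableSet_ball] with x hx
      rw [norm_mul, Real.norm_eq_abs, Real.norm_eq_abs, ed]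
      refine mul_le_mul_of_nonneg_left ((abs_add_le _ _).trans (add_le_add ?_ ?_)) (abs_nonneg _)
      · rw [abs_mul]
        exact (mul_le_of_le_one_left (abs_nonneg _) (cut1 _)).trans (hC x hx)
      · rw [abs_mul]
        exact mul_le_mul (hD x hx) (hM _) (abs_nonneg _) ((abs_nonneg _).trans (hD x hx))
    · filter_upwards [ae_restrict_mem measurableSet_ball] with x hx
      refine tendsto_const_nhds.congr' ?_
      filter_upwards [hcut x hx] with n hn
      rw [ed, hn.1, hn.2, one_mul, mul_zero, mul_zero, add_zero]
  simp only [h1] at l1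
  exact tendsto_nhds_unique l1 l2.neg

theorem laplacian_normSq_pow_mul {l : ℕ} {h : E3 → ℝ} (hh : IsSH l h) (k : ℕ) :
    ContDiff ℝ ∞ (fun x => ‖x‖ ^ (2 * k) * h x) ∧
    (∀ x, ∑ i, x i * pderiv i (fun x => ‖x‖ ^ (2 * k) * h x) x =
      (2 * k + l) * (‖x‖ ^ (2 * k) * h x)) ∧
    ∀ x, ∑ i, pderiv i (pderiv i fun x => ‖x‖ ^ (2 * (k + 1)) * h x) x =
      (2 * k + 2) * (2 * k + 2 * l + 3) * (‖x‖ ^ (2 * k) * h x) := by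
  have hN : ∀ i, pderiv i (fun y : E3 => ‖y‖ ^ 2) = fun x => 2 * x i := fun i => by
    ext x; exact pderiv_normSq i x
  have hN2 : ∀ x : E3, ∑ i : Fin 3, pderiv i (pderiv i fun y : E3 => ‖y‖ ^ 2) x = 6 := fun x => by
    simp only [hN, pderiv_const_mul _ 2 (contDiff_coord _), pderiv_coord]
    simp
    norm_num
  have e : ∀ k : ℕ, (fun x : E3 => ‖x‖ ^ (2 * (k + 1)) * h x) =
      fun x => ‖x‖ ^ 2 * (‖x‖ ^ (2 * k) * h x) := fun k => by ext x; ring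
  have step : ∀ f : E3 → ℝ, ContDiff ℝ ∞ f → ∀ d m : ℝ, ∀ g : E3 → ℝ,
      (∀ x, ∑ i, x i * pderiv i f x = d * f x) →
      (∀ x, ∑ i, pderiv i (pderiv i f) x = m * g x) → ∀ x,
      ∑ i, pderiv i (pderiv i fun x => ‖x‖ ^ 2 * f x) x =
        (6 + 4 * d) * f x + m * (‖x‖ ^ 2 * g x) := by
    intro f hf d m g h1 h2 x
    rw [laplacian_mul contDiff_normSq hf, h2, hN2]
    simp only [hN, mul_assoc, ← Finset.mul_sum, h1]
    ring
  induction k with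
  | zero =>
    refine ⟨by simpa using hh.smooth, fun x => by simpa using hh.euler x, fun x => ?_⟩
    have h1 := step h hh.smooth l 0 (fun _ => 0) hh.euler (fun x => by simp [hh.harmonic]) x
    simp only [e, mul_zero, pow_zero, one_mul]
    rw [h1]
    push_cast
    ring
  | succ k ih =>
    obtain ⟨i1, i2, i3⟩ := ih
    have hs : ContDiff ℝ ∞ (fun x => ‖x‖ ^ (2 * (k + 1)) * h x) := by
      rw [e]; exact contDiff_normSq.mul i1
    have he : ∀ x, ∑ i, x i * pderiv i (fun x => ‖x‖ ^ (2 * (k + 1)) * h x) x =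
        (2 * (k + 1 : ℕ) + l) * (‖x‖ ^ (2 * (k + 1)) * h x) := fun x => by
      have h3 := i2 x
      have h4 : (x 0 ^ 2 + x 1 ^ 2 + x 2 ^ 2) = ‖x‖ ^ 2 := (normSq_eq x).symm
      rw [e]
      simp only [pderiv_mul _ contDiff_normSq i1, pderiv_normSq, Fin.sum_univ_three] at h3 ⊢
      push_cast
      have h5 : ‖x‖ ^ (2 * (k + 1)) = ‖x‖ ^ 2 * ‖x‖ ^ (2 * k) := by ring
      rw [h5]
      linear_combination ‖x‖ ^ 2 * h3 + 2 * (‖x‖ ^ (2 * k) * h x) * h4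
    refine ⟨hs, he, fun x => ?_⟩
    rw [e (k + 1), step _ hs _ _ _ he i3]
    push_cast
    ring

theorem eq_zero_of_harmonic {F : H2Om} (hF : lap F = 0) (h0 : IsBdry F 0) : base F = 0 := by
  have green : ∀ {ψ : E3 → ℝ}, ContDiff ℝ ∞ ψ → ∀ j, ∫ x in Om, base F x * pderiv j ψ x =
      -∫ x in Om, F.1 (word 1 one_le_two ![j]) x * ψ x := fun {ψ} hψ j => by
    have h1 := IsTrace.green h0 hψ j
    rw [← inner_toL2_right _ (memLp_sphere ((contDiff_coord j).mul hψ).continuous),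
      inner_zero_left] at h1
    linarith
  have key : ∀ θ : E3 → ℝ, ContDiff ℝ ∞ θ → ∫ x in Om, base F x *
      ∑ j, pderiv j (pderiv j fun x => (‖x‖ ^ 2 - 1) * θ x) x = 0 := by
    intro θ hθ
    have hη : ContDiff ℝ ∞ fun x => (‖x‖ ^ 2 - 1) * θ x :=
      (contDiff_normSq.sub contDiff_const).mul hθ
    have hd := fun j => contDiff_pderiv j hη
    have hdd := fun j => contDiff_pderiv j (hd j)
    have h1 : ∀ j, ∫ x in Om, base F x * pderiv j (pderiv j fun x => (‖x‖ ^ 2 - 1) * θ x) x =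
        ∫ x in Om, F.1 (word 2 le_rfl ![j, j]) x * ((‖x‖ ^ 2 - 1) * θ x) := fun j => by
      have h2 : (F.1 (word 1 one_le_two ![j]), F.1 (word 2 le_rfl ![j, j])) ∈ ballD j :=
        F.2 1 le_rfl ![j] j
      rw [green (hd j) j, ballD_test h2 hθ]
    simp only [Finset.mul_sum]
    rw [integral_finsetSum _ fun j _ => integrable_L2_mul (base F)
      (memLp_ball (hdd j).continuous)]
    simp only [h1]
    have hm := memLp_ball hη.continuous
    simp only [← inner_toL2_right _ hm]
    rw [← sum_inner]
    have : (∑ j : Fin 3, F.1 (word 2 le_rfl ![j, j])) = lap F := rfl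
    rw [this, hF, inner_zero_left]
  refine ball_eq_zero fun k l h hh => ?_
  obtain ⟨-, -, h3⟩ := laplacian_normSq_pow_mul hh k
  have hN := fun m => (laplacian_normSq_pow_mul hh m).1
  -- the function `(|x|^(2k+2) - 1) h` vanishes on the sphere
  have h4 := key (fun x => ∑ m ∈ Finset.range (k + 1), ‖x‖ ^ (2 * m) * h x)
    (ContDiff.sum fun m _ => hN m)
  have e1 : (fun x : E3 => (‖x‖ ^ 2 - 1) * ∑ m ∈ Finset.range (k + 1), ‖x‖ ^ (2 * m) * h x) =
      fun x => ‖x‖ ^ (2 * (k + 1)) * h x + (-1) * h x := by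
    ext x
    simp only [pow_mul, ← Finset.sum_mul]
    rw [← mul_assoc, mul_geom_sum]
    ring
  have e2 : ∀ x, ∑ j, pderiv j (pderiv j fun x => ‖x‖ ^ (2 * (k + 1)) * h x + (-1) * h x) x =
      (2 * k + 2) * (2 * k + 2 * l + 3) * (‖x‖ ^ (2 * k) * h x) := by
    intro x
    have e3 : ∀ j, pderiv j (fun x => ‖x‖ ^ (2 * (k + 1)) * h x + (-1) * h x) =
        fun x => pderiv j (fun x => ‖x‖ ^ (2 * (k + 1)) * h x) x + (-1) * pderiv j h x := fun j => by
      ext x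
      rw [pderiv_add j (hN (k + 1)) (contDiff_const.mul hh.smooth), pderiv_const_mul j _ hh.smooth]
    have e4 : ∀ j, pderiv j (fun x => pderiv j (fun x => ‖x‖ ^ (2 * (k + 1)) * h x) x +
        (-1) * pderiv j h x) x = pderiv j (pderiv j fun x => ‖x‖ ^ (2 * (k + 1)) * h x) x +
        (-1) * pderiv j (pderiv j h) x := fun j => by
      rw [pderiv_add j (contDiff_pderiv j (hN (k + 1)))
        (contDiff_const.mul (contDiff_pderiv j hh.smooth)),
        pderiv_const_mul j _ (contDiff_pderiv j hh.smooth)]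
    simp only [e3, e4]
    rw [Finset.sum_add_distrib, ← Finset.mul_sum, hh.harmonic, h3]
    ring
  rw [e1] at h4
  simp only [e2] at h4
  have e5 : ∀ x, base F x * ((2 * k + 2) * (2 * k + 2 * l + 3) * (‖x‖ ^ (2 * k) * h x)) =
      (2 * k + 2 : ℝ) * (2 * k + 2 * l + 3) * (base F x * (‖x‖ ^ (2 * k) * h x)) := fun x => by ring
  simp only [e5] at h4
  rw [integral_const_mul] at h4
  exact (mul_eq_zero.1 h4).resolve_left (by positivity)

/-- Uniqueness for the Dirichlet problem in `H²(Ω)`. -/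
theorem base_eq_of_harmonic {F F' : H2Om} {g : H0S} (hF : lap F = 0) (hF' : lap F' = 0)
    (hg : IsBdry F g) (hg' : IsBdry F' g) : base F = base F' := by
  have h1 : lap (F - F') = lap F - lap F' := Finset.sum_sub_distrib _ _
  have h2 : IsBdry (F - F') 0 := by
    have := IsTrace.sub hg hg'
    rw [sub_self] at this
    exact this
  have h3 := eq_zero_of_harmonic (F := F - F') (by rw [h1, hF, hF', sub_zero]) h2
  exact sub_eq_zero.1 h3

/-! ### The operator `Δ̄ ∂_ν` on spherical harmonics -/

/-- The symbol of `-Δ̄ ∂_ν`. -/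
def lam (i : Idx) : ℝ := deg i ^ 2 * (deg i + 1)

theorem IsLapNormal.inner_eq {g q : H0S} (h : IsLapNormal g q) (i : Idx) :
    ⟪eb i, q⟫_ℝ = -lam i * ⟪eb i, g⟫_ℝ := by
  obtain ⟨F, V, hF, hg, ⟨τ, hτ, hV⟩, rfl⟩ := h
  have hY := isSH_Yb i
  have sY := contDiff_Yb i
  have s1 := fun j => contDiff_pderiv j sY
  have r1 := fun j => contDiff_rderiv j sY
  have r2 := fun j => contDiff_rderiv j (r1 j)
  have cS : ∀ {f : E3 → ℝ}, ContDiff ℝ ∞ f → MemLp (fun x : Sph => f x) 2 sigma := fun hf =>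
    memLp_sphere hf.continuous
  have a1 : ⟪eb i, lap V⟫_ℝ = -(deg i * (deg i + 1)) * ∫ x : Sph, base V x * Yb i x ∂sigma := by
    rw [real_inner_comm, lap, sum_inner, eb_eq, resS]
    have e : ∀ j, ⟪V.1 (word 2 le_rfl ![j, j]), toL2 sigma fun x : Sph => Yb i x⟫_ℝ =
        ∫ x : Sph, base V x * rderiv j (rderiv j (Yb i)) x ∂sigma := fun j => by
      have k1 : ∫ x : Sph, V.1 (word 1 one_le_two ![j]) x * rderiv j (Yb i) x ∂sigma =
          -∫ x : Sph, base V x * rderiv j (rderiv j (Yb i)) x ∂sigma :=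
        V.2 0 one_le_two ![] j (_, _) ⟨_, r1 j, rfl, rfl⟩
      have k2 : ∫ x : Sph, V.1 (word 2 le_rfl ![j, j]) x * Yb i x ∂sigma =
          -∫ x : Sph, V.1 (word 1 one_le_two ![j]) x * rderiv j (Yb i) x ∂sigma :=
        V.2 1 le_rfl ![j] j (_, _) ⟨_, sY, rfl, rfl⟩
      rw [inner_toL2_right _ (cS sY), k2, k1, neg_neg]
    simp only [e]
    rw [← integral_finsetSum _ fun j _ => integrable_L2_mul (base V) (cS (r2 j))]
    simp only [← Finset.mul_sum, hY.sum_rderiv_rderiv]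
    rw [← integral_const_mul]
    exact integral_congr_ae (Eventually.of_forall fun x => by simp only; ring)
  have a2 : ∫ x : Sph, base V x * Yb i x ∂sigma =
      ∑ j, ∫ x in Om, F.1 (word 1 one_le_two ![j]) x * pderiv j (Yb i) x := by
    have e1 : ∫ x : Sph, base V x * Yb i x ∂sigma =
        ∫ x : Sph, ∑ j, τ j x * ((x : E3) j * Yb i x) ∂sigma := by
      refine integral_congr_ae ?_
      filter_upwards [hV] with x hx
      rw [hx, Finset.sum_mul]
      exact Finset.sum_congr rfl fun j _ => by ring
    rw [e1, integral_finsetSum _ fun j _ => integrable_L2_mul (τ j)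
      (cS ((contDiff_coord j).mul sY))]
    simp only [fun j => IsTrace.green (hτ j) sY j]
    rw [Finset.sum_add_distrib, add_eq_right]
    simp only [← inner_toL2_right _ (memLp_ball sY.continuous)]
    rw [← sum_inner]
    have : (∑ j : Fin 3, F.1 (word 2 le_rfl ![j, j])) = lap F := rfl
    rw [this, hF, inner_zero_left]
  have a3 : ∑ j, ∫ x in Om, F.1 (word 1 one_le_two ![j]) x * pderiv j (Yb i) x =
      deg i * ∫ x : Sph, g x * Yb i x ∂sigma := by
    have e1 : ∀ j, ∫ x in Om, F.1 (word 1 one_le_two ![j]) x * pderiv j (Yb i) x =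
        (∫ x : Sph, g x * ((x : E3) j * pderiv j (Yb i) x) ∂sigma) -
          ∫ x in Om, base F x * pderiv j (pderiv j (Yb i)) x := fun j => by
      rw [IsTrace.green hg (s1 j) j, add_sub_cancel_right]
    simp only [e1, Finset.sum_sub_distrib]
    rw [← integral_finsetSum _ fun j _ => integrable_L2_mul g
        (cS ((contDiff_coord j).mul (s1 j))),
      ← integral_finsetSum _ fun j _ => integrable_L2_mul (base F)
        (memLp_ball (contDiff_pderiv j (s1 j)).continuous)]
    simp only [← Finset.mul_sum, hY.harmonic, hY.euler, mul_zero, integral_zero, sub_zero]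
    rw [← integral_const_mul]
    exact integral_congr_ae (Eventually.of_forall fun x => by simp only; ring)
  rw [a1, a2, a3, real_inner_comm, eb_eq, resS, inner_toL2_right _ (cS sY), lam]
  ring

theorem IsSH.isLapNormal {l : ℕ} {h : E3 → ℝ} (hh : IsSH l h) :
    IsLapNormal (resS h) (resS fun x => -(l ^ 2 * (l + 1) : ℝ) * h x) := by
  have hs := hh.smooth
  have s1 := fun j => contDiff_pderiv j hs
  have hl : IsSH l fun x => l * h x := (SH l).smul_mem (l : ℝ) hh
  refine ⟨ballSob 2 h hs, sphSob 2 _ hl.smooth, ?_, isTrace_smooth hs,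
    ⟨fun i => resS (pderiv i h), fun i => isTrace_smooth (s1 i), ?_⟩, ?_⟩
  · have hd := fun j => contDiff_pderiv j (s1 j)
    have h1 := toL2_sum (μ := volOm) Finset.univ (fun _ => 1)
      (f := fun j => pderiv j (pderiv j h)) fun j => memLp_ball (hd j).continuous
    simp only [one_mul, one_smul] at h1
    refine Eq.trans h1.symm ?_
    have h2 : (fun x => ∑ j, pderiv j (pderiv j h) x) = fun x => (0 : ℝ) := by
      ext x; exact hh.harmonic x
    rw [h2]
    have := toL2_const_mul (μ := volOm) (f := fun _ => (0 : ℝ)) 0 MemLp.zero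
    simpa using this
  · have h1 : ∀ j, resS (pderiv j h) =ᵐ[sigma] fun x : Sph => pderiv j h x := fun j =>
      coeFn_toL2 (memLp_sphere (s1 j).continuous)
    have h2 : base (sphSob 2 _ hl.smooth) =ᵐ[sigma] fun x : Sph => l * h x :=
      coeFn_toL2 (memLp_sphere hl.smooth.continuous)
    filter_upwards [h2, ae_all_iff.2 h1] with x hx hx1
    rw [hx, ← hh.euler]
    simp only [hx1]
  · have hd := fun j => contDiff_rderiv j (contDiff_rderiv j hl.smooth)
    have h1 := toL2_sum (μ := sigma) Finset.univ (fun _ => 1)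
      (f := fun j (x : Sph) => rderiv j (rderiv j fun x => l * h x) x) fun j =>
      memLp_sphere (hd j).continuous
    simp only [one_mul, one_smul] at h1
    refine Eq.trans ?_ h1
    simp only [hl.sum_rderiv_rderiv]
    unfold resS
    congr 1
    ext x
    ring

/-! ### Curves -/

/-- A curve on `[0, T]`, extended to the line as a constant on both sides. -/
def extend {T : ℝ} {H : Type*} (hT : 0 ≤ T) (f : Icc (0 : ℝ) T → H) (s : ℝ) : H :=
  f (projIcc 0 T hT s)

theorem continuous_extend {T : ℝ} {H : Type*} [TopologicalSpace H] (hT : 0 ≤ T)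
    (f : C(Icc (0 : ℝ) T, H)) : Continuous (extend hT f) :=
  f.continuous.comp continuous_projIcc

theorem extend_coe {T : ℝ} {H : Type*} (hT : 0 ≤ T) (f : Icc (0 : ℝ) T → H) (t : Icc (0 : ℝ) T) :
    extend hT f t = f t := by
  rw [extend, projIcc_val]

section curves

variable {T : ℝ} {H K : Type*} [NormedAddCommGroup H] [NormedSpace ℝ H]
  [NormedAddCommGroup K] [NormedSpace ℝ K]

theorem HasTimeDeriv.clm {f g : Icc (0 : ℝ) T → H} (h : HasTimeDeriv f g) (L : H →L[ℝ] K) :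
    HasTimeDeriv (fun t => L (f t)) (fun t => L (g t)) := by
  intro t
  refine ((L.continuous.tendsto _).comp (h t)).congr fun s => ?_
  simp only [Function.comp_apply, map_smul, map_sub]

theorem HasTimeDeriv.add {f g f' g' : Icc (0 : ℝ) T → H} (h : HasTimeDeriv f g)
    (h' : HasTimeDeriv f' g') : HasTimeDeriv (fun t => f t + f' t) (fun t => g t + g' t) := by
  intro t
  refine ((h t).add (h' t)).congr fun s => ?_
  rw [← smul_add]
  congr 1
  exact (add_sub_add_comm _ _ _ _).symm

theorem HasTimeDeriv.const_smul {f g : Icc (0 : ℝ) T → H} (h : HasTimeDeriv f g) (c : ℝ) :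
    HasTimeDeriv (fun t => c • f t) (fun t => c • g t) := by
  intro t
  refine ((h t).const_smul c).congr fun s => ?_
  rw [smul_comm, smul_sub]

theorem hasTimeDeriv_of_hasDerivAt {F G : ℝ → H} (h : ∀ t, HasDerivAt F (G t) t) :
    HasTimeDeriv (fun t : Icc (0 : ℝ) T => F t) (fun t => G t) := by
  intro t
  have h1 := hasDerivAt_iff_tendsto_slope.1 (h t)
  have h2 : Tendsto (fun s : Icc (0 : ℝ) T => (s : ℝ)) (𝓝[≠] t) (𝓝[≠] (t : ℝ)) :=
    tendsto_nhdsWithin_iff.2 ⟨(continuous_subtype_val.tendsto t).mono_left nhdsWithin_le_nhds, by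
      filter_upwards [self_mem_nhdsWithin] with s hs
      exact fun h => hs (Subtype.ext h)⟩
  exact h1.comp h2

theorem HasTimeDeriv.hasDerivAt (hT : 0 ≤ T) {f g : Icc (0 : ℝ) T → H} (h : HasTimeDeriv f g)
    {s : ℝ} (hs : s ∈ Ioo 0 T) : HasDerivAt (extend hT f) (extend hT g s) s := by
  rw [hasDerivAt_iff_tendsto_slope]
  have hs' : s ∈ Icc 0 T := Ioo_subset_Icc_self hs
  have e : ∀ r (hr : r ∈ Icc 0 T), projIcc 0 T hT r = ⟨r, hr⟩ := fun r hr => projIcc_of_mem hT hr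
  have hI : ∀ᶠ r in 𝓝[≠] s, r ∈ Icc 0 T :=
    nhdsWithin_le_nhds (Icc_mem_nhds hs.1 hs.2)
  have h2 : Tendsto (projIcc 0 T hT) (𝓝[≠] s) (𝓝[≠] ⟨s, hs'⟩) := by
    refine tendsto_nhdsWithin_iff.2 ⟨?_, ?_⟩
    · have := (continuous_projIcc (h := hT)).tendsto s
      rw [e s hs'] at this
      exact this.mono_left nhdsWithin_le_nhds
    · filter_upwards [self_mem_nhdsWithin, hI] with r hr hrI
      rw [e r hrI]
      exact fun h => hr (congrArg Subtype.val h)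
  have h3 := (h ⟨s, hs'⟩).comp h2
  have e2 : extend hT g s = g ⟨s, hs'⟩ := by rw [extend, e s hs']
  rw [e2]
  refine h3.congr' ?_
  filter_upwards [hI] with r hr
  simp only [Function.comp_apply, slope, extend, e r hr, e s hs', vsub_eq_sub]

theorem HasTimeDeriv.continuous {f g : Icc (0 : ℝ) T → H} (h : HasTimeDeriv f g) : Continuous f := by
  rw [continuous_iff_continuousAt]
  intro t
  have h1 : Tendsto (fun s : Icc (0 : ℝ) T => ((s : ℝ) - t) • (((s : ℝ) - t)⁻¹ • (f s - f t)) + f t)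
      (𝓝[≠] t) (𝓝 ((((t : ℝ) - t)) • g t + f t)) := by
    refine (Tendsto.smul ?_ (h t)).add tendsto_const_nhds
    exact ((continuous_subtype_val.tendsto t).sub tendsto_const_nhds).mono_left nhdsWithin_le_nhds
  rw [sub_self, zero_smul, zero_add] at h1
  refine continuousAt_iff_punctured_nhds.2 (h1.congr' ?_)
  filter_upwards [self_mem_nhdsWithin] with s hs
  rw [smul_inv_smul₀ (sub_ne_zero.2 fun h => hs (Subtype.ext h)), sub_add_cancel]

theorem HasTimeDeriv.integral_eq [CompleteSpace H] (hT : 0 ≤ T) {f : Icc (0 : ℝ) T → H}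
    {g : C(Icc (0 : ℝ) T, H)} (h : HasTimeDeriv f g) (t : Icc (0 : ℝ) T) :
    ∫ s in (0 : ℝ)..t, extend hT g s = f t - f ⟨0, le_rfl, hT⟩ := by
  have h1 := intervalIntegral.integral_eq_sub_of_hasDeriv_right_of_le t.2.1
    (f := extend hT f) (f' := extend hT g)
    ((h.continuous.comp continuous_projIcc).continuousOn)
    (fun s hs => (h.hasDerivAt hT ⟨hs.1, hs.2.trans_le t.2.2⟩).hasDerivWithinAt)
    ((continuous_extend hT g).intervalIntegrable _ _)
  rw [h1, extend_coe, extend, projIcc_left]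

theorem hasTimeDeriv_of_integral_eq [CompleteSpace H] (hT : 0 ≤ T) {f : Icc (0 : ℝ) T → H}
    {g : C(Icc (0 : ℝ) T, H)}
    (h : ∀ t : Icc (0 : ℝ) T, ∫ s in (0 : ℝ)..t, extend hT g s = f t - f ⟨0, le_rfl, hT⟩) :
    HasTimeDeriv f g := by
  have h1 : HasTimeDeriv (fun t : Icc (0 : ℝ) T => ∫ s in (0 : ℝ)..t, extend hT g s)
      (fun t => extend hT g t) := hasTimeDeriv_of_hasDerivAt fun t =>
    intervalIntegral.integral_hasDerivAt_right
      ((continuous_extend hT g).intervalIntegrable _ _)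
      ((continuous_extend hT g).stronglyMeasurableAtFilter _ _) (continuous_extend hT g).continuousAt
  intro t
  have h2 := h1 t
  simp only [extend_coe] at h2
  refine h2.congr fun s => ?_
  rw [h s, h t]
  congr 1
  abel

end curves

section X32

variable {T : ℝ}

theorem isClosed_X32 (hT : 0 ≤ T) :
    IsClosed (X32 T : Set (WithLp 1 (C(Icc (0 : ℝ) T, H32S) × C(Icc (0 : ℝ) T, H0S)))) := by
  have h1 : (X32 T : Set (WithLp 1 (C(Icc (0 : ℝ) T, H32S) × C(Icc (0 : ℝ) T, H0S)))) =
      ⋂ t : Icc (0 : ℝ) T, {w | ∫ s in (0 : ℝ)..t, extend hT w.snd s =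
        baseHalfL (w.fst t) - baseHalfL (w.fst ⟨0, le_rfl, hT⟩)} := by
    ext w
    simp only [mem_iInter]
    exact ⟨fun h t => HasTimeDeriv.integral_eq hT h t, fun h => hasTimeDeriv_of_integral_eq hT h⟩
  rw [h1]
  refine isClosed_iInter fun t => isClosed_eq ?_ ?_
  · have h2 : Continuous fun p : C(Icc (0 : ℝ) T, H0S) × ℝ => extend hT p.1 p.2 := by
      have : Continuous fun p : C(Icc (0 : ℝ) T, H0S) × ℝ => p.1 (projIcc 0 T hT p.2) :=
        ContinuousEval.continuous_eval.comp
          (continuous_fst.prodMk ((continuous_projIcc (h := hT)).comp continuous_snd))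
      exact this
    have h3 : Continuous fun v : C(Icc (0 : ℝ) T, H0S) => ∫ s in (0 : ℝ)..t, extend hT v s :=
      intervalIntegral.continuous_parametric_intervalIntegral_of_continuous' h2 _ _
    exact h3.comp (by fun_prop)
  · have h2 : ∀ t : Icc (0 : ℝ) T, Continuous fun w : WithLp 1 (C(Icc (0 : ℝ) T, H32S) ×
        C(Icc (0 : ℝ) T, H0S)) => w.fst t := fun t => by fun_prop
    exact (baseHalfL.continuous.comp (h2 t)).sub (baseHalfL.continuous.comp (h2 _))

theorem completeSpace_X32 (hT : 0 ≤ T) : CompleteSpace (X32 T) :=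
  (isClosed_X32 hT).completeSpace_coe

/-- The value at time `t` of a curve in `X^{3/2}_T(∂Ω)`. -/
def evL (t : Icc (0 : ℝ) T) : X32 T →L[ℝ] H32S where
  toFun w := w.1.fst t
  map_add' _ _ := rfl
  map_smul' _ _ := rfl
  cont := by fun_prop

/-- The velocity at time `t` of a curve in `X^{3/2}_T(∂Ω)`. -/
def evL' (t : Icc (0 : ℝ) T) : X32 T →L[ℝ] H0S where
  toFun w := w.1.snd t
  map_add' _ _ := rfl
  map_smul' _ _ := rfl
  cont := by fun_prop

theorem norm_X32_le {w : X32 T} {A B : ℝ} (hA : 0 ≤ A) (hB : 0 ≤ B)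
    (h : ∀ t, ‖w.1.fst t‖ ≤ A) (h' : ∀ t, ‖w.1.snd t‖ ≤ B) : ‖w‖ ≤ A + B := by
  have h1 : ‖w‖ = ‖w.1‖ := rfl
  rw [h1, WithLp.prod_norm_eq_of_L1]
  exact add_le_add ((ContinuousMap.norm_le _ hA).2 h) ((ContinuousMap.norm_le _ hB).2 h')

/-- The set `X^3_T(∂Ω)` is a linear subspace of `X^{3/2}_T(∂Ω)`. -/
def X3S (T : ℝ) : Submodule ℝ (X32 T) where
  carrier := X3 T
  zero_mem' := ⟨⟨0, fun t => rfl⟩, ⟨0, fun t => rfl, fun t => by simpa using tendsto_const_nhds⟩,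
    ⟨0, fun t => by simpa using tendsto_const_nhds⟩⟩
  add_mem' := by
    rintro a b ⟨⟨f, hf⟩, ⟨f', hf', hfd⟩, f'', hf''⟩ ⟨⟨g, hg⟩, ⟨g', hg', hgd⟩, g'', hg''⟩
    refine ⟨⟨f + g, fun t => ?_⟩, ⟨f' + g', fun t => ?_, hfd.add hgd⟩, ⟨f'' + g'', hf''.add hg''⟩⟩
    · exact congrArg₂ (· + ·) (hf t) (hg t)
    · exact congrArg₂ (· + ·) (hf' t) (hg' t)
  smul_mem' := by
    rintro c a ⟨⟨f, hf⟩, ⟨f', hf', hfd⟩, f'', hf''⟩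
    refine ⟨⟨c • f, fun t => ?_⟩, ⟨c • f', fun t => ?_, hfd.const_smul c⟩,
      ⟨c • f'', hf''.const_smul c⟩⟩
    · exact congrArg (c • ·) (hf t)
    · exact congrArg (c • ·) (hf' t)

end X32

/-! ### The oscillator equation -/

/-- The solution of `φ'' + aφ = 0`, `φ(0) = 1`, `φ'(0) = 0`. -/
def cs (a t : ℝ) : ℝ := Real.cos (√a * t)

/-- The solution of `φ'' + aφ = 0`, `φ(0) = 0`, `φ'(0) = 1`. -/
def sn (a t : ℝ) : ℝ := if a = 0 then t else Real.sin (√a * t) / √a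

section oscillator

variable {a : ℝ}

theorem sqrt_mul_sn (t : ℝ) (ha : 0 ≤ a) : √a * sn a t = Real.sin (√a * t) := by
  by_cases h : a = 0
  · simp [h]
  · rw [sn, if_neg h, mul_div_cancel₀ _ (Real.sqrt_ne_zero'.2 (lt_of_le_of_ne ha (Ne.symm h)))]

theorem cs_sq_add (t : ℝ) (ha : 0 ≤ a) : cs a t ^ 2 + a * sn a t ^ 2 = 1 := by
  have h := sqrt_mul_sn t ha
  have h2 := Real.sq_sqrt ha
  rw [← Real.sin_sq_add_cos_sq (√a * t), ← h, cs]
  nth_rewrite 2 [← h2]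
  ring

theorem hasDerivAt_cs (t : ℝ) (ha : 0 ≤ a) : HasDerivAt (cs a) (-(a * sn a t)) t := by
  have h1 := ((hasDerivAt_id t).const_mul (√a)).cos
  have h2 := sqrt_mul_sn t ha
  have h3 := Real.mul_self_sqrt ha
  have h4 : -(a * sn a t) = -Real.sin (√a * id t) * (√a * 1) := by
    rw [id, ← h2]
    nth_rewrite 1 [← h3]
    ring
  rw [h4]
  exact h1

theorem hasDerivAt_sn (t : ℝ) (ha : 0 ≤ a) : HasDerivAt (sn a) (cs a t) t := by
  by_cases h : a = 0
  · subst h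
    have : sn 0 = id := by ext s; simp [sn]
    rw [this]
    simpa [cs] using hasDerivAt_id t
  · have h0 : √a ≠ 0 := Real.sqrt_ne_zero'.2 (lt_of_le_of_ne ha (Ne.symm h))
    have h1 := (((hasDerivAt_id t).const_mul (√a)).sin).div_const (√a)
    have h2 : sn a = fun s => Real.sin (√a * id s) / √a := by ext s; simp [sn, h]
    rw [h2]
    refine h1.congr_deriv ?_
    simp only [cs, id]
    field_simp

theorem continuous_cs (a : ℝ) : Continuous (cs a) := by unfold cs; fun_prop

theorem continuous_sn (ha : 0 ≤ a) : Continuous (sn a) :=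
  continuous_iff_continuousAt.2 fun t => (hasDerivAt_sn t ha).continuousAt

theorem cs_zero (a : ℝ) : cs a 0 = 1 := by simp [cs]

theorem sn_zero (a : ℝ) : sn a 0 = 0 := by simp [sn]

theorem abs_sn_le (ha : 0 ≤ a) (t : ℝ) : |sn a t| ≤ |t| := by
  by_cases h : a = 0
  · simp [sn, h]
  · have h0 : 0 < √a := Real.sqrt_pos.2 (lt_of_le_of_ne ha (Ne.symm h))
    rw [sn, if_neg h, abs_div, abs_of_pos h0, div_le_iff₀ h0]
    refine Real.abs_sin_le_abs.trans (le_of_eq ?_)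
    rw [abs_mul, abs_of_pos h0, mul_comm]

/-- Duhamel's formula gives a solution of `φ'' + aφ = χ`. -/
theorem exists_oscillator (ha : 0 ≤ a) {χ : ℝ → ℝ} (hχ : Continuous χ) :
    ∃ φ φ' : ℝ → ℝ, φ 0 = 0 ∧ φ' 0 = 0 ∧ (∀ t, HasDerivAt φ (φ' t) t) ∧
      ∀ t, HasDerivAt φ' (χ t - a * φ t) t := by
  have hA : ∀ t, HasDerivAt (fun t => ∫ s in (0 : ℝ)..t, cs a s * χ s) (cs a t * χ t) t := fun t =>
    ((continuous_cs a).mul hχ).integral_hasStrictDerivAt 0 t |>.hasDerivAt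
  have hB : ∀ t, HasDerivAt (fun t => ∫ s in (0 : ℝ)..t, sn a s * χ s) (sn a t * χ t) t := fun t =>
    ((continuous_sn ha).mul hχ).integral_hasStrictDerivAt 0 t |>.hasDerivAt
  refine ⟨fun t => sn a t * (∫ s in (0 : ℝ)..t, cs a s * χ s) -
      cs a t * ∫ s in (0 : ℝ)..t, sn a s * χ s,
    fun t => cs a t * (∫ s in (0 : ℝ)..t, cs a s * χ s) +
      a * sn a t * ∫ s in (0 : ℝ)..t, sn a s * χ s, by simp, by simp, fun t => ?_, fun t => ?_⟩
  · have := ((hasDerivAt_sn t ha).mul (hA t)).sub ((hasDerivAt_cs t ha).mul (hB t))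
    refine this.congr_deriv ?_
    ring
  · have := ((hasDerivAt_cs t ha).mul (hA t)).add (((hasDerivAt_sn t ha).const_mul a).mul (hB t))
    refine this.congr_deriv ?_
    linear_combination χ t * cs_sq_add t ha

/-- Duhamel's formula. -/
theorem duhamel (ha : 0 ≤ a) {φ φ' φ'' : ℝ → ℝ} {t : ℝ} (ht : 0 ≤ t) (c0 : ContinuousOn φ (Icc 0 t))
    (c1 : ContinuousOn φ' (Icc 0 t)) (c2 : Continuous fun s => φ'' s + a * φ s)
    (h1 : ∀ s ∈ Ioo 0 t, HasDerivAt φ (φ' s) s) (h2 : ∀ s ∈ Ioo 0 t, HasDerivAt φ' (φ'' s) s) :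
    φ t = cs a t * φ 0 + sn a t * φ' 0 + (∫ s in (0 : ℝ)..t, sn a (t - s) * (φ'' s + a * φ s)) ∧
    φ' t = -(a * sn a t) * φ 0 + cs a t * φ' 0 +
      ∫ s in (0 : ℝ)..t, cs a (t - s) * (φ'' s + a * φ s) := by
  have s1 : ∀ s, HasDerivAt (fun s => sn a (t - s)) (-cs a (t - s)) s := fun s =>
    (hasDerivAt_sn (t - s) ha).comp_const_sub t s
  have s2 : ∀ s, HasDerivAt (fun s => cs a (t - s)) (a * sn a (t - s)) s := fun s => by
    simpa using (hasDerivAt_cs (t - s) ha).comp_const_sub t s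
  have k1 : Continuous fun s => sn a (t - s) := (continuous_sn ha).comp (by fun_prop)
  have k2 : Continuous fun s => cs a (t - s) := (continuous_cs a).comp (by fun_prop)
  have i1 := intervalIntegral.integral_eq_sub_of_hasDeriv_right_of_le ht
    (f := fun s => sn a (t - s) * φ' s + cs a (t - s) * φ s)
    (f' := fun s => sn a (t - s) * (φ'' s + a * φ s))
    ((k1.continuousOn.mul c1).add (k2.continuousOn.mul c0)) (fun s hs => by
      refine HasDerivAt.hasDerivWithinAt ?_
      refine (((s1 s).mul (h2 s hs)).add ((s2 s).mul (h1 s hs))).congr_deriv ?_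
      ring) ((k1.mul c2).intervalIntegrable _ _)
  have i2 := intervalIntegral.integral_eq_sub_of_hasDeriv_right_of_le ht
    (f := fun s => cs a (t - s) * φ' s - a * sn a (t - s) * φ s)
    (f' := fun s => cs a (t - s) * (φ'' s + a * φ s))
    ((k2.continuousOn.mul c1).sub ((continuous_const.mul k1).continuousOn.mul c0)) (fun s hs => by
      refine HasDerivAt.hasDerivWithinAt ?_
      refine (((s2 s).mul (h2 s hs)).sub (((s1 s).const_mul a).mul (h1 s hs))).congr_deriv ?_
      ring) ((k2.mul c2).intervalIntegrable _ _)
  simp only [sub_self, sn_zero, cs_zero, sub_zero] at i1 i2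
  constructor
  · rw [i1]; ring
  · rw [i2]; ring

end oscillator

/-! ### Duhamel functionals and the energy estimate -/

theorem sum_inner_sq_le {ι H : Type*} [NormedAddCommGroup H] [InnerProductSpace ℝ H]
    [DecidableEq ι] {z : ι → H} {μ : ι → ℝ} {C : ℝ} (hC : 0 ≤ C)
    (hz : ∀ i j, ⟪z i, z j⟫_ℝ = if i = j then μ i else 0) (hμ : ∀ i, μ i ≤ C) (s : Finset ι) (g : H) :
    ∑ i ∈ s, ⟪z i, g⟫_ℝ ^ 2 ≤ C * ‖g‖ ^ 2 := by
  set S := ∑ i ∈ s, ⟪z i, g⟫_ℝ ^ 2 with hS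
  have h0 : 0 ≤ S := Finset.sum_nonneg fun _ _ => sq_nonneg _
  have h1 := norm_sq_sum_smul z μ hz s fun i => ⟪z i, g⟫_ℝ
  have h2 : ∑ i ∈ s, μ i * ⟪z i, g⟫_ℝ ^ 2 ≤ C * S := by
    rw [hS, Finset.mul_sum]
    exact Finset.sum_le_sum fun i _ => mul_le_mul_of_nonneg_right (hμ i) (sq_nonneg _)
  have h3 : ⟪∑ i ∈ s, ⟪z i, g⟫_ℝ • z i, g⟫_ℝ = S := by
    rw [sum_inner]
    exact Finset.sum_congr rfl fun i _ => by rw [inner_smul_left, RCLike.conj_to_real, sq]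
  have h4 : S ^ 2 ≤ C * S * ‖g‖ ^ 2 := by
    rw [← h3]
    refine (sq_le_sq' ?_ (real_inner_le_norm _ _)).trans ?_
    · have := abs_le.1 (abs_real_inner_le_norm (∑ i ∈ s, ⟪z i, g⟫_ℝ • z i) g)
      exact this.1
    · rw [mul_pow, h1, h3]
      exact mul_le_mul_of_nonneg_right h2 (sq_nonneg _)
  rcases h0.eq_or_lt with h5 | h5
  · rw [← h5]; positivity
  · refine le_of_mul_le_mul_left ?_ h5
    nlinarith

theorem norm_sq_le_of_coeff {v : H0S} {C : ℝ} (h : ∀ s : Finset Idx, ∑ i ∈ s, ⟪eb i, v⟫_ℝ ^ 2 ≤ C) :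
    ‖v‖ ^ 2 ≤ C := by
  rw [← eb.repr.norm_map v]
  have h1 := lp.norm_rpow_eq_tsum (p := 2) (by norm_num) (eb.repr v)
  simp only [ENNReal.toReal_ofNat, Real.rpow_two, Real.norm_eq_abs, sq_abs] at h1
  rw [h1]
  refine Real.tsum_le_of_sum_le (fun i => sq_nonneg _) fun s => ?_
  simpa only [eb.repr_apply_apply] using h s

theorem norm_sq_le_of_duhamel [DecidableEq Idx] {H : Type*} [NormedAddCommGroup H]
    [InnerProductSpace ℝ H] {v x y : H0S} {G : H} {α β μ : Idx → ℝ} {z : Idx → H} {A B C : ℝ}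
    (hC : 0 ≤ C) (hv : ∀ i, ⟪eb i, v⟫_ℝ = ⟪z i, G⟫_ℝ + α i * ⟪eb i, x⟫_ℝ + β i * ⟪eb i, y⟫_ℝ)
    (hα : ∀ i, α i ^ 2 ≤ A) (hβ : ∀ i, β i ^ 2 ≤ B)
    (hz : ∀ i j, ⟪z i, z j⟫_ℝ = if i = j then μ i else 0) (hμ : ∀ i, μ i ≤ C) (hA : 0 ≤ A)
    (hB : 0 ≤ B) :
    ‖v‖ ^ 2 ≤ 3 * (C * ‖G‖ ^ 2 + A * ‖x‖ ^ 2 + B * ‖y‖ ^ 2) := by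
  refine norm_sq_le_of_coeff fun s => ?_
  have h1 := sum_inner_sq_le hC hz hμ s G
  have hb : ∀ u : H0S, ∑ i ∈ s, ⟪eb i, u⟫_ℝ ^ 2 ≤ ‖u‖ ^ 2 := fun u => by
    simpa using eb.orthonormal.sum_inner_products_le (s := s) u
  have h2 : ∀ i, ⟪eb i, v⟫_ℝ ^ 2 ≤
      3 * ⟪z i, G⟫_ℝ ^ 2 + 3 * (A * ⟪eb i, x⟫_ℝ ^ 2) + 3 * (B * ⟪eb i, y⟫_ℝ ^ 2) := fun i => by
    rw [hv]
    have k1 := mul_le_mul_of_nonneg_right (hα i) (sq_nonneg ⟪eb i, x⟫_ℝ)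
    have k2 := mul_le_mul_of_nonneg_right (hβ i) (sq_nonneg ⟪eb i, y⟫_ℝ)
    nlinarith [sq_nonneg (⟪z i, G⟫_ℝ - α i * ⟪eb i, x⟫_ℝ),
      sq_nonneg (⟪z i, G⟫_ℝ - β i * ⟪eb i, y⟫_ℝ),
      sq_nonneg (α i * ⟪eb i, x⟫_ℝ - β i * ⟪eb i, y⟫_ℝ)]
  refine (Finset.sum_le_sum fun i _ => h2 i).trans ?_
  rw [Finset.sum_add_distrib, Finset.sum_add_distrib, ← Finset.mul_sum, ← Finset.mul_sum,
    ← Finset.mul_sum, ← Finset.mul_sum, ← Finset.mul_sum]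
  nlinarith [mul_le_mul_of_nonneg_left (hb x) hA, mul_le_mul_of_nonneg_left (hb y) hB]

variable {κ T : ℝ}

/-- The kernel `1_{s ≤ t} m(t - s) Yᵢ(x)` of Duhamel's formula at time `t`. -/
def kfun (m : ℝ → ℝ) (i : Idx) (t : Icc (0 : ℝ) T) (p : Icc (0 : ℝ) T × Sph) : ℝ :=
  (Iic t).indicator (fun s => m (t - s)) p.1 * Yb i p.2

theorem memLp_indicator_kernel {m : ℝ → ℝ} (hm : Continuous m) (t : Icc (0 : ℝ) T) :
    MemLp ((Iic t).indicator fun s : Icc (0 : ℝ) T => m (t - s)) 2 (volT T) := by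
  have hc : Continuous fun s : Icc (0 : ℝ) T => m (t - s) := by fun_prop
  exact (hc.memLp_of_hasCompactSupport (HasCompactSupport.of_compactSpace _)).indicator
    measurableSet_Iic

theorem memLp_kfun {m : ℝ → ℝ} (hm : Continuous m) (i : Idx) (t : Icc (0 : ℝ) T) :
    MemLp (kfun m i t) 2 ((volT T).prod sigma) := by
  have hc : Continuous fun s : Icc (0 : ℝ) T => m (t - s) := by fun_prop
  have hY := continuous_sphere (contDiff_Yb i).continuous
  obtain ⟨A, hA⟩ := isCompact_univ.exists_bound_of_continuousOn hc.continuousOn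
  obtain ⟨B, hB⟩ := isCompact_univ.exists_bound_of_continuousOn hY.continuousOn
  refine MemLp.of_bound (Measurable.aestronglyMeasurable ?_) (A * B) (Eventually.of_forall fun p => ?_)
  · exact ((hc.measurable.indicator measurableSet_Iic).comp measurable_fst).mul
      (hY.measurable.comp measurable_snd)
  · rw [kfun, norm_mul]
    exact mul_le_mul ((norm_indicator_le_norm_self _ _).trans (hA _ (mem_univ _))) (hB _ (mem_univ _))
      (norm_nonneg _) ((norm_nonneg _).trans (hA p.1 (mem_univ _)))

theorem inner_kfun_kfun [DecidableEq Idx] {m : Idx → ℝ → ℝ} (hm : ∀ i, Continuous (m i))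
    (c : Idx → ℝ) (t : Icc (0 : ℝ) T) (i j : Idx) :
    ⟪c i • toL2 ((volT T).prod sigma) (kfun (m i) i t),
      c j • toL2 ((volT T).prod sigma) (kfun (m j) j t)⟫_ℝ = if i = j then
        ∫ s : Icc (0 : ℝ) T, (c i * (Iic t).indicator (fun s => m i (t - s)) s) ^ 2 ∂(volT T)
      else 0 := by
  rw [inner_smul_left, inner_smul_right, inner_toL2 (memLp_kfun (hm i) i t) (memLp_kfun (hm j) j t)]
  have e : ∀ p : Icc (0 : ℝ) T × Sph, kfun (m i) i t p * kfun (m j) j t p =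
      ((Iic t).indicator (fun s => m i (t - s)) p.1 *
        (Iic t).indicator (fun s => m j (t - s)) p.1) * (Yb i p.2 * Yb j p.2) := fun p => by
    simp only [kfun]; ring
  simp only [e]
  rw [integral_prod_mul (μ := volT T) (ν := sigma)
    (fun s : Icc (0 : ℝ) T => (Iic t).indicator (fun s => m i (t - s)) s *
      (Iic t).indicator (fun s => m j (t - s)) s) (fun x : Sph => Yb i x * Yb j x), integral_Yb]
  split_ifs with h
  · subst h
    rw [mul_one, RCLike.conj_to_real, ← integral_const_mul, ← integral_const_mul]
    exact integral_congr_ae (Eventually.of_forall fun s => by simp only; ring)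
  · simp

theorem integral_kernel_sq_le {m : ℝ → ℝ} (hm : Continuous m) {c M : ℝ}
    (h : ∀ s, 0 ≤ s → s ≤ T → (c * m s) ^ 2 ≤ M) (t : Icc (0 : ℝ) T) :
    ∫ s : Icc (0 : ℝ) T, (c * (Iic t).indicator (fun s => m (t - s)) s) ^ 2 ∂(volT T) ≤
      (volT T).real univ * M := by
  have hM : 0 ≤ M := (sq_nonneg _).trans (h 0 le_rfl (t.2.1.trans t.2.2))
  have h1 : ∫ s : Icc (0 : ℝ) T, (c * (Iic t).indicator (fun s => m (t - s)) s) ^ 2 ∂(volT T) ≤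
      ∫ _ : Icc (0 : ℝ) T, M ∂(volT T) := by
    refine integral_mono ((memLp_indicator_kernel hm t).const_mul c).integrable_sq
      (integrable_const M) fun s => ?_
    by_cases hs : s ∈ Iic t
    · simp only [indicator_of_mem hs]
      have h2 : (s : ℝ) ≤ t := hs
      exact h _ (by linarith) (by linarith [t.2.2, s.2.1])
    · simp only [indicator_of_notMem hs]
      simpa using hM
  rwa [integral_const, smul_eq_mul] at h1

/-- The squared frequency of the `i`-th mode. -/
def freq (κ : ℝ) (i : Idx) : ℝ := κ * lam i

theorem lam_nonneg (i : Idx) : 0 ≤ lam i := by unfold lam; positivity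

theorem freq_nonneg (hκ : 0 < κ) (i : Idx) : 0 ≤ freq κ i := mul_nonneg hκ.le (lam_nonneg i)

theorem wt_mul_sn_sq_le (hκ : 0 < κ) (i : Idx) {t : ℝ} (h0 : 0 ≤ t) (hT : t ≤ T) :
    (wt i * sn (freq κ i) t) ^ 2 ≤ T ^ 2 + 4 / κ := by
  have hf := freq_nonneg hκ i
  have h4 : 0 < 4 / κ := by positivity
  rw [mul_pow, wt_sq]
  rcases Nat.eq_zero_or_pos (deg i) with h | h
  · have h1 := abs_sn_le hf t
    rw [abs_of_nonneg h0] at h1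
    have h2 := sq_le_sq' (by linarith [abs_le.1 h1]) ((abs_le.1 h1).2.trans hT)
    rw [h]
    simp only [Nat.cast_zero, add_zero, one_pow, one_mul]
    linarith
  · have h1 : (1 : ℝ) ≤ deg i := by exact_mod_cast h
    have h2 := cs_sq_add t hf
    have h3 : (1 + deg i : ℝ) ^ 3 ≤ 4 / κ * freq κ i := by
      have e : 4 / κ * freq κ i = 4 * lam i := by unfold freq; field_simp
      rw [e, lam]
      have : (1 + deg i : ℝ) ^ 2 ≤ 4 * deg i ^ 2 := by nlinarith
      nlinarith
    have h5 : freq κ i * sn (freq κ i) t ^ 2 ≤ 1 := by nlinarith [sq_nonneg (cs (freq κ i) t)]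
    calc _ ≤ 4 / κ * freq κ i * sn (freq κ i) t ^ 2 :=
          mul_le_mul_of_nonneg_right h3 (sq_nonneg _)
      _ ≤ 4 / κ * 1 := by rw [mul_assoc]; exact mul_le_mul_of_nonneg_left h5 h4.le
      _ ≤ _ := by nlinarith [sq_nonneg T]

theorem cs_sq_le (hκ : 0 < κ) (i : Idx) (t : ℝ) : cs (freq κ i) t ^ 2 ≤ 1 := by
  have h1 := freq_nonneg hκ i
  have := cs_sq_add t h1
  nlinarith [mul_nonneg h1 (sq_nonneg (sn (freq κ i) t))]

theorem freq_mul_sn_sq_le (hκ : 0 < κ) (i : Idx) (t : ℝ) :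
    (-(freq κ i * sn (freq κ i) t) * (wt i)⁻¹) ^ 2 ≤ κ := by
  have h1 := freq_nonneg hκ i
  have h2 := cs_sq_add t h1
  have h3 : freq κ i * sn (freq κ i) t ^ 2 ≤ 1 := by nlinarith [sq_nonneg (cs (freq κ i) t)]
  have h4 : freq κ i ≤ κ * wt i ^ 2 := by
    rw [wt_sq, freq, lam]
    have h0 : (0 : ℝ) ≤ deg i := Nat.cast_nonneg _
    refine mul_le_mul_of_nonneg_left ?_ hκ.le
    nlinarith [mul_nonneg h0 h0]
  have h5 : (-(freq κ i * sn (freq κ i) t) * (wt i)⁻¹) ^ 2 =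
      freq κ i * (freq κ i * sn (freq κ i) t ^ 2) * (wt i ^ 2)⁻¹ := by
    have := (wt_pos i).ne'
    field_simp
  rw [h5, mul_inv_le_iff₀ (by have := wt_pos i; positivity)]
  exact (mul_le_of_le_one_right h1 h3).trans h4

/-- The linear functional of the data with given coefficients of the initial values and a given
kernel for the inhomogeneity. -/
def duh (i : Idx) (k : L2T T) (α β : ℝ) : Data T →L[ℝ] ℝ :=
  (innerSL ℝ k).comp (ContinuousLinearMap.fst ℝ (L2T T) (H32S × H0S)) +
    α • ((innerSL ℝ (eb i)).comp baseHalfL).comp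
      ((ContinuousLinearMap.fst ℝ H32S H0S).comp (ContinuousLinearMap.snd ℝ (L2T T) (H32S × H0S))) +
    β • (innerSL ℝ (eb i)).comp
      ((ContinuousLinearMap.snd ℝ H32S H0S).comp (ContinuousLinearMap.snd ℝ (L2T T) (H32S × H0S)))

theorem duh_apply (i : Idx) (k : L2T T) (α β : ℝ) (d : Data T) :
    duh i k α β d = ⟪k, d.1⟫_ℝ + α * ⟪eb i, baseHalf d.2.1⟫_ℝ + β * ⟪eb i, d.2.2⟫_ℝ := rfl

/-- Duhamel's formula for the `i`-th coefficient at time `t`. -/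
def duhPos (κ : ℝ) (i : Idx) (t : Icc (0 : ℝ) T) : Data T →L[ℝ] ℝ :=
  duh i (toL2 _ (kfun (sn (freq κ i)) i t)) (cs (freq κ i) t) (sn (freq κ i) t)

/-- Duhamel's formula for the time derivative of the `i`-th coefficient at time `t`. -/
def duhVel (κ : ℝ) (i : Idx) (t : Icc (0 : ℝ) T) : Data T →L[ℝ] ℝ :=
  duh i (toL2 _ (kfun (cs (freq κ i)) i t)) (-(freq κ i * sn (freq κ i) t)) (cs (freq κ i) t)

/-- The `i`-th coefficient of a curve at time `t`. -/
def modePos (i : Idx) (t : Icc (0 : ℝ) T) : X32 T →L[ℝ] ℝ :=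
  (innerSL ℝ (eb i)).comp (baseHalfL.comp (evL t))

/-- The `i`-th coefficient of the velocity of a curve at time `t`. -/
def modeVel (i : Idx) (t : Icc (0 : ℝ) T) : X32 T →L[ℝ] ℝ :=
  (innerSL ℝ (eb i)).comp (evL' t)

/-- The coefficients of the curve are given in terms of the data by Duhamel's formula. -/
def IsDuhamel (κ : ℝ) (d : Data T) (w : X32 T) : Prop :=
  ∀ (i : Idx) (t : Icc (0 : ℝ) T), modePos i t w = duhPos κ i t d ∧ modeVel i t w = duhVel κ i t d

set_option maxHeartbeats 1000000 in
/-- The energy estimate: Bessel's inequality for the orthogonal family of Duhamel kernels. The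
weight `(1 + l)³` of `H^{3/2}(∂Ω)` is compensated by the factor `(κ l² (l + 1))^{-1/2}` of the sine
solution, and by the length of the interval for `l = 0`. -/
theorem exists_norm_le (hκ : 0 < κ) (T : ℝ) : ∃ C : ℝ, 0 ≤ C ∧
    ∀ (d : Data T) (w : X32 T), IsDuhamel κ d w → ‖w‖ ≤ C * ‖d‖ := by
  classical
  set M := T ^ 2 + 4 / κ with hM
  have hM0 : 0 ≤ M := by positivity
  set V := (volT T).real univ with hV
  have hV0 : 0 ≤ V := measureReal_nonneg
  set C1 := ‖Bw‖ * √(3 * (V * M + 1 * ‖Jw‖ ^ 2 + M)) with hC1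
  set C2 := √(3 * (V * 1 + κ * ‖Jw‖ ^ 2 + 1)) with hC2
  have hC10 : 0 ≤ C1 := by positivity
  have hC20 : 0 ≤ C2 := by positivity
  refine ⟨C1 + C2, by positivity, fun d w h => ?_⟩
  have d0 := norm_nonneg d
  have d1 : ‖d.1‖ ≤ ‖d‖ := norm_fst_le d
  have d2 : ‖d.2.1‖ ≤ ‖d‖ := (norm_fst_le d.2).trans (norm_snd_le d)
  have d3 : ‖d.2.2‖ ≤ ‖d‖ := (norm_snd_le d.2).trans (norm_snd_le d)
  have q1 : ‖d.1‖ ^ 2 ≤ ‖d‖ ^ 2 := by gcongr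
  have q2 : ‖Jw d.2.1‖ ^ 2 ≤ ‖Jw‖ ^ 2 * ‖d‖ ^ 2 := by
    rw [← mul_pow]
    have := (Jw.le_opNorm d.2.1).trans (mul_le_mul_of_nonneg_left d2 (norm_nonneg _))
    gcongr
  have q3 : ‖d.2.2‖ ^ 2 ≤ ‖d‖ ^ 2 := by gcongr
  have hx : ∀ i, ⟪eb i, baseHalf d.2.1⟫_ℝ = (wt i)⁻¹ * ⟪eb i, Jw d.2.1⟫_ℝ := fun i => by
    rw [inner_Jw, inv_mul_cancel_left₀ (wt_pos i).ne']
  rw [add_mul]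
  refine norm_X32_le (by positivity) (by positivity) (fun t => ?_) fun t => ?_
  · have hv : ∀ i, ⟪eb i, Jw (w.1.fst t)⟫_ℝ =
        ⟪wt i • toL2 ((volT T).prod sigma) (kfun (sn (freq κ i)) i t), d.1⟫_ℝ +
          cs (freq κ i) t * ⟪eb i, Jw d.2.1⟫_ℝ + wt i * sn (freq κ i) t * ⟪eb i, d.2.2⟫_ℝ := by
      intro i
      have h1 : ⟪eb i, baseHalf (w.1.fst t)⟫_ℝ = duhPos κ i t d := (h i t).1
      rw [inner_Jw, h1, duhPos, duh_apply, hx, inner_smul_left, RCLike.conj_to_real]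
      have := (wt_pos i).ne'
      field_simp
    have h2 := norm_sq_le_of_duhamel (C := V * M) (A := 1) (B := M) (by positivity) hv
      (fun i => cs_sq_le hκ i t) (fun i => wt_mul_sn_sq_le hκ i t.2.1 t.2.2)
      (inner_kfun_kfun (fun i => continuous_sn (freq_nonneg hκ i)) wt t)
      (fun i => integral_kernel_sq_le (continuous_sn (freq_nonneg hκ i))
        (fun s h0 h1 => wt_mul_sn_sq_le hκ i h0 h1) t) zero_le_one hM0
    have h3 : ‖Jw (w.1.fst t)‖ ≤ √(3 * (V * M + 1 * ‖Jw‖ ^ 2 + M)) * ‖d‖ := by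
      refine le_of_sq_le_sq ?_ (by positivity)
      rw [mul_pow, Real.sq_sqrt (by positivity)]
      nlinarith [mul_le_mul_of_nonneg_left q1 (mul_nonneg hV0 hM0),
        mul_le_mul_of_nonneg_left q3 hM0]
    calc ‖w.1.fst t‖ = ‖Bw (Jw (w.1.fst t))‖ := by rw [Bw_Jw]
      _ ≤ ‖Bw‖ * ‖Jw (w.1.fst t)‖ := Bw.le_opNorm _
      _ ≤ ‖Bw‖ * (√(3 * (V * M + 1 * ‖Jw‖ ^ 2 + M)) * ‖d‖) := by gcongr
      _ = C1 * ‖d‖ := by rw [hC1]; ring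
  · have hv : ∀ i, ⟪eb i, w.1.snd t⟫_ℝ =
        ⟪(1 : ℝ) • toL2 ((volT T).prod sigma) (kfun (cs (freq κ i)) i t), d.1⟫_ℝ +
          (-(freq κ i * sn (freq κ i) t) * (wt i)⁻¹) * ⟪eb i, Jw d.2.1⟫_ℝ +
          cs (freq κ i) t * ⟪eb i, d.2.2⟫_ℝ := by
      intro i
      have h1 : ⟪eb i, w.1.snd t⟫_ℝ = duhVel κ i t d := (h i t).2
      rw [h1, duhVel, duh_apply, hx, one_smul]
      ring
    have h2 := norm_sq_le_of_duhamel (C := V * 1) (A := κ) (B := 1) (by positivity) hv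
      (fun i => freq_mul_sn_sq_le hκ i t) (fun i => cs_sq_le hκ i t)
      (inner_kfun_kfun (fun i => continuous_cs (freq κ i)) (fun _ => 1) t)
      (fun i => integral_kernel_sq_le (continuous_cs (freq κ i))
        (fun s _ _ => by rw [one_mul]; exact cs_sq_le hκ i s) t) hκ.le zero_le_one
    refine le_of_sq_le_sq ?_ (by positivity)
    rw [mul_pow, Real.sq_sqrt (by positivity)]
    nlinarith [mul_le_mul_of_nonneg_left q1 hV0, mul_le_mul_of_nonneg_left q2 hκ.le]

theorem inner_kfun {m γ : ℝ → ℝ} (hm : Continuous m) (i : Idx) (t : Icc (0 : ℝ) T) (G : L2T T)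
    (hγ : ∀ᵐ s ∂(volT T), ∫ x : Sph, G (s, x) * Yb i x ∂sigma = γ (s : ℝ)) :
    ⟪toL2 ((volT T).prod sigma) (kfun m i t), G⟫_ℝ = ∫ s in (0 : ℝ)..t, m (t - s) * γ s := by
  have hk := memLp_kfun hm i t
  rw [real_inner_comm, inner_toL2_right _ hk, integral_prod _ (integrable_L2_mul G hk)]
  have h1 : ∫ s : Icc (0 : ℝ) T, (∫ x : Sph, G (s, x) * kfun m i t (s, x) ∂sigma) ∂(volT T) =
      ∫ s : Icc (0 : ℝ) T, (Iic (t : ℝ)).indicator (fun s => m (t - s) * γ s) (s : ℝ) ∂(volT T) := by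
    refine integral_congr_ae ?_
    filter_upwards [hγ] with s hs
    have e : ∀ x : Sph, G (s, x) * kfun m i t (s, x) =
        (Iic t).indicator (fun s => m (t - s)) s * (G (s, x) * Yb i x) := fun x => by
      simp only [kfun]; ring
    simp only [e]
    rw [integral_const_mul, hs]
    by_cases h : s ≤ t
    · rw [indicator_of_mem (show s ∈ Iic t from h), indicator_of_mem (show (s : ℝ) ∈ Iic (t : ℝ) from h)]
    · rw [indicator_of_notMem (show s ∉ Iic t from h),
        indicator_of_notMem (show (s : ℝ) ∉ Iic (t : ℝ) from h), zero_mul]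
  rw [h1, integral_subtype_comap measurableSet_Icc
    (fun s : ℝ => (Iic (t : ℝ)).indicator (fun s => m (t - s) * γ s) s),
    setIntegral_indicator measurableSet_Iic, intervalIntegral.integral_of_le t.2.1,
    ← integral_Icc_eq_integral_Ioc]
  congr 2
  ext s
  simp only [mem_inter_iff, mem_Icc, mem_Iic]
  exact ⟨fun h => ⟨h.1.1, h.2⟩, fun h => ⟨⟨h.1, h.2.trans t.2.2⟩, h.2⟩⟩

set_option maxHeartbeats 1000000 in
/-- The coefficients of a solution are given by Duhamel's formula. -/
theorem IsL.isDuhamel (hκ : 0 < κ) {w : X32 T} {d : Data T} (h : IsL κ w d) :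
    IsDuhamel κ d w := by
  obtain ⟨-, ⟨w'', q, hw'', hq, hae⟩, h0⟩ := h
  intro i t
  have hT : 0 ≤ T := t.2.1.trans t.2.2
  have hf := freq_nonneg hκ i
  let f0 : Icc (0 : ℝ) T → ℝ := fun t => innerSL ℝ (eb i) (baseHalf (w.1.fst t))
  let f1 : Icc (0 : ℝ) T → ℝ := fun t => innerSL ℝ (eb i) (w.1.snd t)
  let f2 : Icc (0 : ℝ) T → ℝ := fun t => innerSL ℝ (eb i) (w'' t)
  have hd0 : HasTimeDeriv f0 f1 := HasTimeDeriv.clm w.2 _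
  have hd1 : HasTimeDeriv f1 f2 := hw''.clm _
  have c0 : Continuous (extend hT f0) := hd0.continuous.comp continuous_projIcc
  have c1 : Continuous (extend hT f1) := hd1.continuous.comp continuous_projIcc
  have c2 : Continuous (extend hT f2) :=
    ((innerSL ℝ (eb i)).continuous.comp w''.continuous).comp continuous_projIcc
  have hsub : ∀ s ∈ Ioo (0 : ℝ) t, s ∈ Ioo 0 T := fun s hs => ⟨hs.1, hs.2.trans_le t.2.2⟩
  obtain ⟨e1, e2⟩ := duhamel hf t.2.1 c0.continuousOn c1.continuousOn
    (c2.add (continuous_const.mul c0)) (fun s hs => hd0.hasDerivAt hT (hsub s hs))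
    (fun s hs => hd1.hasDerivAt hT (hsub s hs))
  have hγ : ∀ᵐ s ∂(volT T), ∫ x : Sph, d.1 (s, x) * Yb i x ∂sigma =
      extend hT f2 (s : ℝ) + freq κ i * extend hT f0 (s : ℝ) := by
    filter_upwards [hae] with s hs
    have k1 : ∫ x : Sph, d.1 (s, x) * Yb i x ∂sigma =
        ∫ x : Sph, (w'' s - κ • q s : H0S) x * Yb i x ∂sigma := by
      refine integral_congr_ae ?_
      filter_upwards [hs] with x hx
      rw [hx]
    rw [k1, ← inner_toL2_right _ (memLp_sphere (contDiff_Yb i).continuous)]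
    have k2 : toL2 sigma (fun x : Sph => Yb i x) = eb i := (eb_eq i).symm
    rw [k2, real_inner_comm, inner_sub_right, inner_smul_right, (hq s).inner_eq i, extend_coe,
      extend_coe]
    simp only [f0, f2, innerSL_apply_apply, freq]
    ring
  have z := h0 ⟨0, le_rfl, hT⟩ rfl
  have z0 : extend hT f0 0 = ⟪eb i, baseHalf d.2.1⟫_ℝ := by
    rw [extend, projIcc_left, z.1]
    rfl
  have z1 : extend hT f1 0 = ⟪eb i, d.2.2⟫_ℝ := by
    rw [extend, projIcc_left, z.2]
    rfl
  rw [extend_coe, z0, z1] at e1 e2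
  rw [← inner_kfun (continuous_sn hf) i t d.1 hγ] at e1
  rw [← inner_kfun (continuous_cs _) i t d.1 hγ] at e2
  constructor
  · refine e1.trans ?_
    rw [duhPos, duh_apply]
    ring
  · refine e2.trans ?_
    rw [duhVel, duh_apply]
    ring

/-! ### Operators defined by linear relations -/

section relation

variable {D X : Type*} [NormedAddCommGroup D] [NormedSpace ℝ D] [NormedAddCommGroup X]
  [NormedSpace ℝ X]

/-- The relation "`p j w = q j d` for all `j`" between `d` and `w` is linear and closed. If
`w` is bounded by `d` and the relation is solvable for a total set of `d`, it is a bounded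
operator. -/
theorem exists_clm_of_relation [CompleteSpace X] {ι : Type*} {p : ι → X →L[ℝ] ℝ}
    {q : ι → D →L[ℝ] ℝ} {A : Set D} {C : ℝ} (hC0 : 0 ≤ C)
    (hC : ∀ d w, (∀ j, p j w = q j d) → ‖w‖ ≤ C * ‖d‖)
    (hA : Dense (Submodule.span ℝ A : Set D)) (hRA : ∀ d ∈ A, ∃ w, ∀ j, p j w = q j d) :
    ∃ S : D →L[ℝ] X, ∀ d w, (∀ j, p j w = q j d) → S d = w := by
  have hsub : ∀ d d' w w', (∀ j, p j w = q j d) → (∀ j, p j w' = q j d') →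
      ∀ j, p j (w - w') = q j (d - d') := fun d d' w w' h h' j => by
    rw [map_sub, map_sub, h, h']
  have huniq : ∀ d w w', (∀ j, p j w = q j d) → (∀ j, p j w' = q j d) → w = w' :=
    fun d w w' h h' => by
      have := hC _ _ (hsub _ _ _ _ h h')
      rw [sub_self, norm_zero, mul_zero] at this
      exact sub_eq_zero.1 (norm_le_zero_iff.1 this)
  let M : Submodule ℝ D :=
    { carrier := {d | ∃ w, ∀ j, p j w = q j d}
      zero_mem' := ⟨0, fun j => by rw [map_zero, map_zero]⟩
      add_mem' := fun ⟨w, hw⟩ ⟨w', hw'⟩ => ⟨w + w', fun j => by rw [map_add, map_add, hw, hw']⟩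
      smul_mem' := fun c _ ⟨w, hw⟩ => ⟨c • w, fun j => by rw [map_smul, map_smul, hw]⟩ }
  -- The bound makes the domain of the relation closed.
  have hM : IsClosed (M : Set D) := by
    refine IsSeqClosed.isClosed fun d d₀ hd hlim => ?_
    choose w hw using hd
    have hc : CauchySeq w := by
      refine Metric.cauchySeq_iff'.2 fun ε hε => ?_
      obtain ⟨N, hN⟩ := Metric.cauchySeq_iff'.1 hlim.cauchySeq (ε / (C + 1)) (by positivity)
      refine ⟨N, fun n hn => ?_⟩
      have h1 := hC _ _ (hsub _ _ _ _ (hw n) (hw N))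
      have h2 := hN n hn
      rw [dist_eq_norm, lt_div_iff₀ (by positivity)] at h2
      rw [dist_eq_norm]
      nlinarith [norm_nonneg (d n - d N)]
    obtain ⟨w₀, hw₀⟩ := cauchySeq_tendsto_of_complete hc
    exact ⟨w₀, fun j => tendsto_nhds_unique (((p j).continuous.tendsto w₀).comp hw₀)
      ((((q j).continuous.tendsto d₀).comp hlim).congr fun n => (hw n j).symm)⟩
  have hall : ∀ d, ∃ w, ∀ j, p j w = q j d := fun d =>
    closure_minimal (Submodule.span_le.2 hRA : Submodule.span ℝ A ≤ M) hM (hA d)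
  choose s hs using hall
  let S : D →ₗ[ℝ] X :=
    { toFun := s
      map_add' := fun d d' => huniq _ _ _ (hs (d + d')) fun j => by
        rw [map_add, map_add, hs, hs]
      map_smul' := fun c d => huniq _ _ _ (hs (c • d)) fun j => by
        rw [RingHom.id_apply, map_smul, map_smul, hs] }
  exact ⟨S.mkContinuous C fun d => hC d (s d) (hs d), fun d w h => huniq _ _ _ (hs d) h⟩

theorem eq_of_dense_span {A : Set D} (hA : Dense (Submodule.span ℝ A : Set D)) {S S' : D →L[ℝ] X}
    (h : ∀ d ∈ A, ∃ w, S d = w ∧ S' d = w) : S = S' :=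
  ContinuousLinearMap.ext_on hA fun d hd => by
    obtain ⟨w, h1, h2⟩ := h d hd
    rw [h1, h2]

theorem mem_closure_of_dense_span {A : Set D} (hA : Dense (Submodule.span ℝ A : Set D))
    {S : D →L[ℝ] X} {V : Submodule ℝ X} (h : ∀ d ∈ A, ∃ w ∈ V, S d = w) (d : D) :
    S d ∈ closure (V : Set X) := by
  have h1 : Submodule.span ℝ A ≤ V.comap (S : D →ₗ[ℝ] X) := Submodule.span_le.2 fun d hd => by
    obtain ⟨w, hw, e⟩ := h d hd
    exact (congrArg (· ∈ V) e).mpr hw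
  exact map_mem_closure S.continuous (hA d) fun x hx => h1 hx

end relation

/-! ### The solution operator -/

section modes

variable {T κ : ℝ} {l : ℕ} {h : E3 → ℝ} {φ φ' φ'' : ℝ → ℝ}

/-- The element of `X^{3/2}_T(∂Ω)` with a given value and velocity. -/
def mkX32 (f : C(Icc (0 : ℝ) T, H32S)) (g : C(Icc (0 : ℝ) T, H0S))
    (h : HasTimeDeriv (fun t => baseHalf (f t)) g) : X32 T :=
  ⟨WithLp.toLp 1 (f, g), h⟩

/-- The curve `φ(t) v`. -/
def smulCurve {H : Type*} [NormedAddCommGroup H] [NormedSpace ℝ H] (T : ℝ) (hφ : Continuous φ)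
    (v : H) : C(Icc (0 : ℝ) T, H) :=
  ⟨fun t => φ t • v, (hφ.comp continuous_subtype_val).smul continuous_const⟩

theorem hasTimeDeriv_smulCurve {H : Type*} [NormedAddCommGroup H] [NormedSpace ℝ H]
    (hφ : ∀ t, HasDerivAt φ (φ' t) t) (c0 : Continuous φ) (c1 : Continuous φ') (v : H) :
    HasTimeDeriv (smulCurve T c0 v) (smulCurve T c1 v) :=
  hasTimeDeriv_of_hasDerivAt fun t => (hφ t).smul_const v

/-- The curve `φ(t) h` for a solid harmonic `h`. -/
def modeCurve (T : ℝ) (hh : IsSH l h) (hφ : ∀ t, HasDerivAt φ (φ' t) t) (c0 : Continuous φ)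
    (c1 : Continuous φ') : X32 T :=
  mkX32 (smulCurve T c0 (solid32 hh)) (smulCurve T c1 (resS h))
    (hasTimeDeriv_smulCurve hφ c0 c1 (resS h))

/-- If `φ'' + κ l² (l + 1) φ = g`, then `ℒ (φ h) = (g h, φ(0) h, φ'(0) h)`. -/
theorem isL_modeCurve (hh : IsSH l h) (hφ : ∀ t, HasDerivAt φ (φ' t) t)
    (hφ' : ∀ t, HasDerivAt φ' (φ'' t) t) (c0 : Continuous φ) (c1 : Continuous φ')
    (c2 : Continuous φ'') {G : L2T T}
    (hG : G =ᵐ[(volT T).prod sigma] fun p =>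
      (φ'' p.1 + κ * (l ^ 2 * (l + 1)) * φ p.1) * h p.2) :
    IsL κ (modeCurve T hh hφ c0 c1) (G, φ 0 • solid32 hh, φ' 0 • resS h) := by
  have d1 : HasTimeDeriv (smulCurve T c1 (resS h)) (smulCurve T c2 (resS h)) :=
    hasTimeDeriv_smulCurve hφ' c1 c2 _
  refine ⟨⟨⟨smulCurve T c0 (sphSob 3 h hh.smooth), fun t => rfl⟩,
    ⟨smulCurve T c1 (solid32 hh), fun t => rfl, hasTimeDeriv_smulCurve hφ c0 c1 _⟩, _, d1⟩,
    ⟨_, fun t => φ t • resS fun x => -(l ^ 2 * (l + 1) : ℝ) * h x, d1, fun t => ?_, ?_⟩, ?_⟩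
  · have hm : IsSH l fun x => φ t * h x := (SH l).smul_mem (φ t) hh
    have h1 := hm.isLapNormal
    have m0 := memLp_sphere hh.smooth.continuous
    have e1 : resS (fun x => φ t * h x) = φ t • resS h := toL2_const_mul _ m0
    have e2 : resS (fun x => -(l ^ 2 * (l + 1) : ℝ) * (φ t * h x)) =
        φ t • resS fun x => -(l ^ 2 * (l + 1) : ℝ) * h x := by
      have : resS (fun x => φ t * (-(l ^ 2 * (l + 1) : ℝ) * h x)) =
          φ t • resS fun x => -(l ^ 2 * (l + 1) : ℝ) * h x := toL2_const_mul _ (m0.const_mul _)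
      rw [← this]
      congr 1
      ext x
      ring
    rw [e1, e2] at h1
    exact h1
  · have m0 := memLp_sphere hh.smooth.continuous
    filter_upwards [Measure.ae_ae_of_ae_prod hG] with t ht
    have e : smulCurve T c2 (resS h) t - κ • φ t • resS (fun x => -(l ^ 2 * (l + 1) : ℝ) * h x) =
        (φ'' t + κ * (l ^ 2 * (l + 1)) * φ t) • resS h := by
      have : resS (fun x => -(l ^ 2 * (l + 1) : ℝ) * h x) = (-(l ^ 2 * (l + 1) : ℝ)) • resS h :=
        toL2_const_mul _ m0
      rw [this, smul_smul, smul_smul]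
      change φ'' t • resS h - _ = _
      rw [← sub_smul]
      congr 1
      ring
    rw [e]
    filter_upwards [ht, Lp.coeFn_smul (φ'' t + κ * (l ^ 2 * (l + 1)) * φ t) (resS h),
      coeFn_toL2 m0] with x h1 h2 h3
    rw [h2, Pi.smul_apply, smul_eq_mul]
    exact h1.trans (by rw [← h3]; rfl)
  · rintro t ht
    constructor
    · change _ = φ t • solid32 hh
      rw [ht]
    · change _ = φ' t • resS h
      rw [ht]

end modes

variable {T κ : ℝ}

theorem isL_sine_mode (hκ : 0 < κ) (T : ℝ) (i : Idx) : ∃ w : X32 T, IsL κ w (0, 0, eb i) := by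
  have hf := freq_nonneg hκ i
  have := isL_modeCurve (T := T) (κ := κ) (isSH_Yb i) (φ := sn (freq κ i)) (φ' := cs (freq κ i))
    (φ'' := fun t => -(freq κ i * sn (freq κ i) t)) (fun t => hasDerivAt_sn t hf)
    (fun t => hasDerivAt_cs t hf) (continuous_sn hf) (continuous_cs _)
    (continuous_const.mul (continuous_sn hf)).neg (G := 0) (by
      filter_upwards [Lp.coeFn_zero ℝ 2 ((volT T).prod sigma)] with p hp
      rw [hp, freq, lam]
      simp only [Pi.zero_apply]
      ring)
  rw [sn_zero, cs_zero, zero_smul, one_smul, ← eb_eq] at this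
  exact ⟨_, this⟩

theorem isL_cosine_mode (hκ : 0 < κ) (T : ℝ) (i : Idx) : ∃ w : X32 T, IsL κ w (0, h32 i, 0) := by
  have hf := freq_nonneg hκ i
  have := isL_modeCurve (T := T) (κ := κ) (isSH_Yb i) (φ := cs (freq κ i))
    (φ' := fun t => -(freq κ i * sn (freq κ i) t))
    (φ'' := fun t => -(freq κ i * cs (freq κ i) t)) (fun t => hasDerivAt_cs t hf)
    (fun t => ((hasDerivAt_sn t hf).const_mul _).neg)
    (continuous_cs _) (continuous_const.mul (continuous_sn hf)).neg
    (continuous_const.mul (continuous_cs _)).neg (G := 0) (by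
      filter_upwards [Lp.coeFn_zero ℝ 2 ((volT T).prod sigma)] with p hp
      rw [hp, freq, lam]
      simp only [Pi.zero_apply]
      ring)
  simp only [sn_zero, cs_zero, mul_zero, neg_zero, zero_smul, one_smul] at this
  exact ⟨_, this⟩

theorem memLp_tensor (χ : C(Icc (0 : ℝ) T, ℝ)) {h : E3 → ℝ} (hh : Continuous h) :
    MemLp (fun p : Icc (0 : ℝ) T × Sph => χ p.1 * h p.2) 2 ((volT T).prod sigma) := by
  exact Continuous.memLp_of_hasCompactSupport ((χ.continuous.comp continuous_fst).mul
    (hh.comp (continuous_subtype_val.comp continuous_snd))) (HasCompactSupport.of_compactSpace _)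

theorem isL_forced_mode (hκ : 0 < κ) (hT : 0 ≤ T) {l : ℕ} {h : E3 → ℝ} (hh : IsSH l h)
    (χ : C(Icc (0 : ℝ) T, ℝ)) :
    ∃ w : X32 T, IsL κ w (toL2 ((volT T).prod sigma) fun p => χ p.1 * h p.2, 0, 0) := by
  have ha : 0 ≤ κ * (l ^ 2 * (l + 1) : ℝ) := by positivity
  have cχ := continuous_extend hT χ
  obtain ⟨φ, φ', h0, h1, hφ, hφ'⟩ := exists_oscillator ha cχ
  have c0 : Continuous φ := continuous_iff_continuousAt.2 fun t => (hφ t).continuousAt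
  have c1 : Continuous φ' := continuous_iff_continuousAt.2 fun t => (hφ' t).continuousAt
  have := isL_modeCurve (T := T) (κ := κ) hh hφ hφ' c0 c1 (cχ.sub (continuous_const.mul c0))
    (G := toL2 ((volT T).prod sigma) fun p => χ p.1 * h p.2) (by
      filter_upwards [coeFn_toL2 (memLp_tensor χ hh.smooth.continuous)] with p hp
      rw [hp, extend_coe, sub_add_cancel])
  rw [h0, h1, zero_smul, zero_smul] at this
  exact ⟨_, this⟩

/-- The products of continuous functions of time with spherical harmonics are total in
`L²([0, T] × ∂Ω)`. -/
theorem tensor_eq_zero {u : L2T T}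
    (h : ∀ (χ : C(Icc (0 : ℝ) T, ℝ)) l f, IsSH l f →
      ∫ p : Icc (0 : ℝ) T × Sph, u p * (χ p.1 * f p.2) ∂((volT T).prod sigma) = 0) : u = 0 := by
  let G : Set C(Icc (0 : ℝ) T × Sph, ℝ) :=
    {g | ∃ (χ : C(Icc (0 : ℝ) T, ℝ)) (l : ℕ) (f : E3 → ℝ), IsSH l f ∧ ∀ p, g p = χ p.1 * f p.2}
  have hG : ∀ (χ : C(Icc (0 : ℝ) T, ℝ)) {l f} (hf : IsSH l f),
      (⟨fun p => χ p.1 * f p.2, (χ.continuous.comp continuous_fst).mul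
        (hf.smooth.continuous.comp (continuous_subtype_val.comp continuous_snd))⟩ :
        C(Icc (0 : ℝ) T × Sph, ℝ)) ∈ Submodule.span ℝ G := fun χ {l f} hf =>
    Submodule.subset_span ⟨χ, l, f, hf, fun _ => rfl⟩
  -- The cylinder is embedded in space by `(t, x) ↦ (1 + t) x`.
  let r : C(Icc (0 : ℝ) T, ℝ) := ⟨fun t => 1 + t, continuous_const.add continuous_subtype_val⟩
  have hr : ∀ t, 0 < r t := fun t => add_pos_of_pos_of_nonneg one_pos t.2.1
  let j : C(Icc (0 : ℝ) T × Sph, E3) := ⟨fun p => r p.1 • (p.2 : E3),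
    (r.continuous.comp continuous_fst).smul (continuous_subtype_val.comp continuous_snd)⟩
  have hj : Function.Injective j := by
    rintro ⟨t, x⟩ ⟨s, y⟩ hp
    change r t • (x : E3) = r s • (y : E3) at hp
    have h1 := congrArg norm hp
    rw [norm_smul, norm_smul, norm_eq_of_mem_sphere, norm_eq_of_mem_sphere, mul_one, mul_one,
      Real.norm_of_nonneg (hr t).le, Real.norm_of_nonneg (hr s).le] at h1
    have h2 : t = s := Subtype.ext (add_left_cancel h1)
    subst h2
    exact Prod.ext rfl (Subtype.ext (smul_right_injective _ (hr t).ne' hp))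
  have h0 := ae_eq_zero_of_orthogonal ((volT T).prod sigma) j hj G
    ⟨1, 0, _, IsSH.one_mem, fun _ => by simp⟩ ?_ (Lp.memLp u) ?_
  · exact (Lp.eq_zero_iff_ae_eq_zero).2 h0
  · rintro g ⟨χ, l, f, hf, hgf⟩ i
    cases l with
    | zero =>
      refine ⟨_, hG (r * χ) (hf.raise_mem i), fun p => ?_⟩
      simp [hgf, IsSH.raise, hf.pderiv_eq_zero, j]
      ring
    | succ l =>
      refine ⟨_, Submodule.add_mem _ (hG (r * χ) (hf.raise_mem i))
        (Submodule.smul_mem _ (2 * (l + 1 : ℕ) + 1 : ℝ)⁻¹ (hG (r * χ) (hf.pderiv_mem i))),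
        fun p => ?_⟩
      simp [hgf, IsSH.raise, j]
      ring
  · rintro g ⟨χ, l, f, hf, hgf⟩
    simp only [hgf]
    exact h χ l f hf

theorem eq_top_of_eb_mem {N : Submodule ℝ H0S} (hN : IsClosed (N : Set H0S))
    (h : ∀ i, eb i ∈ N) : N = ⊤ := by
  rw [eq_top_iff, ← eb.dense_span]
  exact Submodule.topologicalClosure_minimal _ (Submodule.span_le.2 (by rintro _ ⟨i, rfl⟩; exact h i))
    hN

/-- The data of the solutions in `X^3_T(∂Ω)` are total in the data space. -/
theorem eq_top_of_isL (hκ : 0 < κ) (hT : 0 ≤ T) {M : Submodule ℝ (Data T)}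
    (hM : IsClosed (M : Set (Data T))) (h : ∀ w d, IsL κ w d → d ∈ M) : M = ⊤ := by
  have h1 : ∀ v : H0S, ((0, 0, v) : Data T) ∈ M := by
    let L : H0S →L[ℝ] Data T := (ContinuousLinearMap.inr ℝ (L2T T) (H32S × H0S)).comp
      (ContinuousLinearMap.inr ℝ H32S H0S)
    have : M.comap (L : H0S →ₗ[ℝ] Data T) = ⊤ := eq_top_of_eb_mem (hM.preimage L.continuous)
      fun i => by
        obtain ⟨w, hw⟩ := isL_sine_mode hκ T i
        exact h _ _ hw
    exact fun v => (Submodule.eq_top_iff'.1 this) v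
  have h2 : ∀ W : H32S, ((0, W, 0) : Data T) ∈ M := by
    let L : H32S →L[ℝ] Data T := (ContinuousLinearMap.inr ℝ (L2T T) (H32S × H0S)).comp
      (ContinuousLinearMap.inl ℝ H32S H0S)
    have : M.comap ((L.comp Bw : H0S →L[ℝ] Data T) : H0S →ₗ[ℝ] Data T) = ⊤ :=
      eq_top_of_eb_mem (hM.preimage (L.comp Bw).continuous) fun i => by
        obtain ⟨w, hw⟩ := isL_cosine_mode hκ T i
        have e : L (Bw (eb i)) = (wt i)⁻¹ • ((0, h32 i, 0) : Data T) := by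
          rw [Bw_eb, map_smul]
          rfl
        change L (Bw (eb i)) ∈ M
        rw [e]
        exact M.smul_mem _ (h _ _ hw)
    intro W
    have h3 : L (Bw (Jw W)) ∈ M := (Submodule.eq_top_iff'.1 this) (Jw W)
    rw [Bw_Jw] at h3
    exact h3
  have h3 : ∀ u : L2T T, ((u, 0, 0) : Data T) ∈ M := by
    let L : L2T T →L[ℝ] Data T := ContinuousLinearMap.inl ℝ (L2T T) (H32S × H0S)
    let N : Submodule ℝ (L2T T) := M.comap (L : L2T T →ₗ[ℝ] Data T)
    have hN : IsClosed (N : Set (L2T T)) := hM.preimage L.continuous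
    have : N.topologicalClosure = ⊤ := by
      rw [Submodule.topologicalClosure_eq_top_iff, eq_bot_iff]
      intro u hu
      refine (Submodule.mem_bot ℝ).2 (tensor_eq_zero fun χ l f hf => ?_)
      rw [← inner_toL2_right u (memLp_tensor χ hf.smooth.continuous)]
      obtain ⟨w, hw⟩ := isL_forced_mode hκ hT hf χ
      exact Submodule.inner_left_of_mem_orthogonal (show _ ∈ N from h _ _ hw) hu
    rw [hN.submodule_topologicalClosure_eq] at this
    exact fun u => (Submodule.eq_top_iff'.1 this) u
  refine Submodule.eq_top_iff'.2 fun d => ?_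
  have e : d = (d.1, 0, 0) + ((0, d.2.1, 0) + (0, 0, d.2.2)) := by
    refine Prod.ext ?_ (Prod.ext ?_ ?_) <;> simp
  rw [e]
  exact M.add_mem (h3 _) (M.add_mem (h2 _) (h1 _))

theorem dense_span_isL (hκ : 0 < κ) (hT : 0 ≤ T) :
    Dense (Submodule.span ℝ {d : Data T | ∃ w, IsL κ w d} : Set (Data T)) := by
  rw [Submodule.dense_iff_topologicalClosure_eq_top]
  exact eq_top_of_isL hκ hT (Submodule.isClosed_topologicalClosure _) fun w d h =>
    subset_closure (Submodule.subset_span ⟨w, h⟩)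

set_option maxHeartbeats 1000000 in
set_option synthInstance.maxHeartbeats 200000 in
theorem exists_extendsInverse (hκ : 0 < κ) (hT : 0 ≤ T) :
    ∃ S : Data T →L[ℝ] X32 T, ExtendsInverse κ S := by
  have := completeSpace_X32 hT
  obtain ⟨C, hC0, hC⟩ := exists_norm_le hκ T
  let p : (Idx × Icc (0 : ℝ) T) ⊕ (Idx × Icc (0 : ℝ) T) → X32 T →L[ℝ] ℝ :=
    Sum.elim (fun j => modePos j.1 j.2) fun j => modeVel j.1 j.2
  let q : (Idx × Icc (0 : ℝ) T) ⊕ (Idx × Icc (0 : ℝ) T) → Data T →L[ℝ] ℝ :=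
    Sum.elim (fun j => duhPos κ j.1 j.2) fun j => duhVel κ j.1 j.2
  have hpq : ∀ d w, (∀ j, p j w = q j d) ↔ IsDuhamel κ d w := fun d w =>
    ⟨fun h i t => ⟨h (.inl (i, t)), h (.inr (i, t))⟩, fun h j =>
      j.rec (fun k => (h k.1 k.2).1) fun k => (h k.1 k.2).2⟩
  obtain ⟨S, hS⟩ := exists_clm_of_relation (p := p) (q := q) hC0
    (fun d w h => hC d w ((hpq d w).1 h)) (dense_span_isL hκ hT)
    fun d ⟨w, hw⟩ => ⟨w, (hpq d w).2 (hw.isDuhamel hκ)⟩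
  exact ⟨S, fun w d h => hS d w ((hpq d w).2 (h.isDuhamel hκ))⟩

set_option maxHeartbeats 1000000 in
theorem ExtendsInverse.unique (hκ : 0 < κ) (hT : 0 ≤ T) {S S' : Data T →L[ℝ] X32 T}
    (h : ExtendsInverse κ S) (h' : ExtendsInverse κ S') : S = S' :=
  eq_of_dense_span (dense_span_isL hκ hT) fun d ⟨w, hw⟩ => ⟨w, h w d hw, h' w d hw⟩

set_option maxHeartbeats 1000000 in
theorem ExtendsInverse.mem_closure (hκ : 0 < κ) (hT : 0 ≤ T) {S : Data T →L[ℝ] X32 T}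
    (h : ExtendsInverse κ S) (d : Data T) : S d ∈ closure (X3 T) :=
  mem_closure_of_dense_span (V := X3S T) (dense_span_isL hκ hT)
    (fun d ⟨w, hw⟩ => ⟨w, hw.1, h w d hw⟩) d

/-- The harmonic extension maps `X^{3/2}_T(∂Ω)` to `X²_T(Ω)`. -/
theorem inX2_harmonic_extension (w : X32 T) : InX2 fun t => base (E2 (w.1.fst t)) := by
  refine ⟨⟨⟨fun t => E2 (w.1.fst t), by fun_prop⟩, fun t => rfl⟩,
    ⟨fun t => E0 (baseHalfL (w.1.fst t)), by fun_prop⟩, ⟨fun t => E0 (w.1.snd t), by fun_prop⟩,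
    fun t => baseHalf_E0 _, ?_⟩
  exact HasTimeDeriv.clm w.2 E0

set_option maxHeartbeats 1000000 in
theorem existsUnique_isWeakSolution (hκ : 0 < κ) (hT : 0 ≤ T) {S : Data T →L[ℝ] X32 T}
    (hS : ExtendsInverse κ S) (G : L2T T) (f₀ : H32S) (f₁ : H0S) :
    ∃! f : Icc (0 : ℝ) T → L2 volOm, IsWeakSolution κ G f₀ f₁ f := by
  refine ⟨fun t => base (E2 ((S (G, f₀, f₁)).1.fst t)), ⟨inX2_harmonic_extension _, S (G, f₀, f₁),
    hS.mem_closure hκ hT _, fun t => ⟨_, rfl, lap_E2_and_isBdry _⟩, S, hS, rfl⟩, ?_⟩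
  rintro f ⟨-, w, -, hw, S', hS', hwS⟩
  have hwS' : w = S (G, f₀, f₁) := hwS.trans (DFunLike.congr_fun (hS'.unique hκ hT hS) _)
  subst hwS'
  ext1 t
  obtain ⟨F, hF, hF0, hFb⟩ := hw t
  obtain ⟨h0, hb⟩ := lap_E2_and_isBdry ((S (G, f₀, f₁)).1.fst t)
  exact hF.symm.trans (base_eq_of_harmonic hF0 h0 hFb hb)

end

end DynamicBoundary

open DynamicBoundary in
theorem theorem1 (κ T : ℝ) (hκ : 0 < κ) (hT : 0 < T) :
    (∃! S : Data T →L[ℝ] X32 T, ExtendsInverse κ S) ∧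
    ∀ (G : L2T T) (f₀ : H32S) (f₁ : H0S),
      ∃! f : Icc (0 : ℝ) T → L2 volOm, IsWeakSolution κ G f₀ f₁ f := by
  obtain ⟨S, hS⟩ := exists_extendsInverse hκ hT.le
  exact ⟨⟨S, hS, fun S' hS' => hS'.unique hκ hT.le hS⟩, existsUnique_isWeakSolution hκ hT.le hS⟩
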